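/- Let $n\ge 2$ and write $\hat f(p)=(2\pi)^{-n/2}\int_{\mathbb R^n}e^{-ix\cdot p}f(x)\,dx$ for the Fourier transform on $\mathbb R^n$. **Assumptions on $T$.** Let $1\le r<\infty$ and let $T(p)=|P(p)|^r$, where $P:\mathbb R^n\to\mathbb R$ is measurable and locally bounded. Assume that $S=\{p\in\mathbb R^n : T(p)=0\}$ is non-empty and has finitely many connected components, and that there are a compact set $\Omega\subset\mathbb R^n$ with $S\subset\Omega$ and numbers $\sigma>0$, $C_1>0$, $C_2>0$, $s>0$ such that every point of $S$ has distance at least $\sigma$ from $\mathbb R^n\setminus\Omega$; $P\in C^2(\Omega)$; $\nabla P\ne0$ in (the interior of) $\Omega$; and $T(p)\ge C_1|p|^s+C_2$ for $p\notin\Omega$. **Assumptions on $V$.** Let $V:\mathbb R^n\to\mathbb R$ satisfy $V\in L^1(\mathbb R^n)$ and in addition $V\in L^{n/s}(\mathbb R^n)$ if $n>s$, and $V\in L^{1+\varepsilon}(\mathbb R^n)$ for some $\varepsilon>0$ if $n=s$. If $T$ is not radial, assume $\iint|V(x)|\,|x-y|^2\,|V(y)|\,dx\,dy<\infty$; if $T$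 is radial and $n=2$, assume $\iint|V(x)|\,|x-y|\,|V(y)|\,dx\,dy<\infty$. **Operators.** For $\lambda>0$ let $H_\lambda=T+\lambda V$ be the operator on $L^2(\mathbb R^n)$ associated with the quadratic form $\psi\mapsto\int T(p)|\hat\psi(p)|^2\,dp+\lambda\int V(x)|\psi(x)|^2\,dx$ with form domain $\{\psi\in L^2(\mathbb R^n):\int T|\hat\psi|^2<\infty,\ \int|V||\psi|^2<\infty\}$. Let $\mathcal V_S$ be the operator on $L^2(S)$, with respect to the $(n-1)$-dimensional surface measure $dq$ on $S$, given by $$(\mathcal V_Su)(p)=\frac{1}{\sqrt{|\nabla P(p)|}\,(2\pi)^{n/2}}\int_S\hat V(p-q)\,\frac{u(q)}{\sqrt{|\nabla P(q)|}}\,dq .$$ **Statement.** (i) For every $\lambda>0$, the operator $H_\lambda$ has at least as many negative eigenvalues, counted with multiplicity, as $\mathcal V_S$. (ii) If $V\le 0$ almost everywhere and $V$ is not almost everywhere zero, then $\mathcal V_S$ has infinitely many (distinct) negative eigenvalues, and so does $H_\lambda$ for every $\lambda>0$. -/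

import Mathlib

open MeasureTheory
open scoped FourierTransform ComplexConjugate

noncomputable section

namespace DegenerateSymbol

/-! ### Eigenvalues of (possibly unbounded) operators, counted with multiplicity -/

section Eigenvalues

variable {X : Type*} [AddCommGroup X] [Module ℂ X]

/-- The eigenspace `ker (A - a)` of a partially defined operator `A`. -/
def eigenspace (A : X →ₗ.[ℂ] X) (a : ℝ) : Submodule ℂ X where
  carrier := {ψ | ∃ h : ψ ∈ A.domain, A ⟨ψ, h⟩ = (a : ℂ) • ψ}
  add_mem' := by
    rintro ψ φ ⟨h, e⟩ ⟨h', e'⟩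
    refine ⟨A.domain.add_mem h h', ?_⟩
    have := A.map_add ⟨ψ, h⟩ ⟨φ, h'⟩
    rw [e, e', ← smul_add] at this
    exact this
  zero_mem' := ⟨A.domain.zero_mem, by
    rw [smul_zero]
    exact A.map_zero⟩
  smul_mem' := by
    rintro c ψ ⟨h, e⟩
    refine ⟨A.domain.smul_mem c h, ?_⟩
    have := A.map_smul c ⟨ψ, h⟩
    rw [e, smul_comm] at this
    exact this

/-- The real number `a` is an eigenvalue of `A`. -/
def IsEigenvalue (A : X →ₗ.[ℂ] X) (a : ℝ) : Prop :=
  eigenspace A a ≠ ⊥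

/-- The multiplicity `dim ker (A - a)`, possibly infinite. -/
def eigenMultiplicity (A : X →ₗ.[ℂ] X) (a : ℝ) : ℕ∞ :=
  Cardinal.toENat (Module.rank ℂ (eigenspace A a))

/-- The number of negative eigenvalues of `A` counted with multiplicity, that is
`∑_{a < 0} dim ker (A - a)`, as the supremum of the finite partial sums. -/
def numNegEigenvalues (A : X →ₗ.[ℂ] X) : ℕ∞ :=
  ⨆ F : Finset {a : ℝ // a < 0}, ∑ a ∈ F, eigenMultiplicity A (a : ℝ)

end Eigenvalues

/-! ### Integral operators on `L²(μ)` -/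

/-- The maximal domain of the integral operator with kernel `k` on `L²(μ)`: the integrals
`∫ k p q u(q) dμ(q)` converge absolutely for almost every `p` and define a function in `L²(μ)`. -/
def integralDomain {X : Type*} [MeasurableSpace X] (μ : Measure X) (k : X → X → ℂ) :
    Submodule ℂ (Lp ℂ 2 μ) where
  carrier := {u | (∀ᵐ p ∂μ, Integrable (fun q => k p q * u q) μ) ∧
    MemLp (fun p => ∫ q, k p q * u q ∂μ) 2 μ}
  add_mem' := by
    rintro u v ⟨hu, hu'⟩ ⟨hv, hv'⟩
    have key : ∀ p, (fun q => k p q * (u + v : Lp ℂ 2 μ) q) =ᵐ[μ]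
        fun q => k p q * u q + k p q * v q := by
      intro p
      filter_upwards [Lp.coeFn_add u v] with q hq
      rw [hq, Pi.add_apply, mul_add]
    refine ⟨?_, ?_⟩
    · filter_upwards [hu, hv] with p h1 h2
      exact (h1.add h2).congr (key p).symm
    · refine (hu'.add hv').ae_eq ?_
      filter_upwards [hu, hv] with p h1 h2
      rw [integral_congr_ae (key p), integral_add h1 h2, Pi.add_apply]
  zero_mem' := by
    have key : ∀ p, (fun q => k p q * (0 : Lp ℂ 2 μ) q) =ᵐ[μ] fun _ => 0 := by
      intro p
      filter_upwards [Lp.coeFn_zero ℂ 2 μ] with q hq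
      rw [hq, Pi.zero_apply, mul_zero]
    refine ⟨Filter.Eventually.of_forall fun p =>
      (integrable_zero X ℂ μ).congr (key p).symm, ?_⟩
    refine (MemLp.zero (ε := ℂ)).ae_eq (Filter.Eventually.of_forall fun p => ?_)
    simp only [integral_congr_ae (key p), integral_zero, Pi.zero_apply]
  smul_mem' := by
    rintro c u ⟨hu, hu'⟩
    have key : ∀ p, (fun q => k p q * (c • u : Lp ℂ 2 μ) q) =ᵐ[μ]
        fun q => c * (k p q * u q) := by
      intro p
      filter_upwards [Lp.coeFn_smul c u] with q hq
      rw [hq, Pi.smul_apply, smul_eq_mul]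
      ring
    refine ⟨?_, ?_⟩
    · filter_upwards [hu] with p h1
      exact (h1.const_mul c).congr (key p).symm
    · refine (hu'.const_mul c).ae_eq (Filter.Eventually.of_forall fun p => ?_)
      simp only [integral_congr_ae (key p), integral_const_mul]

/-- The operator `(K u)(p) = ∫ k p q u(q) dμ(q)` on `L²(μ)` with its maximal domain. -/
def integralOperator {X : Type*} [MeasurableSpace X] (μ : Measure X) (k : X → X → ℂ) :
    Lp ℂ 2 μ →ₗ.[ℂ] Lp ℂ 2 μ where
  domain := integralDomain μ k
  toFun :=
    { toFun := fun u => MemLp.toLp (fun p => ∫ q, k p q * (u : Lp ℂ 2 μ) q ∂μ) u.2.2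
      map_add' := by
        rintro ⟨u, hu, hu'⟩ ⟨v, hv, hv'⟩
        apply Lp.ext
        refine (MemLp.coeFn_toLp _).trans
          (Filter.EventuallyEq.trans ?_ (Lp.coeFn_add _ _).symm)
        filter_upwards [hu, hv, MemLp.coeFn_toLp hu', MemLp.coeFn_toLp hv'] with p h1 h2 e1 e2
        rw [Pi.add_apply, e1, e2, ← integral_add h1 h2]
        apply integral_congr_ae
        filter_upwards [Lp.coeFn_add u v] with q hq
        simp only [Submodule.coe_add]
        rw [hq, Pi.add_apply, mul_add]
      map_smul' := by
        rintro c ⟨u, hu, hu'⟩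
        rw [RingHom.id_apply]
        apply Lp.ext
        refine (MemLp.coeFn_toLp _).trans
          (Filter.EventuallyEq.trans ?_ (Lp.coeFn_smul _ _).symm)
        filter_upwards [MemLp.coeFn_toLp hu'] with p e1
        rw [Pi.smul_apply, e1, smul_eq_mul, ← integral_const_mul]
        apply integral_congr_ae
        filter_upwards [Lp.coeFn_smul c u] with q hq
        simp only [Submodule.coe_smul]
        rw [hq, Pi.smul_apply, smul_eq_mul]
        ring }

/-! ### The setting -/

/-- Euclidean space `ℝⁿ`. -/
abbrev E (n : ℕ) : Type := EuclideanSpace ℝ (Fin n)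

/-- The Hilbert space `L²(ℝⁿ)`. -/
abbrev L2 (n : ℕ) : Type := Lp ℂ 2 (volume : Measure (E n))

variable {n : ℕ}

/-- The symbol `T(p) = |P(p)|^r`. -/
def symbol (P : E n → ℝ) (r : ℝ) (p : E n) : ℝ := |P p| ^ r

/-- The set `S = {p | T(p) = 0}`. -/
def zeroSet (P : E n → ℝ) (r : ℝ) : Set (E n) := {p | symbol P r p = 0}

/-- The symbol is radial. -/
def IsRadial (T : E n → ℝ) : Prop := ∀ p q : E n, ‖p‖ = ‖q‖ → T p = T q

/-- The assumptions on the kinetic energy `T = |P|^r`, where `S` is the zero set of `T`. -/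
structure KineticAssumptions (P : E n → ℝ) (Ω : Set (E n)) (r s : ℝ) : Prop where
  /-- The minimal value zero of `T` is attained. -/
  nonempty : (zeroSet P r).Nonempty
  finite_components : Finite (ConnectedComponents (zeroSet P r))
  isCompact : IsCompact Ω
  subset : zeroSet P r ⊆ Ω
  /-- `S` has a positive distance from the complement of `Ω`. -/
  dist_compl : ∃ σ : ℝ, 0 < σ ∧ ∀ p ∈ zeroSet P r, ∀ q ∉ Ω, σ ≤ dist p q
  one_le_r : 1 ≤ r
  measurable : AEMeasurable P
  locallyBounded : ∀ R : ℝ, ∃ C : ℝ, ∀ p : E n, ‖p‖ ≤ R → |P p| ≤ C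
  contDiffOn : ContDiffOn ℝ 2 P Ω
  /-- The gradient is required to be nonzero only at interior points of `Ω`, where it is
  unambiguous; the set `S` consists of interior points. -/
  gradient_ne_zero : ∀ p ∈ interior Ω, gradient P p ≠ 0
  s_pos : 0 < s
  growth : ∃ C₁ C₂ : ℝ, 0 < C₁ ∧ 0 < C₂ ∧ ∀ p ∉ Ω, C₁ * ‖p‖ ^ s + C₂ ≤ symbol P r p

/-- `∬ |V(x)| |x - y|^κ |V(y)| dx dy < ∞`. -/
def FiniteMoment (V : E n → ℝ) (κ : ℕ) : Prop :=
  Integrable (fun z : E n × E n => |V z.1| * ‖z.1 - z.2‖ ^ κ * |V z.2|)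
    ((volume : Measure (E n)).prod volume)

/-- The assumptions on the real-valued potential `V`, depending on the symbol `T` and on the
exponent `s` in the lower bound on `T`. -/
structure PotentialAssumptions (T : E n → ℝ) (s : ℝ) (V : E n → ℝ) : Prop where
  integrable : MemLp V 1
  memLp_of_gt : s < n → MemLp V (ENNReal.ofReal (n / s))
  memLp_of_eq : (n : ℝ) = s → ∃ ε : ℝ, 0 < ε ∧ MemLp V (ENNReal.ofReal (1 + ε))
  moment_of_not_radial : ¬ IsRadial T → FiniteMoment V 2
  moment_of_radial : IsRadial T → n = 2 → FiniteMoment V 1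

/-! ### The operator `V_S` on `L²(S)` -/

/-- The surface measure on `S`, i.e. the `(n-1)`-dimensional Hausdorff measure, normalized as
Lebesgue measure on `(n-1)`-dimensional Euclidean space. -/
def surfaceMeasure (S : Set (E n)) : Measure (E n) := (μHE[n - 1] : Measure (E n)).restrict S

/-- The Fourier transform `(2π)^{-n/2} ∫ e^{-i x⬝p} V(x) dx`. -/
def hat (V : E n → ℝ) (p : E n) : ℂ :=
  (((2 * Real.pi) ^ (-(n : ℝ) / 2) : ℝ) : ℂ) *
    ∫ x : E n, Complex.exp (-(Complex.I * (inner ℝ x p : ℝ))) * (V x : ℂ)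

/-- The operator
`(V_S u)(p) = (|∇P(p)|^{1/2} (2π)^{n/2})⁻¹ ∫_S hat V (p - q) |∇P(q)|^{-1/2} u(q) dq`
on `L²(S)`. -/
def surfaceOperator (P : E n → ℝ) (r : ℝ) (V : E n → ℝ) :
    Lp ℂ 2 (surfaceMeasure (zeroSet P r)) →ₗ.[ℂ] Lp ℂ 2 (surfaceMeasure (zeroSet P r)) :=
  integralOperator (surfaceMeasure (zeroSet P r)) fun p q =>
    ((√‖gradient P p‖ * (2 * Real.pi) ^ ((n : ℝ) / 2))⁻¹ : ℝ) * hat V (p - q) *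
      ((√‖gradient P q‖)⁻¹ : ℝ)

/-! ### The operator `H_λ = T + λ V` on `L²(ℝⁿ)` -/

/-- The form domain: `∫ T |ψ̂|² < ∞` and `∫ |V| |ψ|² < ∞`. In terms of the Fourier transform `𝓕` with
kernel `e^{-2πi x⬝ξ}`, the transform with kernel `(2π)^{-n/2} e^{-i x⬝p}` is
`ψ̂(p) = (2π)^{-n/2} (𝓕 ψ)(p / 2π)`, so that `∫ T |ψ̂|² dp = ∫ T(2πξ) |𝓕 ψ(ξ)|² dξ`. -/
def formDomain (T V : E n → ℝ) : Submodule ℂ (L2 n) where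
  carrier := {ψ | MemLp (fun ξ => (√(T ((2 * Real.pi) • ξ)) : ℂ) * (𝓕 ψ : L2 n) ξ) 2 ∧
    MemLp (fun x => (√|V x| : ℂ) * ψ x) 2}
  add_mem' := by
    rintro ψ φ ⟨h1, h2⟩ ⟨h3, h4⟩
    refine ⟨(h1.add h3).ae_eq ?_, (h2.add h4).ae_eq ?_⟩
    · rw [FourierTransform.fourier_add]
      filter_upwards [Lp.coeFn_add (𝓕 ψ : L2 n) (𝓕 φ)] with x hx
      rw [hx, Pi.add_apply, Pi.add_apply, mul_add]
    · filter_upwards [Lp.coeFn_add ψ φ] with x hx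
      rw [hx, Pi.add_apply, Pi.add_apply, mul_add]
  zero_mem' := by
    have h0 : (𝓕 (0 : L2 n) : L2 n) = 0 := (Lp.fourierTransformₗᵢ (E n) ℂ).map_zero
    refine ⟨(MemLp.zero (ε := ℂ)).ae_eq ?_, (MemLp.zero (ε := ℂ)).ae_eq ?_⟩
    · rw [h0]
      simp only [ZeroMemClass.coe_zero]
      exact Filter.Eventually.of_forall fun x => by simp
    · exact Filter.Eventually.of_forall fun x => by simp
  smul_mem' := by
    rintro c ψ ⟨h1, h2⟩
    refine ⟨(h1.const_mul c).ae_eq ?_, (h2.const_mul c).ae_eq ?_⟩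
    · rw [FourierTransform.fourier_smul]
      filter_upwards [Lp.coeFn_smul c (𝓕 ψ : L2 n)] with x hx
      rw [hx, Pi.smul_apply, smul_eq_mul, mul_left_comm]
    · filter_upwards [Lp.coeFn_smul c ψ] with x hx
      rw [hx, Pi.smul_apply, smul_eq_mul, mul_left_comm]

/-- The integrand `T(2πξ) conj (𝓕 φ(ξ)) 𝓕 ψ(ξ)` of the kinetic energy form. -/
def kineticDensity (T : E n → ℝ) (φ ψ : L2 n) (ξ : E n) : ℂ :=
  (T ((2 * Real.pi) • ξ) : ℂ) * (conj ((𝓕 φ : L2 n) ξ) * (𝓕 ψ : L2 n) ξ)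

/-- The integrand `V(x) conj (φ(x)) ψ(x)` of the potential energy form. -/
def potentialDensity (V : E n → ℝ) (φ ψ : L2 n) (x : E n) : ℂ :=
  (V x : ℂ) * (conj (φ x) * ψ x)

/-- The quadratic form of `T + c V`, as a sesquilinear form. -/
def energyForm (T V : E n → ℝ) (c : ℝ) (φ ψ : L2 n) : ℂ :=
  (∫ ξ, kineticDensity T φ ψ ξ) + c * ∫ x, potentialDensity V φ ψ x

theorem kineticDensity_add (T : E n → ℝ) (φ ψ ψ' : L2 n) :
    kineticDensity T φ (ψ + ψ') =ᵐ[volume]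
      fun ξ => kineticDensity T φ ψ ξ + kineticDensity T φ ψ' ξ := by
  unfold kineticDensity
  rw [FourierTransform.fourier_add]
  filter_upwards [Lp.coeFn_add (𝓕 ψ : L2 n) (𝓕 ψ')] with x hx
  rw [hx, Pi.add_apply]
  ring

theorem kineticDensity_smul (T : E n → ℝ) (φ ψ : L2 n) (a : ℂ) :
    kineticDensity T φ (a • ψ) =ᵐ[volume] fun ξ => a * kineticDensity T φ ψ ξ := by
  unfold kineticDensity
  rw [FourierTransform.fourier_smul]
  filter_upwards [Lp.coeFn_smul a (𝓕 ψ : L2 n)] with x hx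
  rw [hx, Pi.smul_apply, smul_eq_mul]
  ring

theorem potentialDensity_add (V : E n → ℝ) (φ ψ ψ' : L2 n) :
    potentialDensity V φ (ψ + ψ') =ᵐ[volume]
      fun x => potentialDensity V φ ψ x + potentialDensity V φ ψ' x := by
  unfold potentialDensity
  filter_upwards [Lp.coeFn_add ψ ψ'] with x hx
  rw [hx, Pi.add_apply]
  ring

theorem potentialDensity_smul (V : E n → ℝ) (φ ψ : L2 n) (a : ℂ) :
    potentialDensity V φ (a • ψ) =ᵐ[volume] fun x => a * potentialDensity V φ ψ x := by
  unfold potentialDensity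
  filter_upwards [Lp.coeFn_smul a ψ] with x hx
  rw [hx, Pi.smul_apply, smul_eq_mul]
  ring

/-- The graph of the operator `H = T + c V` associated with the quadratic form: `H ψ = g` means that
`ψ` lies in the form domain and that the form satisfies `h(φ, ψ) = ⟨φ, g⟩` for all `φ` in the form
domain. (For measurable `T` and `V`, the integrability holds for all `φ`, `ψ` in the form domain.) -/
def hamiltonianGraph (T V : E n → ℝ) (c : ℝ) : Submodule ℂ (L2 n × L2 n) where
  carrier := {z | z.1 ∈ formDomain T V ∧ ∀ φ ∈ formDomain T V,
    Integrable (kineticDensity T φ z.1) ∧ Integrable (potentialDensity V φ z.1) ∧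
      energyForm T V c φ z.1 = inner ℂ φ z.2}
  add_mem' := by
    rintro ⟨ψ, g⟩ ⟨ψ', g'⟩ ⟨h, e⟩ ⟨h', e'⟩
    refine ⟨(formDomain T V).add_mem h h', fun φ hφ => ?_⟩
    obtain ⟨a1, a2, a3⟩ := e φ hφ
    obtain ⟨b1, b2, b3⟩ := e' φ hφ
    refine ⟨(a1.add b1).congr (kineticDensity_add T φ ψ ψ').symm,
      (a2.add b2).congr (potentialDensity_add V φ ψ ψ').symm, ?_⟩
    simp only [energyForm, Prod.fst_add, Prod.snd_add, inner_add_right] at a3 b3 ⊢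
    rw [integral_congr_ae (kineticDensity_add T φ ψ ψ'),
      integral_congr_ae (potentialDensity_add V φ ψ ψ'), integral_add a1 b1, integral_add a2 b2,
      ← a3, ← b3]
    ring
  zero_mem' := by
    refine ⟨(formDomain T V).zero_mem, fun φ hφ => ?_⟩
    have k : kineticDensity T φ 0 =ᵐ[volume] fun _ => 0 := by
      have := kineticDensity_smul T φ 0 0
      simpa using this
    have v : potentialDensity V φ 0 =ᵐ[volume] fun _ => 0 := by
      have := potentialDensity_smul V φ 0 0
      simpa using this
    refine ⟨(integrable_zero _ ℂ volume).congr k.symm,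
      (integrable_zero _ ℂ volume).congr v.symm, ?_⟩
    simp only [energyForm, Prod.fst_zero, Prod.snd_zero, inner_zero_right]
    rw [integral_congr_ae k, integral_congr_ae v]
    simp
  smul_mem' := by
    rintro a ⟨ψ, g⟩ ⟨h, e⟩
    refine ⟨(formDomain T V).smul_mem a h, fun φ hφ => ?_⟩
    obtain ⟨a1, a2, a3⟩ := e φ hφ
    refine ⟨(a1.const_mul a).congr (kineticDensity_smul T φ ψ a).symm,
      (a2.const_mul a).congr (potentialDensity_smul V φ ψ a).symm, ?_⟩
    simp only [energyForm, Prod.smul_fst, Prod.smul_snd, inner_smul_right] at a3 ⊢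
    rw [integral_congr_ae (kineticDensity_smul T φ ψ a),
      integral_congr_ae (potentialDensity_smul V φ ψ a), integral_const_mul, integral_const_mul,
      ← a3]
    ring

/-- The operator `H = T + c V` on `L²(ℝⁿ)`. -/
def hamiltonian (T V : E n → ℝ) (c : ℝ) : L2 n →ₗ.[ℂ] L2 n :=
  (hamiltonianGraph T V c).toLinearPMap

/-- Under the assumptions on `T` and `V` the form domain is dense, so that the operator is well
defined: its graph is the one prescribed by the quadratic form. -/
theorem hamiltonian_graph {P V : E n → ℝ} {Ω : Set (E n)} {r s : ℝ}
    (hT : KineticAssumptions P Ω r s) (hV : PotentialAssumptions (symbol P r) s V) (c : ℝ) :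
    (hamiltonian (symbol P r) V c).graph = hamiltonianGraph (symbol P r) V c := by
  refine Submodule.toLinearPMap_graph_eq _ ?_
  rintro ⟨ψ, g⟩ ⟨-, h⟩ (rfl : ψ = 0)
  have hg : ∀ φ ∈ formDomain (symbol P r) V, inner ℂ φ g = 0 := by
    intro φ hφ
    rw [← (h φ hφ).2.2]
    have k : kineticDensity (symbol P r) φ 0 =ᵐ[volume] fun _ => 0 := by
      simpa using kineticDensity_smul (symbol P r) φ 0 0
    have v : potentialDensity V φ 0 =ᵐ[volume] fun _ => 0 := by
      simpa using potentialDensity_smul V φ 0 0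
    simp only [energyForm]
    rw [integral_congr_ae k, integral_congr_ae v]
    simp
  suffices h0 : (𝓕 g : L2 n) = 0 by
    have := Lp.norm_fourier_eq g
    rw [h0, norm_zero] at this
    exact norm_eq_zero.1 this.symm
  refine (MeasureTheory.Lp.dense_hasCompactSupport_contDiff (F := ℂ) (μ := (volume : Measure (E n)))
    (p := 2) ENNReal.ofNat_ne_top).eq_zero_of_inner_right ℂ ?_
  rintro f ⟨w, hfw, hw, hw'⟩
  set W : SchwartzMap (E n) ℂ := hw.toSchwartzMap hw' with hW
  have hf : f = W.toLp 2 := by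
    apply Lp.ext
    refine hfw.trans ?_
    filter_upwards [W.coeFn_toLp 2 volume] with x hx
    rw [hx]
    rfl
  have e : 𝓕 ((𝓕⁻ W).toLp 2) = f := by
    rw [SchwartzMap.toLp_fourier_eq, FourierTransform.fourier_fourierInv_eq, hf]
  rw [← e, Lp.inner_fourier_eq]
  refine hg _ ⟨?_, ?_⟩
  · rw [e]
    obtain ⟨R, hR⟩ := hw.isCompact.isBounded.exists_norm_le
    obtain ⟨C, hC⟩ := hT.locallyBounded (2 * Real.pi * R)
    have hm : AEMeasurable fun ξ : E n => symbol P r ((2 * Real.pi) • ξ) := by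
      have hq := Measure.quasiMeasurePreserving_smul (volume : Measure (E n))
        (r := 2 * Real.pi) (by positivity)
      exact (hT.measurable.comp_quasiMeasurePreserving hq).abs.pow_const r
    refine MemLp.of_le_mul (c := √(C ^ r)) (Lp.memLp f) ?_ ?_
    · exact (Complex.measurable_ofReal.comp_aemeasurable hm.sqrt).aestronglyMeasurable.mul
        (Lp.aestronglyMeasurable f)
    · filter_upwards [hfw] with ξ hξ
      rw [hξ, norm_mul]
      by_cases h1 : w ξ = 0
      · simp [h1]
      · have h2 : ‖ξ‖ ≤ R := hR ξ (subset_tsupport w h1)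
        have h3 : ‖(2 * Real.pi) • ξ‖ ≤ 2 * Real.pi * R := by
          rw [norm_smul, Real.norm_of_nonneg (by positivity)]
          gcongr
        gcongr
        rw [Complex.norm_real, Real.norm_of_nonneg (Real.sqrt_nonneg _)]
        refine Real.sqrt_le_sqrt (Real.rpow_le_rpow (abs_nonneg _) (hC _ h3) ?_)
        linarith [hT.one_le_r]
  · have hV1 : Integrable V := memLp_one_iff_integrable.1 hV.integrable
    have hs : MemLp (fun x => (√|V x| : ℂ)) 2 := by
      have hm : AEStronglyMeasurable (fun x => (√|V x| : ℂ)) :=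
        (Complex.measurable_ofReal.comp_aemeasurable
          hV1.aestronglyMeasurable.aemeasurable.abs.sqrt).aestronglyMeasurable
      rw [memLp_two_iff_integrable_sq_norm hm]
      refine hV1.abs.congr (Filter.Eventually.of_forall fun x => ?_)
      simp only [Complex.norm_real, Real.norm_of_nonneg (Real.sqrt_nonneg _),
        Real.sq_sqrt (abs_nonneg _)]
    have := (Lp.memLp ((𝓕⁻ W).toLp 2 volume))
    refine MemLp.of_le_mul (c := SchwartzMap.seminorm ℝ 0 0 (𝓕⁻ W)) hs
      (hs.aestronglyMeasurable.mul this.aestronglyMeasurable) ?_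
    filter_upwards [(𝓕⁻ W).coeFn_toLp 2 volume] with x hx
    rw [hx, norm_mul, mul_comm]
    gcongr
    exact SchwartzMap.norm_le_seminorm ℝ _ x

end DegenerateSymbol

end

open DegenerateSymbol

/-! Functions on the null set `S` act as trial functions for `H_λ` after a slight smearing in
momentum. For `u` in `L²(S)` let `h_u(x) = ∫_S e^{iq·x} |∇P(q)|^{-1/2} u(q) dq` (`surfaceExtend`).
Interchanging integrals gives `∫ V conj(h_u) h_v = (2π)^n ⟨u, V_S v⟩` (`exists_surface_clm`). Near
`S` the zero set is a Lipschitz graph and `T ≤ L t` at height `t` above it, because `r ≥ 1`.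
Smearing with a profile `f` of mass one costs a kinetic energy of order `∫ t f(t)² dt`, which a
logarithmic profile makes as small as desired (`exists_profile`). Thus `h_u` is a bounded pointwise
limit of `L²` functions whose kinetic energy tends to zero (`KineticAssumptions.approximable`). As
`V` is integrable, the form of `H_λ` on these functions converges to `λ (2π)^n ⟨u, V_S v⟩`. Starting
from orthonormal eigenfunctions of `V_S` with negative eigenvalues, one obtains a subspace of the
same dimension on which `H_λ` is negative (`card_le_numNegEigenvalues_of_orthonormal`).

A negative subspace yields eigenvalues because the negative spectrum of `H_λ` is discrete. A
fractional Sobolev inequality makes `V` small relative to `T + μ`. With `ψ = D f`, where `D` is the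
multiplier `(T + μ)^{-1/2}`, the form becomes `‖f‖² + ⟨f, K f⟩ - μ ‖D f‖²` with `K` compact
(`nonempty_pencilData`). Negative infima of its quotient by `‖D f‖²` are attained
(`exists_mem_pencilEigenspace`), and successive minimization counts eigenvalues
(`card_le_sum_finrank_pencilEigenspace`).

If `V ≤ 0` is not almost everywhere zero, `⟨u, V_S u⟩ = 0` forces `h_u` to vanish on a set of
positive measure. Since `S` is compact, `h_u` is entire along every line, so it vanishes identically
and `u = 0` (`extend_eq_zero_of_measure_ne_zero`, `ae_eq_zero_of_extend`). A compact operator with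
strictly negative form on the infinite-dimensional space `L²(S)` has infinitely many eigenvalues.
The comparison makes the count for `H_λ` infinite, and finite multiplicities make the eigenvalues of
`H_λ` infinitely many. -/

noncomputable section

namespace DegenerateSymbol

/-! ### Negative eigenvalues of a compactly perturbed quadratic form -/

section Pencil

open Filter Topology

variable {X Y : Type*} [NormedAddCommGroup X] [InnerProductSpace ℂ X]
  [NormedAddCommGroup Y] [InnerProductSpace ℂ Y]

/-- The sesquilinear form `⟪φ, f⟫ + ⟪φ, K f⟫ - μ ⟪D φ, D f⟫`. -/
def pform (D : X →L[ℂ] Y) (K : X →L[ℂ] X) (μ : ℝ) (φ f : X) : ℂ :=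
  inner ℂ φ f + inner ℂ φ (K f) - μ * inner ℂ (D φ) (D f)

section Algebra

variable (D : X →L[ℂ] Y) (K : X →L[ℂ] X) (μ : ℝ)

theorem pform_add_right (φ f g : X) :
    pform D K μ φ (f + g) = pform D K μ φ f + pform D K μ φ g := by
  simp only [pform, map_add, inner_add_right]; ring

theorem pform_smul_right (φ f : X) (c : ℂ) :
    pform D K μ φ (c • f) = c * pform D K μ φ f := by
  simp only [pform, map_smul, inner_smul_right]; ring

theorem pform_add_left (φ ψ f : X) :
    pform D K μ (φ + ψ) f = pform D K μ φ f + pform D K μ ψ f := by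
  simp only [pform, map_add, inner_add_left]; ring

theorem pform_smul_left (φ f : X) (c : ℂ) :
    pform D K μ (c • φ) f = conj c * pform D K μ φ f := by
  simp only [pform, map_smul, inner_smul_left]; ring

theorem pform_conj (hK : (K : X →ₗ[ℂ] X).IsSymmetric) (φ f : X) :
    conj (pform D K μ φ f) = pform D K μ f φ := by
  have := hK f φ
  simp only [ContinuousLinearMap.coe_coe] at this
  simp only [pform, map_sub, map_add, map_mul, inner_conj_symm, Complex.conj_ofReal, this]

/-- The generalized eigenspace `{f | h(φ, f) = a ⟪D φ, D f⟫ for all φ}`. -/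
def pencilEigenspace (a : ℝ) : Submodule ℂ X where
  carrier := {f | ∀ φ, pform D K μ φ f = a * inner ℂ (D φ) (D f)}
  add_mem' := by
    intro f g hf hg φ
    rw [pform_add_right, hf φ, hg φ, map_add, inner_add_right, mul_add]
  zero_mem' := by intro φ; simp [pform]
  smul_mem' := by
    intro c f hf φ
    rw [pform_smul_right, hf φ, map_smul, inner_smul_right]; ring

/-- The real quadratic form `h(f, f) - a ‖D f‖²`. -/
def pquad (a : ℝ) (f : X) : ℝ := (pform D K μ f f).re - a * ‖D f‖ ^ 2

theorem pquad_eq (a : ℝ) (f : X) :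
    pquad D K μ a f = ‖f‖ ^ 2 + (inner ℂ f (K f)).re - (μ + a) * ‖D f‖ ^ 2 := by
  have h1 : (inner ℂ f f : ℂ) = ((‖f‖ ^ 2 : ℝ) : ℂ) := by
    rw [inner_self_eq_norm_sq_to_K]; norm_cast
  have h2 : (inner ℂ (D f) (D f) : ℂ) = ((‖D f‖ ^ 2 : ℝ) : ℂ) := by
    rw [inner_self_eq_norm_sq_to_K]; norm_cast
  rw [pquad, pform, h1, h2]
  simp only [Complex.sub_re, Complex.add_re, Complex.ofReal_re, Complex.re_ofReal_mul]
  ring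

theorem pquad_smul (a : ℝ) (c : ℂ) (f : X) :
    pquad D K μ a (c • f) = ‖c‖ ^ 2 * pquad D K μ a f := by
  rw [pquad, pquad, pform_smul_left, pform_smul_right, map_smul, norm_smul, ← mul_assoc,
    mul_comm (conj c) c, Complex.mul_conj, Complex.re_ofReal_mul, Complex.normSq_eq_norm_sq]
  ring

theorem pquad_parallelogram (a : ℝ) (f g : X) :
    pquad D K μ a (f + g) + pquad D K μ a (f - g) = 2 * pquad D K μ a f + 2 * pquad D K μ a g := by
  have e := parallelogram_law_with_norm ℂ f g
  have e' := parallelogram_law_with_norm ℂ (D f) (D g)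
  simp only [pquad_eq, map_add, map_sub, inner_add_left, inner_sub_left, inner_add_right,
    inner_sub_right, Complex.add_re, Complex.sub_re]
  linear_combination e - (μ + a) * e'

theorem pquad_add (hK : (K : X →ₗ[ℂ] X).IsSymmetric) (a : ℝ) (f g : X) :
    pquad D K μ a (f + g) = pquad D K μ a f + pquad D K μ a g +
      2 * (pform D K μ g f - a * inner ℂ (D g) (D f)).re := by
  have h1 : (pform D K μ f g).re = (pform D K μ g f).re := by
    rw [← pform_conj D K μ hK g f, Complex.conj_re]
  have h2 := norm_add_sq (𝕜 := ℂ) (D f) (D g)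
  have h3 : RCLike.re (inner ℂ (D f) (D g)) = (inner ℂ (D g) (D f)).re := by
    rw [← inner_conj_symm, RCLike.re_eq_complex_re, Complex.conj_re]
  rw [h3] at h2
  simp only [pquad, pform_add_left, pform_add_right, Complex.add_re, map_add, h1, h2,
    Complex.sub_re, Complex.re_ofReal_mul]
  ring

end Algebra

variable {D : X →L[ℂ] Y} {K : X →L[ℂ] X} {μ : ℝ}

/-- For `a < 0` only `K` obstructs coercivity. If `0 ≤ μ + a`, then `hD` gives `(μ + a) ‖D f‖² ≤ (1
+ a/μ) ‖f‖²`, which leaves the factor `-a/μ`; otherwise the last term of the form has a good sign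
and leaves the factor `1`. -/
theorem norm_sq_le_pquad_add (hμ : 0 < μ) (hD : ∀ f, μ * ‖D f‖ ^ 2 ≤ ‖f‖ ^ 2) (a : ℝ) (f : X) :
    min 1 (-a / μ) * ‖f‖ ^ 2 ≤ pquad D K μ a f + ‖f‖ * ‖K f‖ := by
  have h1 : -(‖f‖ * ‖K f‖) ≤ (inner ℂ f (K f)).re := by
    have := abs_le.1 ((Complex.abs_re_le_norm _).trans (norm_inner_le_norm (𝕜 := ℂ) f (K f)))
    exact this.1
  rw [pquad_eq]
  have h2 := hD f
  have h3 : min 1 (-a / μ) * ‖f‖ ^ 2 ≤ ‖f‖ ^ 2 - (μ + a) * ‖D f‖ ^ 2 := by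
    rcases le_total 0 (μ + a) with h | h
    · have : min 1 (-a / μ) * ‖f‖ ^ 2 ≤ (-a / μ) * ‖f‖ ^ 2 := by
        gcongr; exact min_le_right _ _
      have h4 : (μ + a) * ‖D f‖ ^ 2 ≤ (μ + a) / μ * ‖f‖ ^ 2 := by
        have : (μ + a) * ‖D f‖ ^ 2 = (μ + a) / μ * (μ * ‖D f‖ ^ 2) := by field_simp
        rw [this]; gcongr
      have h5 : (μ + a) / μ = 1 + a / μ := by field_simp
      have h6 : -a / μ = -(a / μ) := by ring
      rw [h5] at h4; rw [h6] at this ⊢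
      linarith
    · have : min 1 (-a / μ) * ‖f‖ ^ 2 ≤ 1 * ‖f‖ ^ 2 := by
        gcongr; exact min_le_left _ _
      nlinarith [sq_nonneg ‖D f‖]
  linarith

/-- Compactness of `K` makes `K (u k)` converge along a subsequence; coercivity up to `K` then turns
smallness of the form on differences into the Cauchy property in norm. -/
theorem exists_subseq_tendsto_of_pquad [CompleteSpace X] (hKc : IsCompactOperator K) (hμ : 0 < μ)
    (hD : ∀ f, μ * ‖D f‖ ^ 2 ≤ ‖f‖ ^ 2) {a : ℝ} (ha : a < 0) {u : ℕ → X} {R : ℝ}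
    (hu : ∀ k, ‖u k‖ ≤ R)
    (hq : ∀ ε > 0, ∃ N, ∀ k ≥ N, ∀ l ≥ N, pquad D K μ a (u k - u l) ≤ ε) :
    ∃ f : X, ∃ θ : ℕ → ℕ, StrictMono θ ∧ Tendsto (u ∘ θ) atTop (𝓝 f) := by
  obtain ⟨Q, hQ, hKQ⟩ := IsCompactOperator.image_closedBall_subset_compact
    (f := (K : X →ₗ[ℂ] X)) hKc R
  obtain ⟨v, -, θ, hθ, hv⟩ := hQ.tendsto_subseq (x := fun k => K (u k))
    fun k => hKQ ⟨u k, by simpa using hu k, rfl⟩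
  have hR : 0 ≤ R := (norm_nonneg _).trans (hu 0)
  have hc : 0 < min 1 (-a / μ) := lt_min one_pos (by have : 0 < -a := by linarith
                                                     positivity)
  set c := min 1 (-a / μ)
  have hcs : CauchySeq (u ∘ θ) := by
    rw [Metric.cauchySeq_iff]
    intro ε hε
    obtain ⟨N, hN⟩ := hq (c * ε ^ 2 / 4) (by positivity)
    -- Differences have norm at most `2R`; the extra `1` keeps the divisor positive when `R = 0`.
    -- The form and the compact term each contribute a quarter of `c ε²`.
    obtain ⟨N', hN'⟩ := Metric.cauchySeq_iff.1 hv.cauchySeq (c * ε ^ 2 / (4 * (2 * R + 1)))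
      (by positivity)
    refine ⟨max N N', fun k hk l hl => ?_⟩
    have h1 := hN (θ k) ((le_of_max_le_left hk).trans (hθ.id_le k)) (θ l)
      ((le_of_max_le_left hl).trans (hθ.id_le l))
    have h2 := hN' k (le_of_max_le_right hk) l (le_of_max_le_right hl)
    have h3 := norm_sq_le_pquad_add (K := K) hμ hD a (u (θ k) - u (θ l))
    rw [map_sub] at h3
    simp only [Function.comp, dist_eq_norm] at h2 ⊢
    have h4 : ‖u (θ k) - u (θ l)‖ ≤ 2 * R + 1 := by
      have := norm_sub_le (u (θ k)) (u (θ l))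
      linarith [hu (θ k), hu (θ l)]
    have h5 : ‖u (θ k) - u (θ l)‖ * ‖K (u (θ k)) - K (u (θ l))‖ ≤
        (2 * R + 1) * (c * ε ^ 2 / (4 * (2 * R + 1))) := by gcongr
    have h6 : (2 * R + 1) * (c * ε ^ 2 / (4 * (2 * R + 1))) = c * ε ^ 2 / 4 := by field_simp
    have h7 : c * ‖u (θ k) - u (θ l)‖ ^ 2 < c * ε ^ 2 := by
      have : 0 < c * ε ^ 2 := by positivity
      linarith
    exact lt_of_pow_lt_pow_left₀ 2 hε.le (lt_of_mul_lt_mul_left h7 hc.le)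
  obtain ⟨f, hf⟩ := cauchySeq_tendsto_of_complete hcs
  exact ⟨f, θ, hθ, hf⟩

theorem pquad_eq_zero_of_mem {a : ℝ} {f : X} (hf : f ∈ pencilEigenspace D K μ a) :
    pquad D K μ a f = 0 := by
  have h2 : (inner ℂ (D f) (D f) : ℂ) = ((‖D f‖ ^ 2 : ℝ) : ℂ) := by
    rw [inner_self_eq_norm_sq_to_K]; norm_cast
  rw [pquad, hf f, h2, Complex.re_ofReal_mul, Complex.ofReal_re, sub_self]

theorem continuous_pform_right (φ : X) : Continuous fun f => pform D K μ φ f := by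
  unfold pform; fun_prop

theorem continuous_pquad (a : ℝ) : Continuous fun f => pquad D K μ a f := by
  simp only [pquad_eq]; fun_prop

theorem isClosed_pencilEigenspace (a : ℝ) : IsClosed (pencilEigenspace D K μ a : Set X) := by
  have : (pencilEigenspace D K μ a : Set X) =
      ⋂ φ : X, {f | pform D K μ φ f = a * inner ℂ (D φ) (D f)} := by
    ext f; simp [pencilEigenspace]
  rw [this]
  refine isClosed_iInter fun φ => isClosed_eq (continuous_pform_right φ) (by fun_prop)

/-- Riesz's criterion: the form vanishes on differences of eigenvectors, so every sequence in the
closed unit ball has a convergent subsequence. -/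
theorem finiteDimensional_pencilEigenspace [CompleteSpace X] (hKc : IsCompactOperator K)
    (hμ : 0 < μ) (hD : ∀ f, μ * ‖D f‖ ^ 2 ≤ ‖f‖ ^ 2) {a : ℝ} (ha : a < 0) :
    FiniteDimensional ℂ (pencilEigenspace D K μ a) := by
  refine FiniteDimensional.of_isCompact_closedBall₀ ℂ one_pos (isCompact_iff_isSeqCompact.2 ?_)
  intro u hu
  have hu' : ∀ k, ‖(u k : X)‖ ≤ 1 := fun k => by simpa using hu k
  obtain ⟨f, θ, hθ, hf⟩ := exists_subseq_tendsto_of_pquad hKc hμ hD ha hu' (fun ε hε => ⟨0,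
    fun k _ l _ => by
      rw [pquad_eq_zero_of_mem ((pencilEigenspace D K μ a).sub_mem (u k).2 (u l).2)]
      exact hε.le⟩)
  have hfm : f ∈ pencilEigenspace D K μ a :=
    (isClosed_pencilEigenspace a).mem_of_tendsto hf (Eventually.of_forall fun k => (u (θ k)).2)
  refine ⟨⟨f, hfm⟩, ?_, θ, hθ, tendsto_subtype_rng.2 hf⟩
  have : ‖f‖ ≤ 1 := le_of_tendsto hf.norm (Eventually.of_forall fun k => hu' (θ k))
  simpa using this

/-- A nonnegative form that vanishes at `f` annihilates `f`. -/
theorem pform_eq_of_pquad_nonneg (hK : (K : X →ₗ[ℂ] X).IsSymmetric) {M : Submodule ℂ X} {a : ℝ}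
    (hM : ∀ g ∈ M, 0 ≤ pquad D K μ a g) {f : X} (hf : f ∈ M) (hf0 : pquad D K μ a f = 0)
    {φ : X} (hφ : φ ∈ M) : pform D K μ φ f = a * inner ℂ (D φ) (D f) := by
  set z : ℂ := pform D K μ φ f - a * inner ℂ (D φ) (D f) with hz
  suffices z = 0 by exact sub_eq_zero.1 this
  have key : ∀ c : ℂ, 0 ≤ ‖c‖ ^ 2 * pquad D K μ a φ + 2 * (conj c * z).re := by
    intro c
    have h := hM _ (M.add_mem hf (M.smul_mem c hφ))
    rw [pquad_add D K μ hK, hf0, pquad_smul, pform_smul_left, map_smul, inner_smul_left] at h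
    have e : conj c * pform D K μ φ f - a * (conj c * inner ℂ (D φ) (D f)) = conj c * z := by
      rw [hz]; ring
    rw [e] at h
    linarith
  by_contra hne
  have hzp : 0 < ‖z‖ ^ 2 := by positivity
  set p := pquad D K μ a φ with hp
  have hp0 : 0 ≤ p := hM φ hφ
  -- Moving against `z` by `1/(p+1)` makes the linear gain exceed the quadratic cost; `p + 1`
  -- instead of `p` avoids a division by zero.
  have h := key (-((1 / (p + 1) : ℝ) : ℂ) * z)
  have e1 : (conj (-((1 / (p + 1) : ℝ) : ℂ) * z) * z).re = -(1 / (p + 1)) * ‖z‖ ^ 2 := by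
    rw [map_mul, mul_assoc, mul_comm (conj z) z, Complex.mul_conj, map_neg, Complex.conj_ofReal,
      ← Complex.ofReal_neg, Complex.re_ofReal_mul, Complex.ofReal_re, Complex.normSq_eq_norm_sq]
  have e2 : ‖-((1 / (p + 1) : ℝ) : ℂ) * z‖ ^ 2 = (1 / (p + 1)) ^ 2 * ‖z‖ ^ 2 := by
    rw [norm_mul, norm_neg, Complex.norm_real, mul_pow, Real.norm_eq_abs, sq_abs]
  rw [e1, e2] at h
  have e3 : (1 / (p + 1)) ^ 2 * ‖z‖ ^ 2 * p + 2 * (-(1 / (p + 1)) * ‖z‖ ^ 2) =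
      -((p + 2) / (p + 1) ^ 2 * ‖z‖ ^ 2) := by field_simp; ring
  rw [e3] at h
  have : 0 < (p + 2) / (p + 1) ^ 2 * ‖z‖ ^ 2 := by positivity
  linarith

/-- The quotient of the form by `‖D f‖²` is minimized over the `D`-orthogonal complement of `Z`; its
infimum is negative because of `w`. A minimizer satisfies the eigenvalue equation against test
vectors in this complement, and the invariance `hZ` extends it to all test vectors. -/
theorem exists_mem_pencilEigenspace [CompleteSpace X] (hKc : IsCompactOperator K)
    (hK : (K : X →ₗ[ℂ] X).IsSymmetric) (hμ : 0 < μ) (hD : ∀ f, μ * ‖D f‖ ^ 2 ≤ ‖f‖ ^ 2)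
    (hDi : Function.Injective D) (hco : ∀ f, ‖f‖ ^ 2 / 2 ≤ ‖f‖ ^ 2 + (inner ℂ f (K f)).re)
    (Z : Submodule ℂ X) [FiniteDimensional ℂ Z]
    (hZ : ∀ z ∈ Z, ∃ z' ∈ Z, ∀ φ, pform D K μ φ z = inner ℂ (D φ) (D z'))
    {w : X} (hw : ∀ z ∈ Z, inner ℂ (D z) (D w) = 0) (hwn : (pform D K μ w w).re < 0) :
    ∃ a < 0, ∃ f ≠ 0, f ∈ pencilEigenspace D K μ a ∧ ∀ z ∈ Z, inner ℂ (D z) (D f) = 0 := by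
  let M : Submodule ℂ X :=
    { carrier := {f | ∀ z ∈ Z, inner ℂ (D z) (D f) = 0}
      add_mem' := by
        intro f g hf hg z hz
        rw [map_add, inner_add_right, hf z hz, hg z hz, add_zero]
      zero_mem' := by intro z _; simp
      smul_mem' := by
        intro c f hf z hz
        rw [map_smul, inner_smul_right, hf z hz, mul_zero] }
  have hMc : IsClosed (M : Set X) := by
    have : (M : Set X) = ⋂ z ∈ Z, {f | inner ℂ (D z) (D f) = 0} := by
      ext f; simp [M]
    rw [this]
    exact isClosed_biInter fun z _ => isClosed_eq (by fun_prop) continuous_const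
  have hwM : w ∈ M := hw
  have hre : ∀ f, (pform D K μ f f).re = pquad D K μ 0 f := fun f => by simp [pquad]
  simp only [hre] at hwn
  have hlow : ∀ f, ‖f‖ ^ 2 / 2 - μ * ‖D f‖ ^ 2 ≤ pquad D K μ 0 f := by
    intro f
    rw [pquad_eq, add_zero]
    linarith [hco f]
  have hshift : ∀ a f, pquad D K μ a f = pquad D K μ 0 f - a * ‖D f‖ ^ 2 := by
    intro a f; simp only [pquad]; ring
  have hDw : 0 < ‖D w‖ := by
    rw [norm_pos_iff]
    intro h
    have : w = 0 := hDi (by rw [h, map_zero])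
    rw [this] at hwn
    simp [pquad_eq] at hwn
  have hDc : ∀ c : ℂ, ∀ f, ‖D (c • f)‖ ^ 2 = ‖c‖ ^ 2 * ‖D f‖ ^ 2 := by
    intro c f; rw [map_smul, norm_smul, mul_pow]
  set A : Set ℝ := {x | ∃ f ∈ M, ‖D f‖ = 1 ∧ pquad D K μ 0 f = x} with hA
  have hnormal : ∀ f ∈ M, 0 < ‖D f‖ → pquad D K μ 0 f / ‖D f‖ ^ 2 ∈ A := by
    intro f hf hpos
    refine ⟨((‖D f‖⁻¹ : ℝ) : ℂ) • f, M.smul_mem _ hf, ?_, ?_⟩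
    · rw [map_smul, norm_smul, Complex.norm_real, norm_inv, norm_norm, inv_mul_cancel₀ hpos.ne']
    · rw [pquad_smul, Complex.norm_real, norm_inv, norm_norm]
      field_simp
  have hAb : BddBelow A := by
    refine ⟨-μ, ?_⟩
    rintro x ⟨f, -, h1, rfl⟩
    have := hlow f
    rw [h1] at this
    nlinarith [sq_nonneg ‖f‖]
  have hAn : A.Nonempty := ⟨_, hnormal w hwM hDw⟩
  set m := sInf A with hm
  have hm0 : m < 0 :=
    (csInf_le hAb (hnormal w hwM hDw)).trans_lt (div_neg_of_neg_of_pos hwn (by positivity))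
  have hMpos : ∀ g ∈ M, 0 ≤ pquad D K μ m g := by
    intro g hg
    rw [hshift]
    rcases (norm_nonneg (D g)).eq_or_lt with h | h
    · have : g = 0 := hDi (by rw [map_zero]; exact norm_eq_zero.1 h.symm)
      simp [this, pquad_eq]
    · have := csInf_le hAb (hnormal g hg h)
      rw [le_div_iff₀ (by positivity)] at this
      linarith
  obtain ⟨x, -, hx, hxA⟩ := exists_seq_tendsto_sInf hAn hAb
  choose u huM hu1 hux using hxA
  have hqm : ∀ k, pquad D K μ m (u k) = x k - m := by
    intro k; rw [hshift, hu1, hux]; ring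
  have hq0 : Tendsto (fun k => pquad D K μ m (u k)) atTop (𝓝 0) := by
    simp only [hqm]
    rw [← sub_self m]
    exact hx.sub_const m
  obtain ⟨C, hC⟩ := hx.bddAbove_range
  have hub : ∀ k, ‖u k‖ ≤ √(2 * (C + μ)) := by
    intro k
    refine Real.le_sqrt_of_sq_le ?_
    have h1 := hlow (u k)
    rw [hu1, hux] at h1
    have h2 := hC ⟨k, rfl⟩
    linarith
  -- The form at level `m` is nonnegative at `u k + u l`, so by the parallelogram law it is small at
  -- `u k - u l` when both vectors are nearly minimizing.
  obtain ⟨f, θ, hθ, hf⟩ := exists_subseq_tendsto_of_pquad hKc hμ hD hm0 hub (by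
    intro ε hε
    have := hq0.eventually (gt_mem_nhds (show (0 : ℝ) < ε / 4 by positivity))
    obtain ⟨N, hN⟩ := eventually_atTop.1 this
    refine ⟨N, fun k hk l hl => ?_⟩
    have h1 := pquad_parallelogram D K μ m (u k) (u l)
    have h2 := hMpos _ (M.add_mem (huM k) (huM l))
    linarith [hN k hk, hN l hl])
  have hfM : f ∈ M := hMc.mem_of_tendsto hf (Eventually.of_forall fun k => huM (θ k))
  have hf1 : ‖D f‖ = 1 := by
    refine tendsto_nhds_unique ((D.continuous.tendsto f).comp hf).norm ?_
    simp only [Function.comp, hu1]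
    exact tendsto_const_nhds
  have hf0 : pquad D K μ m f = 0 :=
    tendsto_nhds_unique (((continuous_pquad m).tendsto f).comp hf) (hq0.comp hθ.tendsto_atTop)
  refine ⟨m, hm0, f, ?_, ?_, hfM⟩
  · rintro rfl
    simp at hf1
  · intro φ
    obtain ⟨y, hy, hyo⟩ : ∃ z ∈ Z, φ - z ∈ M := by
      obtain ⟨z, hz, hze⟩ : (Z.map (D : X →ₗ[ℂ] Y)).starProjection (D φ) ∈ Z.map (D : X →ₗ[ℂ] Y) :=
        Submodule.starProjection_apply_mem _ _
      refine ⟨z, hz, fun z' hz' => ?_⟩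
      rw [map_sub]
      have e : D z = (Z.map (D : X →ₗ[ℂ] Y)).starProjection (D φ) := hze
      rw [e]
      exact (Z.map (D : X →ₗ[ℂ] Y)).sub_starProjection_mem_orthogonal (D φ) (D z') ⟨z', hz', rfl⟩
    have h1 := pform_eq_of_pquad_nonneg hK hMpos hfM hf0 hyo
    have h2 : pform D K μ y f = 0 := by
      obtain ⟨z', hz', hzz⟩ := hZ y hy
      rw [← pform_conj D K μ hK, hzz f, inner_conj_symm]
      exact hfM z' hz'
    have h3 : inner ℂ (D y) (D f) = 0 := hfM y hy
    have e : φ = (φ - y) + y := by abel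
    rw [e, pform_add_left, h1, h2, map_add, inner_add_left, h3, add_zero, add_zero]

theorem finrank_finset_sup_le {ι : Type*} (F : Finset ι) (p : ι → Submodule ℂ X)
    [∀ i, FiniteDimensional ℂ (p i)] :
    Module.finrank ℂ (F.sup p : Submodule ℂ X) ≤ ∑ i ∈ F, Module.finrank ℂ (p i) := by
  classical
  induction F using Finset.induction_on with
  | empty => simp
  | insert i F hi ih =>
    rw [Finset.sup_insert, Finset.sum_insert hi]
    have : FiniteDimensional ℂ (F.sup p : Submodule ℂ X) := Submodule.finiteDimensional_finset_sup F _
    exact (Submodule.finrank_add_le_finrank_add_finrank _ _).trans (Nat.add_le_add_left ih _)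

/-- A negative definite subspace is not larger than the number of negative eigenvalues. -/
theorem card_le_sum_finrank_pencilEigenspace [CompleteSpace X] (hKc : IsCompactOperator K)
    (hK : (K : X →ₗ[ℂ] X).IsSymmetric) (hμ : 0 < μ) (hD : ∀ f, μ * ‖D f‖ ^ 2 ≤ ‖f‖ ^ 2)
    (hDi : Function.Injective D) (hco : ∀ f, ‖f‖ ^ 2 / 2 ≤ ‖f‖ ^ 2 + (inner ℂ f (K f)).re)
    (F : Finset {a : ℝ // a < 0})
    (hF : ∀ a : {a : ℝ // a < 0}, pencilEigenspace D K μ a ≠ ⊥ → a ∈ F)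
    {ι : Type*} [Fintype ι] (w : ι → X)
    (hw : ∀ c : ι → ℂ, c ≠ 0 → (pform D K μ (∑ i, c i • w i) (∑ i, c i • w i)).re < 0) :
    Fintype.card ι ≤ ∑ a ∈ F, Module.finrank ℂ (pencilEigenspace D K μ a) := by
  have hfd : ∀ a : {a : ℝ // a < 0}, FiniteDimensional ℂ (pencilEigenspace D K μ a) :=
    fun a => finiteDimensional_pencilEigenspace hKc hμ hD a.2
  set Z : Submodule ℂ X := ⨆ a ∈ F, pencilEigenspace D K μ a with hZdef
  have hZsup : Z = F.sup fun a => pencilEigenspace D K μ (a : ℝ) := (Finset.sup_eq_iSup _ _).symm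
  have hZfd : FiniteDimensional ℂ Z := by
    rw [hZsup]
    exact Submodule.finiteDimensional_finset_sup F _
  have hZrank : Module.finrank ℂ Z ≤ ∑ a ∈ F, Module.finrank ℂ (pencilEigenspace D K μ a) := by
    rw [hZsup]
    exact finrank_finset_sup_le F _
  -- If `ι` has more elements than the dimension of `Z`, some nonzero combination of the `w i` is
  -- `D`-orthogonal to `Z`. Minimization then yields a negative eigenvector that is `D`-orthogonal
  -- to `Z`, whereas `hF` places it in `Z`.
  by_contra! hlt
  have hinv : ∀ z ∈ Z, ∃ z' ∈ Z, ∀ φ, pform D K μ φ z = inner ℂ (D φ) (D z') := by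
    intro z hz
    rw [hZdef] at hz
    induction hz using Submodule.iSup_induction' with
    | mem a z hz =>
      by_cases haF : a ∈ F
      · simp only [haF, iSup_pos] at hz
        refine ⟨((a : ℝ) : ℂ) • z, Z.smul_mem _ ?_, fun φ => ?_⟩
        · exact Submodule.mem_iSup_of_mem a (by simpa [haF] using hz)
        · rw [hz φ, map_smul, inner_smul_right]
      · simp only [haF, iSup_false, Submodule.mem_bot] at hz
        exact ⟨0, Z.zero_mem, fun φ => by simp [hz, pform]⟩
    | zero => exact ⟨0, Z.zero_mem, fun φ => by simp [pform]⟩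
    | add x y _ _ hx hy =>
      obtain ⟨x', hx', ex⟩ := hx
      obtain ⟨y', hy', ey⟩ := hy
      exact ⟨x' + y', Z.add_mem hx' hy', fun φ => by
        rw [pform_add_right, ex, ey, map_add, inner_add_right]⟩
  let Φ : (ι → ℂ) →ₗ[ℂ] X := Fintype.linearCombination ℂ w
  let W := Z.map (D : X →ₗ[ℂ] Y)
  let Λ : (ι → ℂ) →ₗ[ℂ] W :=
    (W.orthogonalProjectionOnto : Y →ₗ[ℂ] W) ∘ₗ (D : X →ₗ[ℂ] Y) ∘ₗ Φ
  have hker : Λ.ker ≠ ⊥ := by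
    refine LinearMap.ker_ne_bot_of_finrank_lt ?_
    rw [Module.finrank_fintype_fun_eq_card]
    exact ((Submodule.finrank_map_le _ _).trans hZrank).trans_lt hlt
  obtain ⟨c, hc, hc0⟩ := Submodule.exists_mem_ne_zero_of_ne_bot hker
  have hΦ : Φ c = ∑ i, c i • w i := Fintype.linearCombination_apply ℂ w c
  obtain ⟨a, ha, f, hf0, hf, hfZ⟩ := exists_mem_pencilEigenspace hKc hK hμ hD hDi hco Z hinv
    (w := Φ c) (fun z hz => by
      have h1 : W.orthogonalProjectionOnto (D (Φ c)) = 0 := hc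
      have h2 : D (Φ c) ∈ Wᗮ := Submodule.orthogonalProjectionOnto_eq_zero_iff.1 h1
      exact h2 (D z) ⟨z, hz, rfl⟩) (by rw [hΦ]; exact hw c hc0)
  have hne : pencilEigenspace D K μ a ≠ ⊥ := fun h => hf0 (by rwa [h, Submodule.mem_bot] at hf)
  have haF := hF ⟨a, ha⟩ hne
  have hfz : f ∈ Z := Submodule.mem_iSup_of_mem ⟨a, ha⟩ (by simpa [haF] using hf)
  have := hfZ f hfz
  rw [inner_self_eq_zero] at this
  exact hf0 (hDi (by rw [this, map_zero]))

end Pencil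

/-! ### Counting negative eigenvalues -/

section Counting

variable {X Y : Type*} [AddCommGroup Y] [Module ℂ Y]

theorem eigenMultiplicity_eq_finrank (A : Y →ₗ.[ℂ] Y) (a : ℝ)
    [FiniteDimensional ℂ (eigenspace A a)] :
    eigenMultiplicity A a = Module.finrank ℂ (eigenspace A a) := by
  rw [eigenMultiplicity, ← Module.finrank_eq_rank, Cardinal.toENat_nat]

theorem one_le_eigenMultiplicity {A : Y →ₗ.[ℂ] Y} {a : ℝ} (h : IsEigenvalue A a) :
    1 ≤ eigenMultiplicity A a := by
  have : Nontrivial (eigenspace A a) := Submodule.nontrivial_iff_ne_bot.2 h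
  have h1 : (1 : Cardinal) ≤ Module.rank ℂ (eigenspace A a) := by
    rw [Cardinal.one_le_iff_pos]
    exact rank_pos
  have := Cardinal.toENat.monotone' h1
  simpa [eigenMultiplicity] using this

theorem eigenMultiplicity_eq_zero {A : Y →ₗ.[ℂ] Y} {a : ℝ} (h : ¬ IsEigenvalue A a) :
    eigenMultiplicity A a = 0 := by
  rw [IsEigenvalue, not_not] at h
  rw [eigenMultiplicity, h]
  simp

/-- If there are only finitely many negative eigenvalues, all of finite multiplicity, then their
number is the sum of the multiplicities. -/
theorem numNegEigenvalues_eq_sum (A : Y →ₗ.[ℂ] Y) (F : Finset {a : ℝ // a < 0})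
    (hF : ∀ a : {a : ℝ // a < 0}, IsEigenvalue A a → a ∈ F) :
    numNegEigenvalues A = ∑ a ∈ F, eigenMultiplicity A (a : ℝ) := by
  classical
  refine le_antisymm (iSup_le fun G => ?_) (le_iSup (fun F : Finset {a : ℝ // a < 0} =>
    ∑ a ∈ F, eigenMultiplicity A (a : ℝ)) F)
  calc ∑ a ∈ G, eigenMultiplicity A (a : ℝ) ≤ ∑ a ∈ G ∪ F, eigenMultiplicity A (a : ℝ) :=
        Finset.sum_le_sum_of_subset Finset.subset_union_left
    _ = ∑ a ∈ F, eigenMultiplicity A (a : ℝ) := by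
        refine (Finset.sum_subset Finset.subset_union_right fun a _ ha => ?_).symm
        exact eigenMultiplicity_eq_zero fun h => ha (hF a h)

/-- Each eigenvalue contributes at least one to the count, so infinitely many of them would make it
infinite. -/
theorem exists_finset_of_numNegEigenvalues_ne_top {A : Y →ₗ.[ℂ] Y}
    (h : numNegEigenvalues A ≠ ⊤) :
    ∃ F : Finset {a : ℝ // a < 0}, ∀ a : {a : ℝ // a < 0}, IsEigenvalue A a → a ∈ F := by
  by_cases hfin : {a : {a : ℝ // a < 0} | IsEigenvalue A a}.Finite
  · exact ⟨hfin.toFinset, fun a ha => by simpa using ha⟩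
  · exfalso
    refine h (ENat.eq_top_iff_forall_ge.2 fun N => ?_)
    obtain ⟨G, hG, hN⟩ := (Set.not_finite.1 hfin |> Set.Infinite.exists_subset_card_eq) N
    refine le_trans ?_ (le_iSup (fun F : Finset {a : ℝ // a < 0} =>
      ∑ a ∈ F, eigenMultiplicity A (a : ℝ)) G)
    calc (N : ℕ∞) = ∑ a ∈ G, 1 := by simp [hN]
      _ ≤ _ := Finset.sum_le_sum fun a ha => one_le_eigenMultiplicity (hG ha)

/-- Finitely many eigenvalues of finite multiplicity have a finite total. -/
theorem infinite_of_numNegEigenvalues_eq_top {A : Y →ₗ.[ℂ] Y}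
    (hfd : ∀ a < (0 : ℝ), FiniteDimensional ℂ (eigenspace A a)) (h : numNegEigenvalues A = ⊤) :
    {a : ℝ | a < 0 ∧ IsEigenvalue A a}.Infinite := by
  intro hfin
  have hfin' : {a : {a : ℝ // a < 0} | IsEigenvalue A a}.Finite := by
    refine Set.Finite.of_finite_image (f := Subtype.val) (hfin.subset ?_)
      Subtype.val_injective.injOn
    rintro _ ⟨a, ha, rfl⟩
    exact ⟨a.2, ha⟩
  have := numNegEigenvalues_eq_sum A hfin'.toFinset fun a ha => by simpa using ha
  rw [h] at this
  have h2 : ∑ a ∈ hfin'.toFinset, eigenMultiplicity A (a : ℝ) =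
      ((∑ a ∈ hfin'.toFinset, Module.finrank ℂ (eigenspace A (a : ℝ)) : ℕ) : ℕ∞) := by
    push_cast
    refine Finset.sum_congr rfl fun a _ => ?_
    have := hfd a a.2
    exact eigenMultiplicity_eq_finrank A a
  rw [h2] at this
  exact ENat.natCast_ne_top _ this.symm

end Counting

/-! ### Transfer from the pencil to the unbounded operator. -/

section PencilOperator

variable {X Y : Type*} [NormedAddCommGroup X] [InnerProductSpace ℂ X] [CompleteSpace X]
  [NormedAddCommGroup Y] [InnerProductSpace ℂ Y]
  {D : X →L[ℂ] Y} {K : X →L[ℂ] X} {μ : ℝ} {A : Y →ₗ.[ℂ] Y}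

theorem finiteDimensional_eigenspace_of_pencil (hKc : IsCompactOperator K)
    (hμ : 0 < μ) (hD : ∀ f, μ * ‖D f‖ ^ 2 ≤ ‖f‖ ^ 2)
    (hA : ∀ a : ℝ, eigenspace A a = (pencilEigenspace D K μ a).map (D : X →ₗ[ℂ] Y)) {a : ℝ}
    (ha : a < 0) : FiniteDimensional ℂ (eigenspace A a) := by
  have := finiteDimensional_pencilEigenspace hKc hμ hD ha
  rw [hA a]
  infer_instance

/-- The variational principle in the form used later. Being injective, `D` identifies pencil
eigenspaces with eigenspaces of `A` of equal dimension; if the count is finite, only finitely many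
negative eigenvalues exist and successive minimization applies. -/
theorem card_le_numNegEigenvalues_of_pencil (hKc : IsCompactOperator K)
    (hK : (K : X →ₗ[ℂ] X).IsSymmetric) (hμ : 0 < μ) (hD : ∀ f, μ * ‖D f‖ ^ 2 ≤ ‖f‖ ^ 2)
    (hDi : Function.Injective D) (hco : ∀ f, ‖f‖ ^ 2 / 2 ≤ ‖f‖ ^ 2 + (inner ℂ f (K f)).re)
    (hA : ∀ a : ℝ, eigenspace A a = (pencilEigenspace D K μ a).map (D : X →ₗ[ℂ] Y))
    {ι : Type*} [Fintype ι] (w : ι → X)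
    (hw : ∀ c : ι → ℂ, c ≠ 0 → (pform D K μ (∑ i, c i • w i) (∑ i, c i • w i)).re < 0) :
    (Fintype.card ι : ℕ∞) ≤ numNegEigenvalues A := by
  by_cases htop : numNegEigenvalues A = ⊤
  · rw [htop]; exact le_top
  obtain ⟨F, hF⟩ := exists_finset_of_numNegEigenvalues_ne_top htop
  rw [numNegEigenvalues_eq_sum A F hF]
  have h := card_le_sum_finrank_pencilEigenspace hKc hK hμ hD hDi hco F (fun a ha => hF a (by
    rw [IsEigenvalue, hA a]
    intro h
    refine ha ((Submodule.eq_bot_iff _).2 fun f hf => hDi ?_)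
    rw [map_zero]
    exact (Submodule.eq_bot_iff _).1 h (D f) ⟨f, hf, rfl⟩)) w hw
  refine (Nat.cast_le.2 h).trans ?_
  push_cast
  refine Finset.sum_le_sum fun a _ => ?_
  have := finiteDimensional_eigenspace_of_pencil hKc hμ hD hA a.2
  rw [eigenMultiplicity_eq_finrank, hA a]
  rw [((pencilEigenspace D K μ (a : ℝ)).equivMapOfInjective (D : X →ₗ[ℂ] Y) hDi).finrank_eq]

end PencilOperator

/-! ### Hilbert–Schmidt operators are compact -/

section HilbertSchmidt

open Filter Topology

variable {X Y : Type*} [NormedAddCommGroup X] [InnerProductSpace ℂ X]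
  [NormedAddCommGroup Y] [InnerProductSpace ℂ Y] [CompleteSpace Y]

/-- Truncations to finitely many basis vectors have finite rank and converge in operator norm: by
Cauchy–Schwarz the remainder is bounded by the tail of the square sum, the other factor being at
most `‖f‖²` by Bessel. -/
theorem isCompactOperator_of_summable_norm_sq {ι : Type*} (b : HilbertBasis ι ℂ X) (Λ : X →L[ℂ] Y)
    (h : Summable fun i => ‖Λ (b i)‖ ^ 2) : IsCompactOperator Λ := by
  classical
  let S : Finset ι → X →L[ℂ] Y := fun F => ∑ i ∈ F, (innerSL ℂ (b i)).smulRight (Λ (b i))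
  have hS : ∀ F f, S F f = ∑ i ∈ F, inner ℂ (b i) f • Λ (b i) := by
    intro F f; simp [S]
  refine isCompactOperator_of_tendsto (l := atTop) (F := S) ?_ (Eventually.of_forall fun F => ?_)
  · rw [Metric.tendsto_atTop]
    intro ε hε
    obtain ⟨F, hF⟩ := summable_iff_vanishing_norm.1 h ((ε / 2) ^ 2) (by positivity)
    refine ⟨F, fun G hG => ?_⟩
    rw [dist_comm, dist_eq_norm]
    refine lt_of_le_of_lt (ContinuousLinearMap.opNorm_le_bound _ (by positivity) fun f => ?_)
      (half_lt_self hε)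
    have h1 : HasSum (fun i => inner ℂ (b i) f • Λ (b i)) (Λ f) := by
      have := (b.hasSum_repr f).mapL Λ
      simpa only [map_smul, b.repr_apply_apply] using this
    have h2 : Tendsto (fun H : Finset ι => ‖∑ i ∈ H, inner ℂ (b i) f • Λ (b i) - S G f‖) atTop
        (𝓝 ‖Λ f - S G f‖) := (Tendsto.sub_const h1 _).norm
    refine le_of_tendsto h2 (eventually_atTop.2 ⟨G, fun H hH => ?_⟩)
    rw [hS, ← Finset.sum_sdiff_eq_sub hH]
    have h3 : ∑ i ∈ H \ G, ‖Λ (b i)‖ ^ 2 ≤ (ε / 2) ^ 2 := by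
      have := hF (H \ G) (Finset.disjoint_of_subset_right hG Finset.sdiff_disjoint)
      exact (Real.le_norm_self _).trans this.le
    have h4 : ∑ i ∈ H \ G, ‖inner ℂ (b i) f‖ ^ 2 ≤ ‖f‖ ^ 2 := b.orthonormal.sum_inner_products_le f
    calc ‖∑ i ∈ H \ G, inner ℂ (b i) f • Λ (b i)‖
        ≤ ∑ i ∈ H \ G, ‖inner ℂ (b i) f‖ * ‖Λ (b i)‖ := by
          refine (norm_sum_le _ _).trans (Finset.sum_le_sum fun i _ => ?_)
          rw [norm_smul]
      _ ≤ ε / 2 * ‖f‖ := by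
          refine abs_le_of_sq_le_sq' ?_ (by positivity) |>.2
          refine (Finset.sum_mul_sq_le_sq_mul_sq _ _ _).trans ?_
          rw [mul_pow, mul_comm]
          gcongr
  · have : IsCompactOperator (S F : X →L[ℂ] Y) := by
      have h' : ∀ i, IsCompactOperator ((innerSL ℂ (b i)).smulRight (Λ (b i)) : X →L[ℂ] Y) := by
        intro i
        have e : ((innerSL ℂ (b i)).smulRight (Λ (b i)) : X → Y) =
            (ContinuousLinearMap.toSpanSingleton ℂ (Λ (b i))) ∘ (innerSL ℂ (b i)) := by
          ext f; simp
        rw [e]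
        exact (isCompactOperator_of_locallyCompactSpace_rng
          (ContinuousLinearMap.toSpanSingleton ℂ (Λ (b i)))).comp_clm _
      have hm : ∀ F : Finset ι, (∑ i ∈ F, (innerSL ℂ (b i)).smulRight (Λ (b i)) : X →L[ℂ] Y) ∈
          compactOperator (RingHom.id ℂ) X Y := fun F => Submodule.sum_mem _ fun i _ => h' i
      exact hm F
    exact this

theorem norm_sq_eq_integral {γ : Type*} [MeasurableSpace γ] {ρ : Measure γ} (f : Lp ℂ 2 ρ) :
    ‖f‖ ^ 2 = ∫ x, ‖f x‖ ^ 2 ∂ρ := by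
  have h1 : (inner ℂ f f : ℂ) = ((‖f‖ ^ 2 : ℝ) : ℂ) := by
    rw [inner_self_eq_norm_sq_to_K]; norm_cast
  have h2 : (inner ℂ f f : ℂ) = ((∫ x, ‖f x‖ ^ 2 ∂ρ : ℝ) : ℂ) := by
    rw [L2.inner_def, ← integral_complex_ofReal]
    refine integral_congr_ae (Eventually.of_forall fun x => ?_)
    simp only
    rw [inner_self_eq_norm_sq_to_K]; norm_cast
  exact_mod_cast h1.symm.trans h2

/-- An operator given by a square integrable kernel is compact. -/
theorem isCompactOperator_of_kernel {α β : Type*} [MeasurableSpace α] [MeasurableSpace β]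
    {μ : Measure α} {ν : Measure β} [SFinite μ] [SFinite ν] {k : α × β → ℂ}
    (hk : MemLp k 2 (μ.prod ν)) (Λ : Lp ℂ 2 ν →L[ℂ] Lp ℂ 2 μ)
    (hΛ : ∀ f, ∀ᵐ x ∂μ, Λ f x = ∫ y, k (x, y) * f y ∂ν) : IsCompactOperator Λ := by
  obtain ⟨w, b, -⟩ := exists_hilbertBasis ℂ (Lp ℂ 2 ν)
  refine isCompactOperator_of_summable_norm_sq b Λ ?_
  have hk2 : Integrable (fun z => ‖k z‖ ^ 2) (μ.prod ν) :=
    (memLp_two_iff_integrable_sq_norm hk.1).1 hk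
  have hkx : ∀ᵐ x ∂μ, MemLp (fun y => k (x, y)) 2 ν := by
    filter_upwards [hk2.prod_right_ae, hk.1.prodMk_left] with x hx hx'
    exact (memLp_two_iff_integrable_sq_norm hx').2 hx
  refine summable_of_sum_le (c := ∫ x, ∫ y, ‖k (x, y)‖ ^ 2 ∂ν ∂μ) (fun i => by positivity)
    fun F => ?_
  have hi : ∀ f : Lp ℂ 2 μ, Integrable (fun x => ‖f x‖ ^ 2) μ := fun f =>
    (memLp_two_iff_integrable_sq_norm (Lp.memLp f).1).1 (Lp.memLp f)
  simp only [norm_sq_eq_integral]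
  rw [← integral_finsetSum _ fun i _ => hi _]
  refine integral_mono_ae (integrable_finsetSum _ fun i _ => hi _) hk2.integral_prod_left ?_
  have hΛ' : ∀ᵐ x ∂μ, ∀ i ∈ F, Λ (b i) x = ∫ y, k (x, y) * b i y ∂ν :=
    (ae_ball_iff F.countable_toSet).2 fun i _ => hΛ (b i)
  filter_upwards [hΛ', hkx] with x hx hx'
  -- For fixed `x` the numbers `Λ (b i) x` are, up to conjugation, the coefficients of the section
  -- `conj (k (x, ·))` in the orthonormal family, so Bessel bounds their square sum by `∫ |k(x, y)|²
  -- dy`.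
  have hc : MemLp (fun y => conj (k (x, y))) 2 ν := hx'.star
  have e : ∀ i ∈ F, ‖Λ (b i) x‖ ^ 2 = ‖inner ℂ (b i) (hc.toLp _)‖ ^ 2 := by
    intro i hiF
    rw [hx i hiF, ← norm_inner_symm, L2.inner_def]
    congr 2
    refine integral_congr_ae ?_
    filter_upwards [hc.coeFn_toLp] with y hy
    rw [hy]
    simp [RCLike.inner_apply, mul_comm]
  rw [Finset.sum_congr rfl e]
  refine (b.orthonormal.sum_inner_products_le _).trans_eq ?_
  rw [norm_sq_eq_integral]
  refine integral_congr_ae ?_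
  filter_upwards [hc.coeFn_toLp] with y hy
  rw [hy]
  simp

end HilbertSchmidt

/-! ### The Fourier transform on `L¹ ∩ L²` -/

-- The `L²` transform is defined as an isometry, while sup bounds and kernels need the integral
-- formula. The two agree against smooth compactly supported functions, since in both cases the
-- transform can be moved onto the test function.
open scoped ContDiff in
theorem coeFn_fourierInv_toLp {n : ℕ} {f : E n → ℂ} (hf : Integrable f) (hf2 : MemLp f 2) :
    ((𝓕⁻ (hf2.toLp f) : L2 n) : E n → ℂ) =ᵐ[volume] 𝓕⁻ f := by
  have hL : Continuous fun p : E n × E n => (-innerₗ (E n)) p.1 p.2 := by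
    simp only [LinearMap.neg_apply, innerₗ_apply_apply]
    fun_prop
  have hcont : Continuous (𝓕⁻ f) :=
    VectorFourier.fourierIntegral_continuous Real.continuous_fourierChar hL hf
  refine ae_eq_of_integral_contDiff_smul_eq ((Lp.memLp _).locallyIntegrable one_le_two)
    hcont.locallyIntegrable fun g hg hgc => ?_
  have hg₁ : HasCompactSupport (Complex.ofRealCLM ∘ g) := hgc.comp_left rfl
  have hg₂ : ContDiff ℝ ∞ (Complex.ofRealCLM ∘ g) := by fun_prop
  let G : SchwartzMap (E n) ℂ := hg₁.toSchwartzMap hg₂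
  have e := DFunLike.congr_fun (Lp.fourierInv_toTemperedDistribution_eq (hf2.toLp f)) G
  rw [TemperedDistribution.fourierInv_apply, Lp.toTemperedDistribution_apply,
    Lp.toTemperedDistribution_apply] at e
  have e1 : ∀ x, g x • (𝓕⁻ (hf2.toLp f) : L2 n) x = G x • (𝓕⁻ (hf2.toLp f) : L2 n) x := by
    intro x; simp [G]
  have e2 : ∀ x, g x • 𝓕⁻ f x = G x • 𝓕⁻ f x := by
    intro x; simp [G]
  simp only [e1, e2]
  rw [← e]
  have e3 := VectorFourier.integral_fourierIntegral_smul_eq_flip (μ := volume) (ν := volume)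
    (L := -innerₗ (E n)) (f := G) (g := f) Real.continuous_fourierChar hL G.integrable hf
  have e4 : (-innerₗ (E n)).flip = -innerₗ (E n) := by
    ext x y; simp [real_inner_comm]
  rw [e4] at e3
  refine Eq.trans ?_ e3
  refine integral_congr_ae ?_
  filter_upwards [hf2.coeFn_toLp] with x hx
  rw [hx, SchwartzMap.fourierInv_coe]
  rfl

/-! ### A fractional Sobolev inequality -/

section Sobolev

open Filter Topology Set
open scoped ENNReal

variable {n : ℕ}

/-- Cauchy–Schwarz for the factorization `F = ω^{-1/2} · (ω^{1/2} F)`. -/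
theorem lintegral_enorm_le_of_weight {α : Type*} [MeasurableSpace α] {μ : Measure α} {ω : α → ℝ}
    (hωm : Measurable ω) (hω : ∀ᵐ ξ ∂μ, 0 < ω ξ) {F : α → ℂ} (hF : AEStronglyMeasurable F μ)
    {M N : ℝ} (hM : 0 ≤ M) (hN : 0 ≤ N)
    (h1 : ∫⁻ ξ, ENNReal.ofReal (ω ξ) * ‖F ξ‖ₑ ^ 2 ∂μ ≤ ENNReal.ofReal (N ^ 2))
    (h2 : ∫⁻ ξ, ENNReal.ofReal (ω ξ)⁻¹ ∂μ ≤ ENNReal.ofReal (M ^ 2)) :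
    ∫⁻ ξ, ‖F ξ‖ₑ ∂μ ≤ ENNReal.ofReal (M * N) := by
  have h := ENNReal.lintegral_mul_le_Lp_mul_Lq μ Real.HolderConjugate.two_two
    (f := fun ξ => ENNReal.ofReal (√(ω ξ)⁻¹)) (g := fun ξ => ENNReal.ofReal √(ω ξ) * ‖F ξ‖ₑ)
    (by fun_prop) (by fun_prop)
  have e0 : ∫⁻ ξ, ‖F ξ‖ₑ ∂μ = ∫⁻ ξ, ((fun ξ => ENNReal.ofReal (√(ω ξ)⁻¹)) *
      (fun ξ => ENNReal.ofReal √(ω ξ) * ‖F ξ‖ₑ)) ξ ∂μ := by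
    refine lintegral_congr_ae ?_
    filter_upwards [hω] with ξ hξ
    rw [Pi.mul_apply, ← mul_assoc, ← ENNReal.ofReal_mul (Real.sqrt_nonneg _), Real.sqrt_inv,
      inv_mul_cancel₀ (Real.sqrt_pos.2 hξ).ne', ENNReal.ofReal_one, one_mul]
  have e1 : ∫⁻ ξ, ENNReal.ofReal (√(ω ξ)⁻¹) ^ (2 : ℝ) ∂μ = ∫⁻ ξ, ENNReal.ofReal (ω ξ)⁻¹ ∂μ := by
    refine lintegral_congr_ae ?_
    filter_upwards [hω] with ξ hξ
    rw [ENNReal.rpow_two, ← ENNReal.ofReal_pow (Real.sqrt_nonneg _), Real.sq_sqrt (by positivity)]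
  have e2 : ∫⁻ ξ, (ENNReal.ofReal √(ω ξ) * ‖F ξ‖ₑ) ^ (2 : ℝ) ∂μ =
      ∫⁻ ξ, ENNReal.ofReal (ω ξ) * ‖F ξ‖ₑ ^ 2 ∂μ := by
    refine lintegral_congr_ae ?_
    filter_upwards [hω] with ξ hξ
    rw [ENNReal.rpow_two, mul_pow, ← ENNReal.ofReal_pow (Real.sqrt_nonneg _), Real.sq_sqrt hξ.le]
  rw [e1, e2] at h
  rw [e0]
  refine h.trans ?_
  have e3 : ∀ {x : ℝ≥0∞} {y : ℝ}, 0 ≤ y → x ≤ ENNReal.ofReal (y ^ 2) →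
      x ^ (1 / (2 : ℝ)) ≤ ENNReal.ofReal y := by
    intro x y hy hx
    refine (ENNReal.rpow_le_rpow hx (by positivity)).trans_eq ?_
    rw [ENNReal.ofReal_rpow_of_nonneg (by positivity) (by positivity), ← Real.sqrt_eq_rpow,
      Real.sqrt_sq hy]
  rw [ENNReal.ofReal_mul hM]
  gcongr
  · exact e3 hM h2
  · exact e3 hN h1

/-- Scaling reduces to the unit ball, where `s < n` makes the singularity integrable. The constant
is written as a square because its root enters the Cauchy–Schwarz bound. -/
theorem lintegral_ball_rpow_neg (hn : 0 < n) {s : ℝ} (hs : s < n) :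
    ∃ c : ℝ, 0 < c ∧ ∀ R : ℝ, 0 < R →
      ∫⁻ ξ in Metric.ball (0 : E n) R, ENNReal.ofReal (‖ξ‖ ^ s)⁻¹ ≤
        ENNReal.ofReal (c ^ 2 * R ^ ((n : ℝ) - s)) := by
  have hint : ∀ R : ℝ, IntegrableOn (fun ξ : E n => (‖ξ‖ ^ s)⁻¹) (Metric.ball 0 R) := by
    intro R
    refine integrableOn_ball_of_norm_le_rpow (C := 1) (α := s) (by simpa using Nat.succ_le_of_lt hn)
      (by simpa using hs) (Eventually.of_forall fun x => ?_)
      (by have : Measurable fun ξ : E n => ‖ξ‖ ^ s := by fun_prop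
          exact this.inv.aestronglyMeasurable)
    rw [Real.norm_of_nonneg (by positivity), one_mul, Real.rpow_neg (norm_nonneg _)]
  set I := ∫ ξ in Metric.ball (0 : E n) 1, (‖ξ‖ ^ s)⁻¹ with hI
  have hI0 : 0 ≤ I := integral_nonneg fun ξ => by positivity
  refine ⟨√(I + 1), Real.sqrt_pos.2 (by positivity), fun R hR => ?_⟩
  rw [Real.sq_sqrt (by positivity), ← ofReal_integral_eq_lintegral_ofReal (hint R)
    (Eventually.of_forall fun ξ => by positivity)]
  refine ENNReal.ofReal_le_ofReal ?_
  have h := Measure.setIntegral_comp_smul_of_pos (volume : Measure (E n))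
    (fun ξ : E n => (‖ξ‖ ^ s)⁻¹) (Metric.ball 0 1) hR
  rw [smul_unitBall_of_pos hR, finrank_euclideanSpace_fin, smul_eq_mul] at h
  have e : ∀ ξ : E n, (‖R • ξ‖ ^ s)⁻¹ = (R ^ s)⁻¹ * (‖ξ‖ ^ s)⁻¹ := by
    intro ξ
    rw [norm_smul, Real.norm_of_nonneg hR.le, Real.mul_rpow hR.le (norm_nonneg _), mul_inv]
  simp only [e] at h
  rw [integral_const_mul, ← hI] at h
  have h' : ∫ ξ in Metric.ball (0 : E n) R, (‖ξ‖ ^ s)⁻¹ = R ^ ((n : ℝ) - s) * I := by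
    rw [Real.rpow_sub hR, Real.rpow_natCast]
    field_simp at h ⊢
    linarith
  rw [h', mul_comm]
  gcongr
  linarith

/-- The part of `ψ` with frequencies in `B`. -/
def freqPart (B : Set (E n)) (ψ : L2 n) : L2 n := by
  classical
  exact if h : MemLp (B.indicator (𝓕 ψ : L2 n)) 2 then 𝓕⁻ (h.toLp _) else 0

theorem freqPart_eq {B : Set (E n)} (hB : MeasurableSet B) (ψ : L2 n) :
    freqPart B ψ = 𝓕⁻ (((Lp.memLp (𝓕 ψ : L2 n)).indicator hB).toLp _) := by
  rw [freqPart, dif_pos]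

theorem freqPart_add_compl {B : Set (E n)} (hB : MeasurableSet B) (ψ : L2 n) :
    freqPart B ψ + freqPart Bᶜ ψ = ψ := by
  rw [freqPart_eq hB, freqPart_eq hB.compl, ← FourierTransform.fourierInv_add, ← MemLp.toLp_add]
  have : ((𝓕⁻ (𝓕 ψ : L2 n)) : L2 n) = ψ := FourierTransform.fourierInv_fourier_eq ψ
  conv_rhs => rw [← this]
  congr 1
  apply Lp.ext
  refine (MemLp.coeFn_toLp _).trans (Eventually.of_forall fun x => ?_)
  exact congr_fun (indicator_self_add_compl B _) x

theorem lintegral_enorm_sq_eq {γ : Type*} [MeasurableSpace γ] {ρ : Measure γ} (f : Lp ℂ 2 ρ) :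
    ∫⁻ x, ‖f x‖ₑ ^ 2 ∂ρ = ‖f‖ₑ ^ 2 := by
  rw [Lp.enorm_def, eLpNorm_eq_lintegral_rpow_enorm_toReal two_ne_zero ENNReal.ofNat_ne_top,
    ← ENNReal.rpow_two, ← ENNReal.rpow_mul]
  simp

theorem enorm_fourierInv_eq (f : L2 n) : ‖(𝓕⁻ f : L2 n)‖ₑ = ‖f‖ₑ := by
  have h : ‖(𝓕⁻ f : L2 n)‖ = ‖f‖ := (Lp.fourierTransformₗᵢ (E n) ℂ).symm.norm_map f
  rw [← ofReal_norm, h, ofReal_norm]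

theorem lintegral_freqPart {B : Set (E n)} (hB : MeasurableSet B) (ψ : L2 n) :
    ∫⁻ x, ‖freqPart B ψ x‖ₑ ^ 2 = ∫⁻ ξ in B, ‖(𝓕 ψ : L2 n) ξ‖ₑ ^ 2 := by
  rw [lintegral_enorm_sq_eq, freqPart_eq hB, enorm_fourierInv_eq, ← lintegral_enorm_sq_eq,
    ← lintegral_indicator hB]
  refine lintegral_congr_ae ?_
  filter_upwards [((Lp.memLp (𝓕 ψ : L2 n)).indicator hB).coeFn_toLp] with x hx
  rw [hx]
  by_cases h : x ∈ B <;> simp [h]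

theorem enorm_freqPart_le {B : Set (E n)} (hB : MeasurableSet B) (ψ : L2 n) {C : ℝ≥0∞} (hC : C ≠ ⊤)
    (h : ∫⁻ ξ in B, ‖(𝓕 ψ : L2 n) ξ‖ₑ ≤ C) : ∀ᵐ x, ‖freqPart B ψ x‖ₑ ≤ C := by
  have hm := (Lp.memLp (𝓕 ψ : L2 n)).indicator hB
  have hn : ∫⁻ ξ, ‖B.indicator (𝓕 ψ : L2 n) ξ‖ₑ ≤ C := by
    rw [← lintegral_indicator hB] at h
    refine le_trans (le_of_eq (lintegral_congr fun ξ => ?_)) h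
    by_cases h : ξ ∈ B <;> simp [h]
  have hint : Integrable (B.indicator (𝓕 ψ : L2 n)) := ⟨hm.1, hn.trans_lt hC.lt_top⟩
  rw [freqPart_eq hB]
  filter_upwards [coeFn_fourierInv_toLp hint hm] with x hx
  rw [hx]
  refine le_trans ?_ hn
  rw [Real.fourierInv_eq]
  refine (enorm_integral_le_lintegral_enorm _).trans (le_of_eq (lintegral_congr fun ξ => ?_))
  rw [← ofReal_norm, Circle.norm_smul, ofReal_norm]

theorem lintegral_Ioc_rpow {τ a : ℝ} (hτ : 0 ≤ τ) (ha : 0 < a) :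
    ∫⁻ t in Ioc 0 τ, ENNReal.ofReal (t ^ (a - 1)) = ENNReal.ofReal (τ ^ a / a) := by
  have hi := (intervalIntegral.intervalIntegrable_rpow' (a := 0) (b := τ)
    (show -1 < a - 1 by linarith))
  rw [← ofReal_integral_eq_lintegral_ofReal ((intervalIntegrable_iff_integrableOn_Ioc_of_le hτ).1 hi)
    ((ae_restrict_iff' measurableSet_Ioc).2 (Eventually.of_forall fun t ht => by
      have := ht.1.le
      positivity)), ← intervalIntegral.integral_of_le hτ, integral_rpow (Or.inl (by linarith)),
      sub_add_cancel, Real.zero_rpow ha.ne', sub_zero]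

/-- At each level `t` the frequencies are split at a radius for which the low part is at most `t/2`
everywhere. Where `|ψ| > t` the high part is then at least `t/2`, and Chebyshev with Plancherel
bounds the measure by the high-frequency mass. Integrating in `t` and exchanging the integrals turns
the cutoff into the weight `‖ξ‖^s`. -/
theorem lintegral_norm_rpow_le_of_sobolev (hn : 0 < n) {s : ℝ} (hs0 : 0 < s) (hs : s < n) :
    ∃ C : ℝ, 0 < C ∧ ∀ (ψ : L2 n) (N : ℝ), 0 < N →
      ∫⁻ ξ, ENNReal.ofReal (‖ξ‖ ^ s) * ‖(𝓕 ψ : L2 n) ξ‖ₑ ^ 2 ≤ ENNReal.ofReal (N ^ 2) →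
      ∫⁻ x, ENNReal.ofReal (‖ψ x‖ ^ (2 * n / (n - s))) ≤
        ENNReal.ofReal (C * N ^ (2 * n / (n - s))) := by
  obtain ⟨c, hc, hball⟩ := lintegral_ball_rpow_neg hn hs
  have hns : (0 : ℝ) < n - s := by linarith
  set α : ℝ := (n - s) / 2 with hα
  have hα0 : 0 < α := by positivity
  set q : ℝ := 2 * n / (n - s) with hq
  have hq0 : 0 < q := by positivity
  have hq2 : q - 2 = s / α := by rw [hq, hα]; field_simp; ring
  have hq2' : 0 < q - 2 := by rw [hq2]; positivity
  refine ⟨q * (4 * ((2 * c) ^ (q - 2) / (q - 2))), by positivity, fun ψ N hN hψ => ?_⟩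
  set τ : E n → ℝ := fun ξ => 2 * c * N * ‖ξ‖ ^ α with hτ
  have hτm : Measurable τ := by fun_prop
  have hlevel : ∀ t : ℝ, 0 < t → volume {x | t < ‖ψ x‖} ≤
      ENNReal.ofReal (4 / t ^ 2) * ∫⁻ ξ in {ξ | t ≤ τ ξ}, ‖(𝓕 ψ : L2 n) ξ‖ₑ ^ 2 := by
    intro t ht
    -- `R` solves `c N R^α = t/2`, where the left side is the Cauchy–Schwarz bound for frequencies
    -- below `R`.
    set R : ℝ := (t / (2 * c * N)) ^ (1 / α) with hR
    have hR0 : 0 < R := by positivity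
    have hRα : R ^ α = t / (2 * c * N) := by
      rw [hR, ← Real.rpow_mul (by positivity), one_div, inv_mul_cancel₀ hα0.ne', Real.rpow_one]
    have hset : {ξ | t ≤ τ ξ} = (Metric.ball (0 : E n) R)ᶜ := by
      ext ξ
      simp only [mem_ofPred_eq, mem_compl_iff, Metric.mem_ball, dist_zero_right, not_lt, hτ]
      rw [← Real.rpow_le_rpow_iff hR0.le (norm_nonneg ξ) hα0, hRα, div_le_iff₀ (by positivity),
        mul_comm]
    have hlow : ∀ᵐ x, ‖freqPart (Metric.ball (0 : E n) R) ψ x‖ₑ ≤ ENNReal.ofReal (t / 2) := by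
      refine enorm_freqPart_le measurableSet_ball ψ ENNReal.ofReal_ne_top ?_
      have := lintegral_enorm_le_of_weight (μ := volume.restrict (Metric.ball (0 : E n) R))
        (ω := fun ξ => ‖ξ‖ ^ s) (F := (𝓕 ψ : L2 n)) (M := c * R ^ α) (N := N) (by fun_prop) ?_
        (Lp.aestronglyMeasurable _).restrict (by positivity) hN.le
        ((lintegral_mono' Measure.restrict_le_self le_rfl).trans hψ) ?_
      · refine this.trans_eq ?_
        rw [hRα]
        congr 1
        field_simp
      · refine ae_restrict_of_ae ?_
        have : Nontrivial (E n) := Module.nontrivial_of_finrank_pos (R := ℝ) (by simpa using hn)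
        filter_upwards [Measure.ae_ne volume (0 : E n)] with ξ hξ
        have := norm_pos_iff.2 hξ
        positivity
      · refine (hball R hR0).trans_eq ?_
        rw [mul_pow, ← Real.rpow_natCast (R ^ α), ← Real.rpow_mul hR0.le]
        congr 3
        rw [hα]; push_cast; ring
    have hsum : ∀ᵐ x, ψ x = freqPart (Metric.ball (0 : E n) R) ψ x +
        freqPart (Metric.ball (0 : E n) R)ᶜ ψ x := by
      filter_upwards [Lp.coeFn_add (freqPart (Metric.ball (0 : E n) R) ψ)
        (freqPart (Metric.ball (0 : E n) R)ᶜ ψ)] with x hx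
      rw [← Pi.add_apply, ← hx, freqPart_add_compl measurableSet_ball]
    have hsub : volume {x | t < ‖ψ x‖} ≤ volume {x | ENNReal.ofReal ((t / 2) ^ 2) ≤
        ‖freqPart (Metric.ball (0 : E n) R)ᶜ ψ x‖ₑ ^ 2} := by
      refine measure_mono_ae ?_
      filter_upwards [hlow, hsum] with x h1 h2 h3
      change t < ‖ψ x‖ at h3
      change ENNReal.ofReal ((t / 2) ^ 2) ≤ ‖freqPart (Metric.ball (0 : E n) R)ᶜ ψ x‖ₑ ^ 2
      rw [← ofReal_norm] at h1 ⊢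
      rw [ENNReal.ofReal_le_ofReal_iff (by positivity)] at h1
      rw [← ENNReal.ofReal_pow (norm_nonneg _)]
      refine ENNReal.ofReal_le_ofReal ?_
      rw [h2] at h3
      have := norm_add_le (freqPart (Metric.ball (0 : E n) R) ψ x)
        (freqPart (Metric.ball (0 : E n) R)ᶜ ψ x)
      gcongr
      linarith
    refine hsub.trans ((meas_ge_le_lintegral_div (by fun_prop)
      (by simpa using ht.ne') ENNReal.ofReal_ne_top).trans_eq ?_)
    rw [lintegral_freqPart measurableSet_ball.compl, ← hset, ENNReal.div_eq_inv_mul,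
      ← ENNReal.ofReal_inv_of_pos (by positivity)]
    congr 2
    field_simp
    norm_num
  rw [lintegral_rpow_eq_lintegral_meas_lt_mul volume (Eventually.of_forall fun x => norm_nonneg _)
    (by fun_prop) hq0]
  have hFm : AEMeasurable (fun ξ => ‖(𝓕 ψ : L2 n) ξ‖ₑ ^ 2) := by fun_prop
  have step1 : ∫⁻ t in Ioi 0, volume {a | t < ‖ψ a‖} * ENNReal.ofReal (t ^ (q - 1)) ≤
      ∫⁻ t in Ioi (0 : ℝ), ∫⁻ ξ, ENNReal.ofReal 4 * (‖(𝓕 ψ : L2 n) ξ‖ₑ ^ 2 *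
        {z : E n × ℝ | z.2 ≤ τ z.1}.indicator (fun z => ENNReal.ofReal (z.2 ^ (q - 2 - 1)))
          (ξ, t)) := by
    refine setLIntegral_mono_ae' measurableSet_Ioi (Eventually.of_forall fun t ht => ?_)
    have ht : 0 < t := ht
    refine (mul_le_mul_left (hlevel t ht) _).trans_eq ?_
    rw [← lintegral_indicator (measurableSet_le measurable_const hτm), mul_right_comm,
      ← lintegral_const_mul' _ _ (by finiteness)]
    refine lintegral_congr fun ξ => ?_
    by_cases h : t ≤ τ ξ
    · rw [indicator_of_mem (by exact h), indicator_of_mem (by exact h), ← ENNReal.ofReal_mul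
        (by positivity), mul_comm (‖(𝓕 ψ : L2 n) ξ‖ₑ ^ 2), ← mul_assoc,
        ← ENNReal.ofReal_mul (by norm_num)]
      congr 2
      rw [show q - 2 - 1 = (q - 1) - 2 by ring, Real.rpow_sub ht (q - 1) 2, Real.rpow_two]
      ring
    · rw [indicator_of_notMem (by exact h), indicator_of_notMem (by exact h)]
      simp
  -- The cutoff leaves `∫ t^{q-3} dt` over `(0, τ ξ]`, which is proportional to `‖ξ‖^{α(q-2)} =
  -- ‖ξ‖^s`.
  have step2 : ∀ ξ : E n, ∫⁻ t in Ioi (0 : ℝ), ENNReal.ofReal 4 * (‖(𝓕 ψ : L2 n) ξ‖ₑ ^ 2 *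
        {z : E n × ℝ | z.2 ≤ τ z.1}.indicator (fun z => ENNReal.ofReal (z.2 ^ (q - 2 - 1)))
          (ξ, t)) = ENNReal.ofReal (4 * ((2 * c * N) ^ (q - 2) / (q - 2))) *
          (ENNReal.ofReal (‖ξ‖ ^ s) * ‖(𝓕 ψ : L2 n) ξ‖ₑ ^ 2) := by
    intro ξ
    have hτ0 : 0 ≤ τ ξ := by simp only [hτ]; positivity
    rw [lintegral_const_mul' _ _ (by finiteness), lintegral_const_mul' _ _ (by finiteness)]
    have : ∫⁻ t in Ioi (0 : ℝ), {z : E n × ℝ | z.2 ≤ τ z.1}.indicator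
        (fun z => ENNReal.ofReal (z.2 ^ (q - 2 - 1))) (ξ, t) =
        ∫⁻ t in Ioc 0 (τ ξ), ENNReal.ofReal (t ^ (q - 2 - 1)) := by
      rw [← Ioi_inter_Iic, inter_comm, ← Measure.restrict_restrict measurableSet_Iic,
        ← lintegral_indicator measurableSet_Iic]
      rfl
    rw [this, lintegral_Ioc_rpow hτ0 hq2']
    have e : τ ξ ^ (q - 2) = (2 * c * N) ^ (q - 2) * ‖ξ‖ ^ s := by
      simp only [hτ]
      rw [Real.mul_rpow (by positivity) (by positivity), ← Real.rpow_mul (norm_nonneg _), hq2,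
        mul_div_cancel₀ _ hα0.ne']
    rw [e, mul_div_right_comm, ENNReal.ofReal_mul (by positivity), ENNReal.ofReal_mul (by norm_num)]
    ring
  have hswap : ∫⁻ t in Ioi (0 : ℝ), ∫⁻ ξ, ENNReal.ofReal 4 * (‖(𝓕 ψ : L2 n) ξ‖ₑ ^ 2 *
        {z : E n × ℝ | z.2 ≤ τ z.1}.indicator (fun z => ENNReal.ofReal (z.2 ^ (q - 2 - 1)))
          (ξ, t)) = ∫⁻ ξ, ∫⁻ t in Ioi (0 : ℝ), ENNReal.ofReal 4 * (‖(𝓕 ψ : L2 n) ξ‖ₑ ^ 2 *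
        {z : E n × ℝ | z.2 ≤ τ z.1}.indicator (fun z => ENNReal.ofReal (z.2 ^ (q - 2 - 1)))
          (ξ, t)) := by
    refine lintegral_lintegral_swap ?_
    refine AEMeasurable.const_mul (AEMeasurable.mul ?_ ?_) _
    · exact hFm.comp_snd
    · refine Measurable.aemeasurable ?_
      refine Measurable.comp (Measurable.indicator (by fun_prop) ?_) measurable_swap
      exact measurableSet_le measurable_snd (hτm.comp measurable_fst)
  calc _ ≤ ENNReal.ofReal q * (ENNReal.ofReal (4 * ((2 * c * N) ^ (q - 2) / (q - 2))) *
        ENNReal.ofReal (N ^ 2)) := by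
        gcongr
        refine step1.trans ?_
        rw [hswap]
        simp only [step2]
        rw [lintegral_const_mul' _ _ (by finiteness)]
        gcongr
    _ = _ := by
        rw [← ENNReal.ofReal_mul (by positivity), ← ENNReal.ofReal_mul (by positivity)]
        congr 1
        rw [Real.mul_rpow (by positivity) hN.le]
        have : N ^ q = N ^ (q - 2) * N ^ 2 := by
          rw [← Real.rpow_two, ← Real.rpow_add hN]; congr 1; ring
        rw [this]
        ring

end Sobolev

/-! ### Form bounds for potentials -/

section FormBound

open Filter Topology Set
open scoped ENNReal

variable {n : ℕ}

/-- Potentials in `L^p` are form bounded with respect to `1 + |ξ|^s`. -/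
def FormBound (n : ℕ) (s p C : ℝ) : Prop :=
  ∀ (ψ : L2 n) (N : ℝ), 0 < N →
    ∫⁻ ξ, ENNReal.ofReal (1 + ‖ξ‖ ^ s) * ‖(𝓕 ψ : L2 n) ξ‖ₑ ^ 2 ≤ ENNReal.ofReal (N ^ 2) →
    ∀ w : E n → ℝ, AEStronglyMeasurable w →
      ∫⁻ x, ‖w x‖ₑ * ‖ψ x‖ₑ ^ 2 ≤
        ENNReal.ofReal C * eLpNorm w (ENNReal.ofReal p) volume * ENNReal.ofReal (N ^ 2)

theorem rpow_le_one_add_rpow {x s s' : ℝ} (hx : 0 ≤ x) (hs' : 0 < s') (h : s' ≤ s) :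
    x ^ s' ≤ 1 + x ^ s := by
  rcases le_total x 1 with h1 | h1
  · have := Real.rpow_le_one hx h1 hs'.le
    have := Real.rpow_nonneg hx s
    linarith
  · have := Real.rpow_le_rpow_of_exponent_le h1 h
    linarith

/-- Hölder with exponent `n/s'` on the potential and `n/(n-s')` on `|ψ|²`, the latter norm being
controlled by the Sobolev inequality. Allowing `s' < s` covers the borderline `s = n`. -/
theorem exists_formBound_of_lt (hn : 0 < n) {s s' : ℝ} (hs0 : 0 < s') (hs' : s' ≤ s) (hs : s' < n) :
    ∃ C, 0 < C ∧ FormBound n s (n / s') C := by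
  obtain ⟨C, hC, h⟩ := lintegral_norm_rpow_le_of_sobolev hn hs0 hs
  have hn' : (0 : ℝ) < n := by exact_mod_cast hn
  have hns : (0 : ℝ) < n - s' := by linarith
  set q : ℝ := 2 * n / (n - s') with hq
  have hq0 : 0 < q := by positivity
  refine ⟨C ^ (2 / q), by positivity, fun ψ N hN hψ w hw => ?_⟩
  have hψ' := h ψ N hN (le_trans (lintegral_mono fun ξ => by
    gcongr
    exact rpow_le_one_add_rpow (norm_nonneg _) hs0 hs') hψ)
  have hconj : (n / s' : ℝ).HolderConjugate (n / (n - s')) := by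
    rw [Real.holderConjugate_iff]
    refine ⟨(one_lt_div hs0).2 hs, ?_⟩
    field_simp
    ring
  have hh := ENNReal.lintegral_mul_le_Lp_mul_Lq volume hconj (f := fun x => ‖w x‖ₑ)
    (g := fun x => ‖ψ x‖ₑ ^ 2) (by fun_prop) (by fun_prop)
  refine hh.trans ?_
  have e1 : eLpNorm w (ENNReal.ofReal (n / s')) volume =
      (∫⁻ x, ‖w x‖ₑ ^ (n / s' : ℝ)) ^ (1 / (n / s') : ℝ) := by
    rw [eLpNorm_eq_lintegral_rpow_enorm_toReal (by simp; positivity) ENNReal.ofReal_ne_top,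
      ENNReal.toReal_ofReal (by positivity)]
  have e2 : ∫⁻ x, (‖ψ x‖ₑ ^ 2) ^ (n / (n - s') : ℝ) = ∫⁻ x, ENNReal.ofReal (‖ψ x‖ ^ q) := by
    refine lintegral_congr fun x => ?_
    rw [← ENNReal.rpow_two, ← ENNReal.rpow_mul, ← ofReal_norm,
      ENNReal.ofReal_rpow_of_nonneg (norm_nonneg _) (by positivity)]
    congr 2
    rw [hq]; ring
  rw [← e1, e2, mul_comm (ENNReal.ofReal (C ^ (2 / q))), mul_assoc]
  gcongr
  have e3 : (1 / (n / (n - s')) : ℝ) = 2 / q := by rw [hq]; field_simp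
  rw [e3]
  refine (ENNReal.rpow_le_rpow hψ' (by positivity)).trans_eq ?_
  rw [ENNReal.ofReal_rpow_of_nonneg (by positivity) (by positivity),
    ← ENNReal.ofReal_mul (by positivity), Real.mul_rpow hC.le (by positivity),
    ← Real.rpow_mul hN.le, mul_div_cancel₀ _ hq0.ne', Real.rpow_two]

/-- For `s > n` the function `(1 + ‖ξ‖^s)⁻¹` is integrable, so `𝓕 ψ` is integrable and `ψ` is
bounded. -/
theorem exists_formBound_of_gt {s : ℝ} (hs : n < s) :
    ∃ C, 0 < C ∧ FormBound n s 1 C := by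
  have hs0 : 0 < s := lt_of_le_of_lt (Nat.cast_nonneg n) hs
  have hle : ∀ ξ : E n, (1 + ‖ξ‖ ^ s)⁻¹ ≤ 2 ^ s * (1 + ‖ξ‖) ^ (-s) := by
    intro ξ
    have h0 := norm_nonneg ξ
    have h1 : (1 + ‖ξ‖) ^ s ≤ 2 ^ s * (1 + ‖ξ‖ ^ s) := by
      rcases le_total ‖ξ‖ 1 with h | h
      · calc (1 + ‖ξ‖) ^ s ≤ 2 ^ s := by gcongr; linarith
          _ ≤ 2 ^ s * (1 + ‖ξ‖ ^ s) := le_mul_of_one_le_right (by positivity)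
              (by linarith [Real.rpow_nonneg h0 s])
      · calc (1 + ‖ξ‖) ^ s ≤ (2 * ‖ξ‖) ^ s := by gcongr; linarith
          _ = 2 ^ s * ‖ξ‖ ^ s := Real.mul_rpow (by norm_num) h0
          _ ≤ 2 ^ s * (1 + ‖ξ‖ ^ s) := by gcongr; linarith
    have h2 : 0 < (1 + ‖ξ‖) ^ s := by positivity
    rw [Real.rpow_neg (by positivity), inv_le_iff_one_le_mul₀ (by positivity), mul_comm, ← mul_assoc,
      mul_comm _ (2 ^ s), ← div_eq_mul_inv, one_le_div h2]
    exact h1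
  have hint : Integrable (fun ξ : E n => (1 + ‖ξ‖ ^ s)⁻¹) := by
    refine Integrable.mono' ((integrable_one_add_norm (μ := (volume : Measure (E n))) (r := s)
      (by simpa using hs)).const_mul (2 ^ s)) (Measurable.aestronglyMeasurable (by fun_prop))
      (Eventually.of_forall fun ξ => ?_)
    rw [Real.norm_of_nonneg (by positivity)]
    exact hle ξ
  set I := ∫ ξ : E n, (1 + ‖ξ‖ ^ s)⁻¹ with hI
  have hI0 : 0 ≤ I := integral_nonneg fun ξ => by positivity
  refine ⟨I + 1, by positivity, fun ψ N hN hψ w hw => ?_⟩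
  have hsup : ∀ᵐ x, ‖ψ x‖ₑ ≤ ENNReal.ofReal (√(I + 1) * N) := by
    have h1 := lintegral_enorm_le_of_weight (μ := volume) (ω := fun ξ : E n => 1 + ‖ξ‖ ^ s)
      (F := (𝓕 ψ : L2 n)) (M := √(I + 1)) (N := N) (by fun_prop)
      (Eventually.of_forall fun ξ => by positivity) (Lp.aestronglyMeasurable _)
      (Real.sqrt_nonneg _) hN.le hψ (by
        rw [← ofReal_integral_eq_lintegral_ofReal hint
          (Eventually.of_forall fun ξ => by positivity), Real.sq_sqrt (by positivity)]
        exact ENNReal.ofReal_le_ofReal (by linarith))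
    have h2 := enorm_freqPart_le MeasurableSet.univ ψ ENNReal.ofReal_ne_top
      (by rw [Measure.restrict_univ]; exact h1)
    have h3 : freqPart univ ψ = ψ := by
      have := freqPart_add_compl MeasurableSet.univ ψ
      have h4 : freqPart (univ : Set (E n))ᶜ ψ = 0 := by
        have := lintegral_freqPart MeasurableSet.univ.compl ψ
        rw [lintegral_enorm_sq_eq] at this
        simpa using this
      rwa [h4, add_zero] at this
    rwa [h3] at h2
  rw [ENNReal.ofReal_one, eLpNorm_one_eq_lintegral_enorm]
  calc ∫⁻ x, ‖w x‖ₑ * ‖ψ x‖ₑ ^ 2 ≤ ∫⁻ x, ‖w x‖ₑ * ENNReal.ofReal ((√(I + 1) * N) ^ 2) := by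
        refine lintegral_mono_ae ?_
        filter_upwards [hsup] with x hx
        rw [ENNReal.ofReal_pow (by positivity)]
        gcongr
    _ = _ := by
        rw [lintegral_mul_const' _ _ ENNReal.ofReal_ne_top, mul_pow, Real.sq_sqrt (by positivity),
          ENNReal.ofReal_mul (by positivity)]
        ring

theorem exists_formBound (hn : 0 < n) {T : E n → ℝ} {s : ℝ} (hs : 0 < s) {V : E n → ℝ}
    (hV : PotentialAssumptions T s V) :
    ∃ p C, 0 < p ∧ 0 < C ∧ FormBound n s p C ∧ MemLp V (ENNReal.ofReal p) := by
  have hn' : (0 : ℝ) < n := by exact_mod_cast hn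
  rcases lt_trichotomy s n with h | h | h
  · obtain ⟨C, hC, hb⟩ := exists_formBound_of_lt hn hs le_rfl h
    exact ⟨n / s, C, by positivity, hC, hb, hV.memLp_of_gt h⟩
  · obtain ⟨ε, hε, hVε⟩ := hV.memLp_of_eq h.symm
    -- At `s = n` the exponent is lowered to `n/(1+ε)`, so that the required integrability of `V` is
    -- exactly `1 + ε`.
    obtain ⟨C, hC, hb⟩ := exists_formBound_of_lt hn (s := s) (s' := n / (1 + ε)) (by positivity)
      (by rw [h, div_le_iff₀ (by positivity)]; nlinarith)
      (by rw [div_lt_iff₀ (by positivity)]; nlinarith)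
    have e : (n : ℝ) / (n / (1 + ε)) = 1 + ε := by field_simp
    rw [e] at hb
    exact ⟨1 + ε, C, by positivity, hC, hb, hVε⟩
  · obtain ⟨C, hC, hb⟩ := exists_formBound_of_gt h
    exact ⟨1, C, one_pos, hC, hb, by simpa using hV.integrable⟩

/-- A splitting of the potential into a small part in `L^p` and a bounded part. -/
theorem exists_le_add_of_memLp {V : E n → ℝ} {p : ℝ≥0∞} (hV : MemLp V p) {ε : ℝ} (hε : 0 < ε) :
    ∃ (w : E n → ℝ) (M : ℝ), 0 < M ∧ AEStronglyMeasurable w ∧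
      eLpNorm w p volume ≤ ENNReal.ofReal ε ∧ ∀ᵐ x, ‖V x‖ₑ ≤ ‖w x‖ₑ + ENNReal.ofReal M := by
  obtain ⟨V', hV', hae⟩ := hV.1
  obtain ⟨M, hM, h⟩ := (hV.ae_eq hae).eLpNorm_indicator_norm_ge_pos_le hV' hε
  refine ⟨_, M, hM, (hV'.indicator (hV'.norm.measurable measurableSet_Ici)).aestronglyMeasurable,
    h, ?_⟩
  filter_upwards [hae] with x hx
  rw [hx]
  by_cases hx' : M ≤ ‖V' x‖
  · rw [indicator_of_mem (by exact hx')]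
    exact le_self_add
  · refine le_add_left ?_
    rw [← ofReal_norm]
    exact ENNReal.ofReal_le_ofReal (not_le.1 hx').le

end FormBound

/-! ### Operators on `L²` defined almost everywhere -/

section MkLp

open scoped ENNReal

variable {X : Type*} [NormedAddCommGroup X] [NormedSpace ℂ X] {α : Type*} [MeasurableSpace α]
  {μ : Measure α}

theorem memLp_two_of_lintegral_le {f : α → ℂ} {C : ℝ} (hm : AEStronglyMeasurable f μ)
    (hC : ∫⁻ x, ‖f x‖ₑ ^ 2 ∂μ ≤ ENNReal.ofReal C) : MemLp f 2 μ := by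
  refine ⟨hm, ?_⟩
  rw [eLpNorm_lt_top_iff_lintegral_rpow_enorm_lt_top two_ne_zero ENNReal.ofNat_ne_top]
  simpa using hC.trans_lt ENNReal.ofReal_lt_top

/-- A bounded operator into `L²` from a map that is linear almost everywhere. -/
def mkLp (A : X → α → ℂ) (C : ℝ) (hm : ∀ f, AEStronglyMeasurable (A f) μ)
    (hadd : ∀ f g, A (f + g) =ᵐ[μ] fun x => A f x + A g x)
    (hsmul : ∀ (c : ℂ) f, A (c • f) =ᵐ[μ] fun x => c * A f x)
    (hC : ∀ f, ∫⁻ x, ‖A f x‖ₑ ^ 2 ∂μ ≤ ENNReal.ofReal (C * ‖f‖ ^ 2)) : X →L[ℂ] Lp ℂ 2 μ :=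
  have hmem : ∀ f, MemLp (A f) 2 μ := fun f => memLp_two_of_lintegral_le (hm f) (hC f)
  LinearMap.mkContinuous
    { toFun := fun f => (hmem f).toLp (A f)
      map_add' := fun f g => by
        rw [← MemLp.toLp_add]
        exact (MemLp.toLp_eq_toLp_iff _ _).2 (hadd f g)
      map_smul' := fun c f => by
        rw [RingHom.id_apply, ← MemLp.toLp_const_smul]
        exact (MemLp.toLp_eq_toLp_iff _ _).2 (hsmul c f) } √C fun f => by
    have h : ‖(hmem f).toLp (A f)‖ₑ ^ 2 ≤ ENNReal.ofReal (C * ‖f‖ ^ 2) := by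
      rw [← lintegral_enorm_sq_eq]
      refine le_trans (le_of_eq (lintegral_congr_ae ?_)) (hC f)
      filter_upwards [(hmem f).coeFn_toLp] with x hx
      rw [hx]
    rw [← ofReal_norm, ← ENNReal.ofReal_pow (norm_nonneg _)] at h
    change ‖(hmem f).toLp (A f)‖ ≤ √C * ‖f‖
    -- `C` may be negative, in which case `ENNReal.ofReal` truncates the bound to zero.
    rcases le_or_gt (C * ‖f‖ ^ 2) 0 with h0 | h0
    · rw [ENNReal.ofReal_of_nonpos h0, nonpos_iff_eq_zero, ENNReal.ofReal_eq_zero] at h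
      have : ‖(hmem f).toLp (A f)‖ = 0 := by
        have := sq_nonneg ‖(hmem f).toLp (A f)‖
        exact pow_eq_zero_iff two_ne_zero |>.1 (le_antisymm h this)
      rw [this]; positivity
    · rw [ENNReal.ofReal_le_ofReal_iff h0.le] at h
      refine (Real.le_sqrt_of_sq_le h).trans_eq ?_
      rw [Real.sqrt_mul' _ (by positivity), Real.sqrt_sq (norm_nonneg _)]

theorem coeFn_mkLp {A : X → α → ℂ} {C : ℝ} {hm : ∀ f, AEStronglyMeasurable (A f) μ}
    {hadd : ∀ f g, A (f + g) =ᵐ[μ] fun x => A f x + A g x}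
    {hsmul : ∀ (c : ℂ) f, A (c • f) =ᵐ[μ] fun x => c * A f x}
    {hC : ∀ f, ∫⁻ x, ‖A f x‖ₑ ^ 2 ∂μ ≤ ENNReal.ofReal (C * ‖f‖ ^ 2)} (f : X) :
    mkLp A C hm hadd hsmul hC f =ᵐ[μ] A f :=
  MemLp.coeFn_toLp (memLp_two_of_lintegral_le (hm f) (hC f))

theorem norm_sq_le_of_lintegral_le {f : Lp ℂ 2 μ} {C : ℝ} (hC : 0 ≤ C)
    (h : ∫⁻ x, ‖f x‖ₑ ^ 2 ∂μ ≤ ENNReal.ofReal C) : ‖f‖ ^ 2 ≤ C := by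
  rw [lintegral_enorm_sq_eq, ← ofReal_norm, ← ENNReal.ofReal_pow (norm_nonneg _),
    ENNReal.ofReal_le_ofReal_iff hC] at h
  exact h

end MkLp

/-! ### Fourier multipliers and relatively compact potentials -/

section Multiplier

open Filter Topology Set
open scoped ENNReal

variable {n : ℕ}

theorem enorm_ofReal_mul_sq (a : ℝ) (z : ℂ) :
    ‖(a : ℂ) * z‖ₑ ^ 2 = ENNReal.ofReal (a ^ 2) * ‖z‖ₑ ^ 2 := by
  rw [enorm_mul, mul_pow, ← ofReal_norm (a : ℂ), Complex.norm_real, Real.norm_eq_abs,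
    ← ENNReal.ofReal_pow (abs_nonneg _), sq_abs]

theorem ofReal_norm_sq {X : Type*} [SeminormedAddCommGroup X] (f : X) :
    ENNReal.ofReal (‖f‖ ^ 2) = ‖f‖ₑ ^ 2 := by
  rw [ENNReal.ofReal_pow (norm_nonneg _), ofReal_norm]

/-- Multiplication of an `L²` function by a bounded real function. -/
def mulLp {α : Type*} [MeasurableSpace α] {μ : Measure α} (g : α → ℝ)
    (hg : AEStronglyMeasurable g μ) (b : ℝ) (hb : ∀ ξ, |g ξ| ≤ b) :
    Lp ℂ 2 μ →L[ℂ] Lp ℂ 2 μ :=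
  mkLp (fun f ξ => (g ξ : ℂ) * f ξ) (b ^ 2)
    (fun f => (Complex.measurable_ofReal.comp_aemeasurable hg.aemeasurable).aestronglyMeasurable.mul
      (Lp.aestronglyMeasurable f))
    (fun f f' => by
      filter_upwards [Lp.coeFn_add f f'] with ξ h
      rw [h, Pi.add_apply, mul_add])
    (fun c f => by
      filter_upwards [Lp.coeFn_smul c f] with ξ h
      rw [h, Pi.smul_apply, smul_eq_mul, mul_left_comm])
    (fun f => by
      rw [ENNReal.ofReal_mul (sq_nonneg b), ofReal_norm_sq, ← lintegral_enorm_sq_eq,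
        ← lintegral_const_mul' _ _ ENNReal.ofReal_ne_top]
      refine lintegral_mono fun ξ => ?_
      rw [enorm_ofReal_mul_sq]
      gcongr ENNReal.ofReal ?_ * _
      rw [← sq_abs]
      gcongr
      exact hb ξ)

theorem coeFn_mulLp {α : Type*} [MeasurableSpace α] {μ : Measure α} {g : α → ℝ}
    (hg : AEStronglyMeasurable g μ) {b : ℝ} (hb : ∀ ξ, |g ξ| ≤ b) (f : Lp ℂ 2 μ) :
    mulLp g hg b hb f =ᵐ[μ] fun ξ => (g ξ : ℂ) * f ξ :=
  coeFn_mkLp f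

/-- The Fourier multiplier with a bounded real symbol, after the inverse Fourier transform. -/
def multiplier (g : E n → ℝ) (hg : AEStronglyMeasurable g) (b : ℝ) (hb : ∀ ξ, |g ξ| ≤ b) :
    L2 n →L[ℂ] L2 n :=
  ((Lp.fourierTransformₗᵢ (E n) ℂ).symm.toContinuousLinearEquiv : L2 n →L[ℂ] L2 n) ∘L
    mulLp g hg b hb

theorem fourier_multiplier {g : E n → ℝ} (hg : AEStronglyMeasurable g) {b : ℝ}
    (hb : ∀ ξ, |g ξ| ≤ b) (f : L2 n) :
    (𝓕 (multiplier g hg b hb f) : L2 n) =ᵐ[volume] fun ξ => (g ξ : ℂ) * f ξ := by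
  have : (𝓕 (multiplier g hg b hb f) : L2 n) = mulLp g hg b hb f :=
    (Lp.fourierTransformₗᵢ (E n) ℂ).apply_symm_apply _
  rw [this]
  exact coeFn_mulLp hg hb f

theorem norm_multiplier_sq_le {g : E n → ℝ} (hg : AEStronglyMeasurable g) {b : ℝ}
    (hb : ∀ ξ, |g ξ| ≤ b) {β : ℝ} (hβ : ∀ ξ, g ξ ^ 2 ≤ β) (hβ0 : 0 ≤ β) (f : L2 n) :
    ‖multiplier g hg b hb f‖ ^ 2 ≤ β * ‖f‖ ^ 2 := by
  rw [← Lp.norm_fourier_eq]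
  refine norm_sq_le_of_lintegral_le (by positivity) ?_
  rw [ENNReal.ofReal_mul hβ0, ofReal_norm_sq, ← lintegral_enorm_sq_eq,
    ← lintegral_const_mul' _ _ ENNReal.ofReal_ne_top]
  refine lintegral_mono_ae ?_
  filter_upwards [fourier_multiplier hg hb f] with ξ h
  rw [h, enorm_ofReal_mul_sq]
  gcongr
  exact hβ ξ

/-- The part `w` is handled by the form bound with `N = √a ‖f‖`, the bounded remainder by `β` alone.
Small `ε` and `β` make the potential relatively small; this serves both the coercivity of the form
and the compactness of the perturbation. -/
theorem lintegral_potential_multiplier_le {s p C : ℝ} (hC : 0 ≤ C) (hF : FormBound n s p C)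
    {V w : E n → ℝ} (hw : AEStronglyMeasurable w) {ε M : ℝ} (hε : 0 ≤ ε) (hM : 0 ≤ M)
    (hwε : eLpNorm w (ENNReal.ofReal p) volume ≤ ENNReal.ofReal ε)
    (hV : ∀ᵐ x, ‖V x‖ₑ ≤ ‖w x‖ₑ + ENNReal.ofReal M)
    {g : E n → ℝ} (hg : AEStronglyMeasurable g) {b : ℝ} (hb : ∀ ξ, |g ξ| ≤ b) {a β : ℝ}
    (ha0 : 0 < a) (ha : ∀ ξ, (1 + ‖ξ‖ ^ s) * g ξ ^ 2 ≤ a) (hβ : ∀ ξ, g ξ ^ 2 ≤ β) (hβ0 : 0 ≤ β)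
    (f : L2 n) :
    ∫⁻ x, ‖V x‖ₑ * ‖multiplier g hg b hb f x‖ₑ ^ 2 ≤
      ENNReal.ofReal ((C * ε * a + M * β) * ‖f‖ ^ 2) := by
  rcases eq_or_ne f 0 with rfl | hf
  · rw [map_zero]
    refine le_of_eq_of_le (lintegral_eq_zero_of_ae_eq_zero ?_) zero_le
    filter_upwards [Lp.coeFn_zero ℂ 2 (volume : Measure (E n))] with x hx
    rw [hx]; simp
  have hf' : 0 < ‖f‖ := norm_pos_iff.2 hf
  set ψ := multiplier g hg b hb f with hψ
  have h1 : ∫⁻ ξ, ENNReal.ofReal (1 + ‖ξ‖ ^ s) * ‖(𝓕 ψ : L2 n) ξ‖ₑ ^ 2 ≤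
      ENNReal.ofReal ((√a * ‖f‖) ^ 2) := by
    rw [mul_pow, Real.sq_sqrt ha0.le, ENNReal.ofReal_mul ha0.le, ofReal_norm_sq,
      ← lintegral_enorm_sq_eq, ← lintegral_const_mul' _ _ ENNReal.ofReal_ne_top]
    refine lintegral_mono_ae ?_
    filter_upwards [fourier_multiplier hg hb f] with ξ h
    rw [hψ, h, enorm_ofReal_mul_sq, ← mul_assoc, ← ENNReal.ofReal_mul (by positivity)]
    gcongr
    exact ha ξ
  have h2 := hF ψ (√a * ‖f‖) (by positivity) h1 w hw
  have h3 : ∫⁻ x, ‖V x‖ₑ * ‖ψ x‖ₑ ^ 2 ≤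
      ∫⁻ x, (‖w x‖ₑ * ‖ψ x‖ₑ ^ 2 + ENNReal.ofReal M * ‖ψ x‖ₑ ^ 2) := by
    refine lintegral_mono_ae ?_
    filter_upwards [hV] with x hx
    rw [← add_mul]
    gcongr
  rw [lintegral_add_left' (by fun_prop), lintegral_const_mul' _ _ ENNReal.ofReal_ne_top,
    lintegral_enorm_sq_eq, ← ofReal_norm_sq] at h3
  refine h3.trans ?_
  rw [add_mul, ENNReal.ofReal_add (by positivity) (by positivity)]
  gcongr
  · refine h2.trans ?_
    rw [mul_pow, Real.sq_sqrt ha0.le, mul_assoc (C * ε),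
      ENNReal.ofReal_mul (show 0 ≤ C * ε by positivity), ENNReal.ofReal_mul hC]
    gcongr
  · rw [← ENNReal.ofReal_mul hM, mul_assoc]
    refine ENNReal.ofReal_le_ofReal ?_
    gcongr
    exact norm_multiplier_sq_le hg hb hβ hβ0 f

/-- The operator `f ↦ √|V| Φ f`, for a potential that is bounded relative to `Φ`. -/
def rootPotential {V : E n → ℝ} (hV : AEStronglyMeasurable V) (Φ : L2 n →L[ℂ] L2 n) (C : ℝ)
    (hC : ∀ f, ∫⁻ x, ‖V x‖ₑ * ‖Φ f x‖ₑ ^ 2 ≤ ENNReal.ofReal (C * ‖f‖ ^ 2)) :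
    L2 n →L[ℂ] L2 n :=
  mkLp (fun f x => (√|V x| : ℂ) * Φ f x) C
    (fun f => (Complex.measurable_ofReal.comp_aemeasurable
      hV.aemeasurable.abs.sqrt).aestronglyMeasurable.mul (Lp.aestronglyMeasurable _))
    (fun f f' => by
      rw [map_add]
      filter_upwards [Lp.coeFn_add (Φ f) (Φ f')] with ξ h
      rw [h, Pi.add_apply, mul_add])
    (fun c f => by
      rw [map_smul]
      filter_upwards [Lp.coeFn_smul c (Φ f)] with ξ h
      rw [h, Pi.smul_apply, smul_eq_mul, mul_left_comm])
    (fun f => by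
      refine le_trans (le_of_eq (lintegral_congr fun x => ?_)) (hC f)
      rw [enorm_ofReal_mul_sq, Real.sq_sqrt (abs_nonneg _), ← Real.norm_eq_abs, ofReal_norm])

theorem coeFn_rootPotential {V : E n → ℝ} {hV : AEStronglyMeasurable V} {Φ : L2 n →L[ℂ] L2 n} {C : ℝ}
    {hC : ∀ f, ∫⁻ x, ‖V x‖ₑ * ‖Φ f x‖ₑ ^ 2 ≤ ENNReal.ofReal (C * ‖f‖ ^ 2)} (f : L2 n) :
    rootPotential hV Φ C hC f =ᵐ[volume] fun x => (√|V x| : ℂ) * Φ f x :=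
  coeFn_mkLp f

theorem isCompactOperator_of_forall_exists {X Y : Type*} [NormedAddCommGroup X] [NormedSpace ℂ X]
    [NormedAddCommGroup Y] [NormedSpace ℂ Y] [CompleteSpace Y] {B : X →L[ℂ] Y}
    (h : ∀ ε > 0, ∃ C : X →L[ℂ] Y, IsCompactOperator C ∧ ∀ f, ‖B f - C f‖ ^ 2 ≤ ε * ‖f‖ ^ 2) :
    IsCompactOperator B := by
  have hcl : B ∈ closure {C : X →L[ℂ] Y | IsCompactOperator C} := by
    rw [Metric.mem_closure_iff]
    intro ε hε
    obtain ⟨C, hC, hb⟩ := h ((ε / 2) ^ 2) (by positivity)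
    refine ⟨C, hC, ?_⟩
    rw [dist_eq_norm]
    refine lt_of_le_of_lt (ContinuousLinearMap.opNorm_le_bound _ (half_pos hε).le fun f => ?_)
      (half_lt_self hε)
    have := hb f
    rw [← mul_pow] at this
    exact (pow_le_pow_iff_left₀ (norm_nonneg _) (by positivity) two_ne_zero).1 this
  have hc : IsClosed {C : X →L[ℂ] Y | IsCompactOperator C} := isClosed_setOfPred_isCompactOperator
  rwa [hc.closure_eq] at hcl

theorem abs_indicator_le {g : E n → ℝ} {b : ℝ} (hb : ∀ ξ, |g ξ| ≤ b) (B : Set (E n)) (ξ : E n) :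
    |B.indicator g ξ| ≤ b := by
  by_cases h : ξ ∈ B
  · rw [indicator_of_mem h]; exact hb ξ
  · rw [indicator_of_notMem h, abs_zero]; exact (abs_nonneg _).trans (hb ξ)

theorem multiplier_indicator_eq {g : E n → ℝ} (hg : AEStronglyMeasurable g) {b : ℝ}
    (hb : ∀ ξ, |g ξ| ≤ b) (R : ℝ) (f : L2 n) :
    ∀ᵐ x, multiplier ((Metric.ball (0 : E n) R).indicator g)
      (hg.indicator measurableSet_ball) b (abs_indicator_le hb _) f x =
      ∫ ξ, (Real.fourierChar (inner ℝ ξ x) : ℂ) *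
        (((Metric.ball (0 : E n) R).indicator g ξ : ℝ) : ℂ) * f ξ := by
  set B := Metric.ball (0 : E n) R
  set h : E n → ℂ := fun ξ => ((B.indicator g ξ : ℝ) : ℂ) * f ξ with hh
  have hm : MemLp h 2 := (memLp_congr_ae (coeFn_mulLp (hg.indicator measurableSet_ball)
    (abs_indicator_le hb B) f)).1 (Lp.memLp _)
  have hind : h = B.indicator h := by
    ext ξ
    by_cases hξ : ξ ∈ B
    · rw [indicator_of_mem hξ]
    · rw [indicator_of_notMem hξ, hh]
      simp only
      rw [indicator_of_notMem hξ]
      simp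
  have hint : Integrable h := by
    rw [hind, integrable_indicator_iff measurableSet_ball]
    have : IsFiniteMeasure (volume.restrict B) :=
      ⟨by rw [Measure.restrict_apply_univ]; exact measure_ball_lt_top⟩
    exact (hm.restrict B).integrable one_le_two
  have e : multiplier (B.indicator g) (hg.indicator measurableSet_ball) b (abs_indicator_le hb _) f =
      𝓕⁻ (hm.toLp h) := by
    change 𝓕⁻ (mulLp (B.indicator g) (hg.indicator measurableSet_ball) b
      (abs_indicator_le hb _) f) = _
    congr 1
  rw [e]
  filter_upwards [coeFn_fourierInv_toLp hint hm] with x hx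
  rw [hx, Real.fourierInv_eq]
  refine integral_congr_ae (Eventually.of_forall fun ξ => ?_)
  simp only [hh, Circle.smul_def, smul_eq_mul, mul_assoc, B]

/-- Low frequencies give a Hilbert–Schmidt kernel, because `V` is integrable and `g` is square
integrable on a ball. High frequencies give an operator of small norm, because `g² ≤ a / R^s` there.
-/
theorem isCompactOperator_rootPotential {s p C : ℝ} (hs : 0 < s) (hC : 0 < C)
    (hF : FormBound n s p C) {V : E n → ℝ} (hV1 : Integrable V) (hVp : MemLp V (ENNReal.ofReal p))
    {g : E n → ℝ} (hg : AEStronglyMeasurable g) {b : ℝ} (hb : ∀ ξ, |g ξ| ≤ b) {a : ℝ}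
    (ha0 : 0 < a) (ha : ∀ ξ, (1 + ‖ξ‖ ^ s) * g ξ ^ 2 ≤ a) (B : L2 n →L[ℂ] L2 n)
    (hB : ∀ f, B f =ᵐ[volume] fun x => (√|V x| : ℂ) * multiplier g hg b hb f x) :
    IsCompactOperator B := by
  have hb0 : 0 ≤ b := (abs_nonneg _).trans (hb 0)
  refine isCompactOperator_of_forall_exists fun ε hε => ?_
  obtain ⟨w, M, hM, hw, hwε, hle⟩ := exists_le_add_of_memLp hVp
    (ε := ε / (2 * C * a)) (by positivity)
  -- With this `R` and with `w` of norm at most `ε/(2Ca)`, the two parts of the potential contribute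
  -- `ε/2` each at high frequencies.
  set R : ℝ := (2 * M * a / ε) ^ (1 / s) with hR
  have hRs : R ^ s = 2 * M * a / ε := by
    rw [hR, ← Real.rpow_mul (by positivity), one_div, inv_mul_cancel₀ hs.ne', Real.rpow_one]
  have hR0 : 0 < R := by positivity
  set U := Metric.ball (0 : E n) R with hU
  have hgU := hg.indicator (s := U) measurableSet_ball
  have hgU' := hg.indicator (s := Uᶜ) measurableSet_ball.compl
  have hind : ∀ (B : Set (E n)) ξ, (1 + ‖ξ‖ ^ s) * (B.indicator g ξ) ^ 2 ≤ a := by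
    intro B ξ
    by_cases h : ξ ∈ B
    · rw [indicator_of_mem h]; exact ha ξ
    · rw [indicator_of_notMem h]; simpa using ha0.le
  have hsmall : ∀ ξ, (Uᶜ.indicator g ξ) ^ 2 ≤ a / R ^ s := by
    intro ξ
    by_cases h : ξ ∈ Uᶜ
    · rw [indicator_of_mem h, le_div_iff₀ (by positivity), mul_comm]
      refine le_trans ?_ (ha ξ)
      gcongr
      have : R ≤ ‖ξ‖ := by simpa [hU] using h
      have := Real.rpow_le_rpow hR0.le this hs.le
      linarith
    · rw [indicator_of_notMem h, zero_pow two_ne_zero]; positivity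
  have hsq : ∀ ξ, (U.indicator g ξ) ^ 2 ≤ b ^ 2 := fun ξ => by
    rw [← sq_abs]
    have := abs_indicator_le hb U ξ
    gcongr
  have hCU := fun f => lintegral_potential_multiplier_le hC.le hF hw (by positivity) hM.le hwε hle hgU
    (abs_indicator_le hb U) ha0 (hind U) hsq (by positivity) f
  refine ⟨rootPotential hV1.1 (multiplier _ hgU b (abs_indicator_le hb U)) _ hCU, ?_, fun f => ?_⟩
  · have hk : MemLp (fun z : E n × E n => (√|V z.1| : ℂ) *
        ((Real.fourierChar (inner ℝ z.2 z.1) : ℂ) * ((U.indicator g z.2 : ℝ) : ℂ))) 2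
        ((volume : Measure (E n)).prod volume) := by
      have hm : AEStronglyMeasurable (fun z : E n × E n => (√|V z.1| : ℂ) *
        ((Real.fourierChar (inner ℝ z.2 z.1) : ℂ) * ((U.indicator g z.2 : ℝ) : ℂ)))
        ((volume : Measure (E n)).prod volume) := by
        refine AEStronglyMeasurable.mul ?_ (AEStronglyMeasurable.mul ?_ ?_)
        · exact (Complex.measurable_ofReal.comp_aemeasurable
            hV1.aemeasurable.abs.sqrt.comp_fst).aestronglyMeasurable
        · refine Continuous.aestronglyMeasurable ?_
          have := Real.continuous_fourierChar
          fun_prop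
        · exact (Complex.measurable_ofReal.comp_aemeasurable
            hgU.aemeasurable.comp_snd).aestronglyMeasurable
      refine (memLp_two_iff_integrable_sq_norm hm).2 ?_
      have hg2 : Integrable (fun ξ => (U.indicator g ξ) ^ 2) := by
        have e : (fun ξ => (U.indicator g ξ) ^ 2) = U.indicator fun ξ => g ξ ^ 2 := by
          ext ξ; by_cases h : ξ ∈ U <;> simp [h]
        rw [e, integrable_indicator_iff measurableSet_ball]
        refine Measure.integrableOn_of_bounded (M := b ^ 2) measure_ball_lt_top.ne (hg.pow 2)
          (Eventually.of_forall fun ξ => ?_)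
        rw [Real.norm_of_nonneg (sq_nonneg _), ← sq_abs]
        have := hb ξ
        gcongr
      refine (hV1.abs.mul_prod hg2).congr (Eventually.of_forall fun z => ?_)
      simp only [norm_mul, Complex.norm_real, Circle.norm_coe, one_mul, mul_pow, Real.norm_eq_abs,
        sq_abs]
      rw [Real.sq_sqrt (abs_nonneg _)]
    refine isCompactOperator_of_kernel hk _ fun f => ?_
    filter_upwards [coeFn_rootPotential (hV := hV1.1) (hC := hCU) f,
      multiplier_indicator_eq hg hb R f] with x h1 h2
    rw [h1, h2, ← integral_const_mul]
    refine integral_congr_ae (Eventually.of_forall fun ξ => ?_)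
    simp only
    ring
  · have h := lintegral_potential_multiplier_le hC.le hF hw (by positivity) hM.le hwε hle hgU'
      (abs_indicator_le hb Uᶜ) ha0 (hind _) hsmall (by positivity) f
    have e : (C * (ε / (2 * C * a)) * a + M * (a / R ^ s)) = ε := by
      rw [hRs]; field_simp; norm_num
    rw [e] at h
    refine norm_sq_le_of_lintegral_le (by positivity) (le_trans (le_of_eq ?_) h)
    have hsplit : multiplier g hg b hb f = multiplier _ hgU b (abs_indicator_le hb U) f +
        multiplier _ hgU' b (abs_indicator_le hb Uᶜ) f := by
      apply (Lp.fourierTransformₗᵢ (E n) ℂ).injective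
      change 𝓕 (multiplier g hg b hb f) = 𝓕 (_ + _ : L2 n)
      rw [FourierTransform.fourier_add]
      apply Lp.ext
      filter_upwards [fourier_multiplier hg hb f, fourier_multiplier hgU (abs_indicator_le hb U) f,
        fourier_multiplier hgU' (abs_indicator_le hb Uᶜ) f, Lp.coeFn_add
          (𝓕 (multiplier _ hgU b (abs_indicator_le hb U) f) : L2 n)
          (𝓕 (multiplier _ hgU' b (abs_indicator_le hb Uᶜ) f))] with ξ h1 h2 h3 h4
      rw [h4, Pi.add_apply, h1, h2, h3, ← add_mul]
      have := congr_fun (indicator_self_add_compl U g) ξ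
      rw [Pi.add_apply] at this
      rw [← Complex.ofReal_add, this]
    refine lintegral_congr_ae ?_
    filter_upwards [hB f, coeFn_rootPotential (hV := hV1.1) (hC := hCU) f,
      Lp.coeFn_sub (B f) (rootPotential hV1.1 (multiplier _ hgU b (abs_indicator_le hb U)) _ hCU f),
      Lp.coeFn_add (multiplier _ hgU b (abs_indicator_le hb U) f)
        (multiplier _ hgU' b (abs_indicator_le hb Uᶜ) f)] with x h1 h2 h3 h4
    rw [h3, Pi.sub_apply, h1, h2, hsplit, h4, Pi.add_apply, ← mul_sub, add_sub_cancel_left,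
      enorm_ofReal_mul_sq, Real.sq_sqrt (abs_nonneg _), ← Real.norm_eq_abs, ofReal_norm]

end Multiplier

/-! ### The Hamiltonian as a pencil -/

section Hamiltonian

open Filter Topology Set
open scoped ENNReal

variable {n : ℕ}

/-- The Fourier multiplier `(T(2πξ) + μ)^{-1/2}`. -/
def resolventSymbol (T : E n → ℝ) (μ : ℝ) (ξ : E n) : ℝ := (√(T ((2 * Real.pi) • ξ) + μ))⁻¹

theorem symbol_nonneg (P : E n → ℝ) (r : ℝ) (p : E n) : 0 ≤ symbol P r p :=
  Real.rpow_nonneg (abs_nonneg _) _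

theorem KineticAssumptions.aemeasurable_symbol_smul {P : E n → ℝ} {Ω : Set (E n)} {r s : ℝ}
    (hT : KineticAssumptions P Ω r s) :
    AEMeasurable fun ξ : E n => symbol P r ((2 * Real.pi) • ξ) := by
  have hq := Measure.quasiMeasurePreserving_smul (volume : Measure (E n))
    (r := 2 * Real.pi) (by positivity)
  exact (hT.measurable.comp_quasiMeasurePreserving hq).abs.pow_const r

/-- On the compact set `Ω` the added `1` makes up for the zeros of `T`; outside, the growth
assumption applies, and the dilation by `2π > 1` only increases norms. -/
theorem KineticAssumptions.exists_lower_bound {P : E n → ℝ} {Ω : Set (E n)} {r s : ℝ}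
    (hT : KineticAssumptions P Ω r s) :
    ∃ c : ℝ, 0 < c ∧ ∀ ξ : E n, c * (1 + ‖ξ‖ ^ s) ≤ symbol P r ((2 * Real.pi) • ξ) + 1 := by
  obtain ⟨C₁, C₂, hC₁, hC₂, hg⟩ := hT.growth
  obtain ⟨R, hR0, hR⟩ := hT.isCompact.isBounded.exists_pos_norm_le
  have hle : ∀ ξ : E n, ‖ξ‖ ≤ ‖(2 * Real.pi) • ξ‖ := by
    intro ξ
    rw [norm_smul, Real.norm_of_nonneg (by positivity)]
    exact le_mul_of_one_le_left (norm_nonneg _) (by linarith [Real.pi_gt_three])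
  have hRs : 0 < R ^ s := by positivity
  refine ⟨min (min C₁ 1) (1 / (1 + R ^ s)), by positivity, fun ξ => ?_⟩
  have h0 : 0 ≤ ‖ξ‖ ^ s := by positivity
  by_cases h : (2 * Real.pi) • ξ ∈ Ω
  · have h1 : ‖ξ‖ ^ s ≤ R ^ s :=
      Real.rpow_le_rpow (norm_nonneg _) ((hle ξ).trans (hR _ h)) hT.s_pos.le
    calc min (min C₁ 1) (1 / (1 + R ^ s)) * (1 + ‖ξ‖ ^ s) ≤ 1 / (1 + R ^ s) * (1 + R ^ s) := by
          gcongr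
          exact min_le_right _ _
      _ = 1 := by field_simp
      _ ≤ _ := by linarith [symbol_nonneg P r ((2 * Real.pi) • ξ)]
  · have h1 : ‖ξ‖ ^ s ≤ ‖(2 * Real.pi) • ξ‖ ^ s :=
      Real.rpow_le_rpow (norm_nonneg _) (hle ξ) hT.s_pos.le
    have h2 := hg _ h
    have h3 : C₁ * ‖ξ‖ ^ s ≤ C₁ * ‖(2 * Real.pi) • ξ‖ ^ s := by gcongr
    calc min (min C₁ 1) (1 / (1 + R ^ s)) * (1 + ‖ξ‖ ^ s) ≤ min C₁ 1 * (1 + ‖ξ‖ ^ s) :=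
          mul_le_mul_of_nonneg_right (min_le_left _ _) (by positivity)
      _ = min C₁ 1 + min C₁ 1 * ‖ξ‖ ^ s := by ring
      _ ≤ 1 + C₁ * ‖ξ‖ ^ s := by
          gcongr
          · exact min_le_right _ _
          · exact min_le_left _ _
      _ ≤ _ := by linarith

/-- The data identifying the quadratic form of `T + lam V` with a compact perturbation of the
identity on `L²`. -/
structure PencilData (T V : E n → ℝ) (lam : ℝ) where
  /-- The square root of the resolvent of the kinetic energy. -/
  D : L2 n →L[ℂ] L2 n
  /-- The potential energy, relative to the kinetic energy. -/
  K : L2 n →L[ℂ] L2 n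
  /-- The energy shift. -/
  μ : ℝ
  μ_pos : 0 < μ
  isCompact : IsCompactOperator K
  isSymmetric : (K : L2 n →ₗ[ℂ] L2 n).IsSymmetric
  norm_D : ∀ f, μ * ‖D f‖ ^ 2 ≤ ‖f‖ ^ 2
  injective : Function.Injective D
  coercive : ∀ f, ‖f‖ ^ 2 / 2 ≤ ‖f‖ ^ 2 + (inner ℂ f (K f)).re
  range_D : ∀ ψ, ψ ∈ formDomain T V ↔ ∃ f, D f = ψ
  integrable_kinetic : ∀ φ f, Integrable (kineticDensity T (D φ) (D f))
  integrable_potential : ∀ φ f, Integrable (potentialDensity V (D φ) (D f))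
  energyForm_eq : ∀ φ f, energyForm T V lam (D φ) (D f) = pform D K μ φ f

theorem integral_conj_mul_eq_inner {α : Type*} [MeasurableSpace α] {μ : Measure α}
    (f g : Lp ℂ 2 μ) : inner ℂ f g = ∫ x, conj (f x) * g x ∂μ := by
  rw [L2.inner_def]
  refine integral_congr_ae (Eventually.of_forall fun x => ?_)
  simp [RCLike.inner_apply, mul_comm]

theorem integrable_conj_mul {α : Type*} [MeasurableSpace α] {μ : Measure α}
    (f g : Lp ℂ 2 μ) : Integrable (fun x => conj (f x) * g x) μ := by
  refine (L2.integrable_inner f g (𝕜 := ℂ)).congr (Eventually.of_forall fun x => ?_)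
  simp [RCLike.inner_apply, mul_comm]

/-- Substituting `ψ = D f`, with `D` the multiplier `(T + μ)^{-1/2}`, turns `T + μ` into the
identity. The potential becomes `K = lam • B* J B` with `B = √|V| D` and `J` multiplication by the
sign of `V`, and `K` is compact because `B` is. -/
theorem nonempty_pencilData (hn : 0 < n) {P V : E n → ℝ} {Ω : Set (E n)} {r s : ℝ}
    (hT : KineticAssumptions P Ω r s) (hV : PotentialAssumptions (symbol P r) s V) {lam : ℝ}
    (hlam : 0 < lam) : Nonempty (PencilData (symbol P r) V lam) := by
  obtain ⟨c, hc, hlow⟩ := hT.exists_lower_bound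
  obtain ⟨p, C, hp, hC, hF, hVp⟩ := exists_formBound hn hT.s_pos hV
  have hV1 : Integrable V := memLp_one_iff_integrable.1 hV.integrable
  obtain ⟨w, M, hM, hw, hwε, hle⟩ := exists_le_add_of_memLp hVp
    (ε := c / (4 * lam * C)) (by positivity)
  set T := symbol P r with hTdef
  have hT0 : ∀ p, 0 ≤ T p := symbol_nonneg P r
  -- The small part of `V` contributes `1/4` to the relative bound by the choice `c / (4 lam C)`,
  -- the bounded part `lam M / μ ≤ 1/4`; the sum `1/2` is the constant in `coercive`.
  set μ : ℝ := 1 + 4 * lam * M with hμ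
  have hμ1 : 1 ≤ μ := by rw [hμ]; have : 0 < 4 * lam * M := by positivity
                         linarith
  have hμ0 : 0 < μ := by linarith
  set g : E n → ℝ := resolventSymbol T μ with hgdef
  have hTm : AEMeasurable fun ξ : E n => T ((2 * Real.pi) • ξ) := hT.aemeasurable_symbol_smul
  have hg : AEStronglyMeasurable g := (hTm.add_const μ).sqrt.inv.aestronglyMeasurable
  have hTμ : ∀ ξ : E n, 0 < T ((2 * Real.pi) • ξ) + μ := fun ξ => by
    linarith [hT0 ((2 * Real.pi) • ξ)]
  have hgpos : ∀ ξ, 0 < g ξ := fun ξ => inv_pos.2 (Real.sqrt_pos.2 (hTμ ξ))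
  have hg2 : ∀ ξ, g ξ ^ 2 = (T ((2 * Real.pi) • ξ) + μ)⁻¹ := fun ξ => by
    rw [hgdef, resolventSymbol, inv_pow, Real.sq_sqrt (hTμ ξ).le]
  have hβ : ∀ ξ, g ξ ^ 2 ≤ μ⁻¹ := fun ξ => by
    rw [hg2]
    gcongr
    linarith [hT0 ((2 * Real.pi) • ξ)]
  have hb : ∀ ξ, |g ξ| ≤ 1 := fun ξ => by
    refine abs_le_one_iff_mul_self_le_one.2 ?_
    rw [← sq]
    exact (hβ ξ).trans (inv_le_one_of_one_le₀ hμ1)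
  have ha : ∀ ξ, (1 + ‖ξ‖ ^ s) * g ξ ^ 2 ≤ 1 / c := fun ξ => by
    rw [hg2, ← div_eq_mul_inv, div_le_div_iff₀ (hTμ ξ) hc]
    linarith [hlow ξ]
  have ha0 : 0 < 1 / c := by positivity
  set D := multiplier g hg 1 hb with hD
  have hpot := fun f => lintegral_potential_multiplier_le hC.le hF hw (by positivity) hM.le hwε hle hg
    hb ha0 ha hβ (by positivity) f
  set κ : ℝ := C * (c / (4 * lam * C)) * (1 / c) + M * μ⁻¹ with hκ
  have hκle : lam * κ ≤ 1 / 2 := by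
    have e : C * (c / (4 * lam * C)) * (1 / c) = 1 / (4 * lam) := by field_simp
    have h1 : lam * (M * μ⁻¹) ≤ 1 / 4 := by
      rw [← mul_assoc, ← div_eq_mul_inv, div_le_iff₀ hμ0, hμ]
      linarith
    have h2 : lam * (1 / (4 * lam)) = 1 / 4 := by field_simp
    rw [hκ, e, mul_add, h2]
    linarith
  have hκ0 : 0 ≤ κ := by positivity
  set B := rootPotential hV1.1 D κ hpot with hBdef
  have hB : ∀ f, B f =ᵐ[volume] fun x => (√|V x| : ℂ) * D f x := fun f => coeFn_rootPotential f
  have hBn : ∀ f, ‖B f‖ ^ 2 ≤ κ * ‖f‖ ^ 2 := by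
    intro f
    refine norm_sq_le_of_lintegral_le (by positivity) (le_trans (le_of_eq ?_) (hpot f))
    refine lintegral_congr_ae ?_
    filter_upwards [hB f] with x h1
    rw [h1, enorm_ofReal_mul_sq, Real.sq_sqrt (abs_nonneg _), ← Real.norm_eq_abs, ofReal_norm]
  have hBc : IsCompactOperator B :=
    isCompactOperator_rootPotential hT.s_pos hC hF hV1 hVp hg hb ha0 ha B hB
  have hsgn : ∀ x, |Real.sign (V x)| ≤ 1 := fun x => by
    rcases Real.sign_apply_eq (V x) with h | h | h <;> simp [h]
  have hsm : AEStronglyMeasurable fun x => Real.sign (V x) := by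
    have : Measurable Real.sign := by
      unfold Real.sign
      exact Measurable.ite measurableSet_Iio measurable_const
        (Measurable.ite measurableSet_Ioi measurable_const measurable_const)
    exact (this.comp_aemeasurable hV1.aemeasurable).aestronglyMeasurable
  set J : L2 n →L[ℂ] L2 n := mulLp (fun x => Real.sign (V x)) hsm 1 hsgn with hJ
  set K : L2 n →L[ℂ] L2 n := (lam : ℂ) • (ContinuousLinearMap.adjoint B ∘L (J ∘L B)) with hK
  have hKi : ∀ φ f, inner ℂ φ (K f) = lam * inner ℂ (B φ) (J (B f)) := by
    intro φ f
    rw [hK, smul_apply, inner_smul_right, ContinuousLinearMap.comp_apply,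
      ContinuousLinearMap.adjoint_inner_right, ContinuousLinearMap.comp_apply]
  have hdens : ∀ φ f, (fun x => conj (B φ x) * J (B f) x) =ᵐ[volume]
      potentialDensity V (D φ) (D f) := by
    intro φ f
    filter_upwards [hB φ, hB f, coeFn_mulLp hsm hsgn (B f)] with x h1 h2 h3
    rw [h3, h1, h2, potentialDensity, map_mul, Complex.conj_ofReal]
    have e : ((V x : ℝ) : ℂ) = (√|V x| : ℂ) * (√|V x| : ℂ) * (Real.sign (V x) : ℂ) := by
      rw [← Complex.ofReal_mul, ← Complex.ofReal_mul, Real.mul_self_sqrt (abs_nonneg _), mul_comm]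
      congr 1
      rcases lt_trichotomy (V x) 0 with h | h | h
      · rw [Real.sign_of_neg h, abs_of_neg h]; ring
      · simp [h]
      · rw [Real.sign_of_pos h, abs_of_pos h]; ring
    rw [e]; ring
  have hKpot : ∀ φ f, inner ℂ φ (K f) = lam * ∫ x, potentialDensity V (D φ) (D f) x := by
    intro φ f
    rw [hKi, integral_conj_mul_eq_inner, integral_congr_ae (hdens φ f)]
  have hFD : ∀ f, (𝓕 (D f) : L2 n) =ᵐ[volume] fun ξ => (g ξ : ℂ) * f ξ := fun f =>
    fourier_multiplier hg hb f
  have hkin : ∀ φ f, kineticDensity T (D φ) (D f) =ᵐ[volume] fun ξ => conj (φ ξ) * f ξ -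
      μ * (conj ((𝓕 (D φ) : L2 n) ξ) * (𝓕 (D f) : L2 n) ξ) := by
    intro φ f
    filter_upwards [hFD φ, hFD f] with ξ h1 h2
    rw [kineticDensity, h1, h2, map_mul, Complex.conj_ofReal]
    have e : ((T ((2 * Real.pi) • ξ) : ℝ) : ℂ) * (g ξ * g ξ) = 1 - μ * (g ξ * g ξ) := by
      have h := hg2 ξ
      have h' := (hTμ ξ).ne'
      have : T ((2 * Real.pi) • ξ) * (g ξ * g ξ) = 1 - μ * (g ξ * g ξ) := by
        rw [← sq, h]; field_simp; ring
      exact_mod_cast this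
    linear_combination (conj (φ ξ) * f ξ) * e
  have hkinint : ∀ φ f, Integrable (kineticDensity T (D φ) (D f)) := fun φ f =>
    ((integrable_conj_mul φ f).sub ((integrable_conj_mul _ _).const_mul _)).congr (hkin φ f).symm
  have hpotint : ∀ φ f, Integrable (potentialDensity V (D φ) (D f)) := fun φ f =>
    (integrable_conj_mul (B φ) (J (B f))).congr (hdens φ f)
  refine ⟨⟨D, K, μ, hμ0, ?_, ?_, ?_, ?_, ?_, ?_, hkinint, hpotint, ?_⟩⟩
  · exact ((hBc.clm_comp J).clm_comp (ContinuousLinearMap.adjoint B)).smul (lam : ℂ)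
  · intro φ f
    change inner ℂ (K φ) f = inner ℂ φ (K f)
    rw [← inner_conj_symm, hKpot, hKpot, map_mul, Complex.conj_ofReal, ← integral_conj]
    congr 2
    ext x
    simp only [potentialDensity, map_mul, Complex.conj_ofReal, Complex.conj_conj]
    ring
  · intro f
    have := norm_multiplier_sq_le hg hb hβ (by positivity) f
    calc μ * ‖D f‖ ^ 2 ≤ μ * (μ⁻¹ * ‖f‖ ^ 2) := by gcongr
      _ = ‖f‖ ^ 2 := by field_simp
  · intro f f' h
    apply Lp.ext
    filter_upwards [hFD f, hFD f'] with ξ h1 h2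
    rw [h, h2] at h1
    exact (mul_left_cancel₀ (by exact_mod_cast (hgpos ξ).ne') h1).symm
  · intro f
    have h1 : -(lam * (κ * ‖f‖ ^ 2)) ≤ (inner ℂ f (K f)).re := by
      rw [hKi, Complex.re_ofReal_mul, ← mul_neg]
      gcongr
      have h2 := (abs_le.1 ((Complex.abs_re_le_norm _).trans
        (norm_inner_le_norm (𝕜 := ℂ) (B f) (J (B f))))).1
      have h3 : ‖J (B f)‖ ≤ ‖B f‖ := by
        refine (pow_le_pow_iff_left₀ (norm_nonneg _) (norm_nonneg _) two_ne_zero).1 ?_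
        refine norm_sq_le_of_lintegral_le (by positivity) ?_
        rw [ofReal_norm_sq, ← lintegral_enorm_sq_eq]
        refine lintegral_mono_ae ?_
        filter_upwards [coeFn_mulLp hsm hsgn (B f)] with x hx
        rw [hx, enorm_ofReal_mul_sq]
        refine mul_le_of_le_one_left zero_le ?_
        rw [← sq_abs, ENNReal.ofReal_le_one]
        exact pow_le_one₀ (abs_nonneg _) (hsgn x)
      have h4 : ‖B f‖ * ‖J (B f)‖ ≤ ‖B f‖ ^ 2 := by rw [sq]; gcongr
      linarith [hBn f]
    have h2 : lam * (κ * ‖f‖ ^ 2) ≤ 1 / 2 * ‖f‖ ^ 2 := by rw [← mul_assoc]; gcongr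
    linarith
  · intro ψ
    constructor
    -- The condition on `V` in the form domain is implied by the one on `T` through the relative
    -- bound, so it can be dropped here.
    · rintro ⟨h1, -⟩
      have hm : MemLp (fun ξ => (√(T ((2 * Real.pi) • ξ) + μ) : ℂ) * (𝓕 ψ : L2 n) ξ) 2 := by
        refine MemLp.of_le (h1.norm.add ((Lp.memLp (𝓕 ψ : L2 n)).norm.const_mul √μ)) ?_
          (Eventually.of_forall fun ξ => ?_)
        · exact (Complex.measurable_ofReal.comp_aemeasurable
            (hTm.add_const μ).sqrt).aestronglyMeasurable.mul (Lp.aestronglyMeasurable _)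
        · rw [Real.norm_of_nonneg (by simp only [Pi.add_apply]; positivity), Pi.add_apply,
            norm_mul, norm_mul, ← add_mul, Complex.norm_real, Complex.norm_real,
            Real.norm_of_nonneg (Real.sqrt_nonneg _), Real.norm_of_nonneg (Real.sqrt_nonneg _)]
          gcongr
          refine Real.sqrt_le_iff.2 ⟨by positivity, ?_⟩
          rw [add_sq, Real.sq_sqrt (hT0 _), Real.sq_sqrt hμ0.le]
          have : 0 ≤ 2 * √(T ((2 * Real.pi) • ξ)) * √μ := by positivity
          linarith
      refine ⟨hm.toLp _, ?_⟩
      apply (Lp.fourierTransformₗᵢ (E n) ℂ).injective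
      change (𝓕 (D (hm.toLp _)) : L2 n) = 𝓕 ψ
      apply Lp.ext
      filter_upwards [hFD (hm.toLp _), hm.coeFn_toLp] with ξ h2 h3
      rw [h2, h3, ← mul_assoc, ← Complex.ofReal_mul, hgdef, resolventSymbol,
        inv_mul_cancel₀ (Real.sqrt_pos.2 (hTμ ξ)).ne', Complex.ofReal_one, one_mul]
    · rintro ⟨f, rfl⟩
      constructor
      · refine MemLp.of_le (Lp.memLp f) ?_ ?_
        · exact (Complex.measurable_ofReal.comp_aemeasurable
            hTm.sqrt).aestronglyMeasurable.mul (Lp.aestronglyMeasurable _)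
        · filter_upwards [hFD f] with ξ h2
          rw [h2, ← mul_assoc, norm_mul, ← Complex.ofReal_mul, Complex.norm_real]
          refine mul_le_of_le_one_left (norm_nonneg _) ?_
          rw [Real.norm_of_nonneg (mul_nonneg (Real.sqrt_nonneg _) (hgpos ξ).le), hgdef,
            resolventSymbol, ← div_eq_mul_inv, div_le_one (Real.sqrt_pos.2 (hTμ ξ))]
          exact Real.sqrt_le_sqrt (by linarith)
      · exact (memLp_congr_ae (hB f)).1 (Lp.memLp _)
  · intro φ f
    rw [energyForm, pform, hKpot, integral_congr_ae (hkin φ f), integral_sub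
      (integrable_conj_mul φ f) ((integrable_conj_mul _ _).const_mul _), integral_const_mul,
      ← integral_conj_mul_eq_inner, ← integral_conj_mul_eq_inner, Lp.inner_fourier_eq]
    ring

/-- Every test function in the form domain is some `D φ`, so the weak equation `H ψ = a ψ` is the
pencil equation for `ψ = D f`. -/
theorem PencilData.eigenspace_hamiltonian {P V : E n → ℝ} {Ω : Set (E n)} {r s : ℝ}
    (hT : KineticAssumptions P Ω r s) (hV : PotentialAssumptions (symbol P r) s V) {lam : ℝ}
    (d : PencilData (symbol P r) V lam) (a : ℝ) :
    eigenspace (hamiltonian (symbol P r) V lam) a =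
      (pencilEigenspace d.D d.K d.μ a).map (d.D : L2 n →ₗ[ℂ] L2 n) := by
  ext ψ
  have h1 : ψ ∈ eigenspace (hamiltonian (symbol P r) V lam) a ↔
      (ψ, (a : ℂ) • ψ) ∈ hamiltonianGraph (symbol P r) V lam := by
    rw [← hamiltonian_graph hT hV lam, LinearPMap.mem_graph_iff]
    constructor
    · rintro ⟨h, e⟩
      exact ⟨⟨ψ, h⟩, rfl, e⟩
    · rintro ⟨y, rfl, e⟩
      exact ⟨y.2, e⟩
  rw [h1]
  constructor
  · rintro ⟨h2, h3⟩
    obtain ⟨f, rfl⟩ := (d.range_D ψ).1 h2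
    refine ⟨f, fun φ => ?_, rfl⟩
    have := (h3 (d.D φ) ((d.range_D _).2 ⟨φ, rfl⟩)).2.2
    rw [d.energyForm_eq, inner_smul_right] at this
    exact this
  · rintro ⟨f, hf, rfl⟩
    refine ⟨(d.range_D _).2 ⟨f, rfl⟩, fun φ' hφ' => ?_⟩
    obtain ⟨φ, rfl⟩ := (d.range_D φ').1 hφ'
    refine ⟨d.integrable_kinetic φ f, d.integrable_potential φ f, ?_⟩
    change energyForm (symbol P r) V lam (d.D φ) (d.D f) = inner ℂ (d.D φ) ((a : ℂ) • d.D f)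
    rw [d.energyForm_eq, inner_smul_right]
    exact hf φ

variable {P V : E n → ℝ} {Ω : Set (E n)} {r s : ℝ}

theorem finiteDimensional_eigenspace_hamiltonian (hn : 0 < n)
    (hT : KineticAssumptions P Ω r s) (hV : PotentialAssumptions (symbol P r) s V) {lam : ℝ}
    (hlam : 0 < lam) {a : ℝ} (ha : a < 0) :
    FiniteDimensional ℂ (eigenspace (hamiltonian (symbol P r) V lam) a) := by
  obtain ⟨d⟩ := nonempty_pencilData hn hT hV hlam
  exact finiteDimensional_eigenspace_of_pencil d.isCompact d.μ_pos d.norm_D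
    (d.eigenspace_hamiltonian hT hV) ha

theorem card_le_numNegEigenvalues_hamiltonian (hn : 0 < n)
    (hT : KineticAssumptions P Ω r s) (hV : PotentialAssumptions (symbol P r) s V) {lam : ℝ}
    (hlam : 0 < lam) {ι : Type*} [Fintype ι] (ψ : ι → L2 n)
    (hψ : ∀ i, ψ i ∈ formDomain (symbol P r) V)
    (hneg : ∀ c : ι → ℂ, c ≠ 0 →
      (energyForm (symbol P r) V lam (∑ i, c i • ψ i) (∑ i, c i • ψ i)).re < 0) :
    (Fintype.card ι : ℕ∞) ≤ numNegEigenvalues (hamiltonian (symbol P r) V lam) := by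
  obtain ⟨d⟩ := nonempty_pencilData hn hT hV hlam
  choose f hf using fun i => (d.range_D _).1 (hψ i)
  refine card_le_numNegEigenvalues_of_pencil d.isCompact d.isSymmetric d.μ_pos d.norm_D
    d.injective d.coercive (d.eigenspace_hamiltonian hT hV) f fun c hc => ?_
  rw [← d.energyForm_eq]
  have e : d.D (∑ i, c i • f i) = ∑ i, c i • ψ i := by
    simp only [map_sum, map_smul, hf]
  rw [e]
  exact hneg c hc

end Hamiltonian

/-! ### The zero set as a hypersurface -/

section Geometry

open Filter Topology Set Metric
open scoped ENNReal NNReal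

/-! ### Compactness of the zero set and regularity of `P` near it. -/

section ZeroSet

variable {n : ℕ} {P : E n → ℝ} {Ω : Set (E n)} {r s : ℝ}

theorem KineticAssumptions.mem_zeroSet (hT : KineticAssumptions P Ω r s) {p : E n} :
    p ∈ zeroSet P r ↔ P p = 0 := by
  change |P p| ^ r = 0 ↔ P p = 0
  rw [Real.rpow_eq_zero (abs_nonneg _) (by linarith [hT.one_le_r]), abs_eq_zero]

theorem KineticAssumptions.zeroSet_subset_interior (hT : KineticAssumptions P Ω r s) :
    zeroSet P r ⊆ interior Ω := by
  obtain ⟨σ, hσ, h⟩ := hT.dist_compl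
  intro p hp
  rw [mem_interior_iff_mem_nhds, Metric.mem_nhds_iff]
  refine ⟨σ, hσ, fun q hq => ?_⟩
  by_contra hqΩ
  have := h p hp q hqΩ
  rw [mem_ball, dist_comm] at hq
  linarith

theorem KineticAssumptions.isCompact_zeroSet (hT : KineticAssumptions P Ω r s) :
    IsCompact (zeroSet P r) := by
  refine hT.isCompact.of_isClosed_subset ?_ hT.subset
  have e : zeroSet P r = Ω ∩ P ⁻¹' {0} := by
    ext p
    constructor
    · exact fun hp => ⟨hT.subset hp, hT.mem_zeroSet.1 hp⟩
    · exact fun hp => hT.mem_zeroSet.2 hp.2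
  rw [e]
  exact hT.contDiffOn.continuousOn.preimage_isClosed_of_isClosed hT.isCompact.isClosed
    isClosed_singleton

theorem KineticAssumptions.contDiffAt (hT : KineticAssumptions P Ω r s) {p : E n}
    (hp : p ∈ zeroSet P r) : ContDiffAt ℝ 2 P p :=
  hT.contDiffOn.contDiffAt (mem_interior_iff_mem_nhds.1 (hT.zeroSet_subset_interior hp))

end ZeroSet

variable {m : ℕ}

/-- The coordinates of `x` other than the `i`-th one. -/
def proj (i : Fin (m + 1)) : E (m + 1) →L[ℝ] (Fin m → ℝ) :=
  ContinuousLinearMap.pi fun k => EuclideanSpace.proj (i.succAbove k)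

/-- The point with `i`-th coordinate `z.1` and other coordinates `z.2`. -/
def ins (i : Fin (m + 1)) : (ℝ × (Fin m → ℝ)) →L[ℝ] E (m + 1) :=
  LinearMap.toContinuousLinearMap
    { toFun := fun z => WithLp.toLp 2 (i.insertNth z.1 z.2)
      map_add' := fun z w => by
        ext j
        refine Fin.succAboveCases i ?_ (fun k => ?_) j <;> simp
      map_smul' := fun c z => by
        ext j
        refine Fin.succAboveCases i ?_ (fun k => ?_) j <;> simp }

theorem proj_apply (i : Fin (m + 1)) (x : E (m + 1)) (k : Fin m) :
    proj i x k = x (i.succAbove k) := rfl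

theorem ins_apply (i : Fin (m + 1)) (z : ℝ × (Fin m → ℝ)) :
    ins i z = WithLp.toLp 2 (i.insertNth z.1 z.2) := rfl

@[simp]
theorem ins_apply_same (i : Fin (m + 1)) (z : ℝ × (Fin m → ℝ)) : ins i z i = z.1 := by
  simp [ins_apply]

@[simp]
theorem proj_ins (i : Fin (m + 1)) (z : ℝ × (Fin m → ℝ)) : proj i (ins i z) = z.2 := by
  ext k
  simp [ins_apply, proj_apply]

@[simp]
theorem ins_proj (i : Fin (m + 1)) (x : E (m + 1)) : ins i (x i, proj i x) = x := by
  ext j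
  refine Fin.succAboveCases i ?_ (fun k => ?_) j <;> simp [ins_apply, proj_apply]

/-- A compact piece `K` of a Lipschitz graph such that `T` grows at most linearly in the direction
transversal to `K`. -/
def IsPatch (T : E (m + 1) → ℝ) (K : Set (E (m + 1))) : Prop :=
  IsCompact K ∧ ∃ (i : Fin (m + 1)) (φ : (Fin m → ℝ) → ℝ) (Λ : ℝ≥0) (L ε : ℝ),
    LipschitzWith Λ φ ∧ 0 < L ∧ 0 < ε ∧ (∀ q ∈ K, q i = φ (proj i q)) ∧
      ∀ q ∈ K, ∀ t ∈ Icc 0 ε, T (ins i (q i + t, proj i q)) ≤ L * t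

variable {P : E (m + 1) → ℝ} {Ω : Set (E (m + 1))} {r s : ℝ}

/-- Strict differentiability with a nonzero partial derivative suffices. For two zeros `q`, `q'`
near `q₀` one has `|A (q - q')| ≤ η ‖q - q'‖`, which bounds the difference of the `i`-th coordinates
by that of the others: the zero set is a Lipschitz graph. The same estimate gives `|P| ≤ L₀ t` at
height `t`, and `r ≥ 1` preserves the linear bound where `|P| ≤ 1`. Surjectivity of `(A, proj i)`
shows that the patch projects onto a neighbourhood. -/
theorem KineticAssumptions.exists_patch (hT : KineticAssumptions P Ω r s) {q₀ : E (m + 1)}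
    (hq₀ : q₀ ∈ zeroSet P r) :
    ∃ ε, 0 < ε ∧ IsPatch (symbol P r) (zeroSet P r ∩ closedBall q₀ ε) ∧
      ∃ i : Fin (m + 1), proj i '' (zeroSet P r ∩ closedBall q₀ ε) ∈ 𝓝 (proj i q₀) := by
  have hst : HasStrictFDerivAt P (fderiv ℝ P q₀) q₀ :=
    (hT.contDiffAt hq₀).hasStrictFDerivAt (by norm_num)
  set A := fderiv ℝ P q₀ with hA
  obtain ⟨i, hi⟩ : ∃ i : Fin (m + 1), A (ins i (1, 0)) ≠ 0 := by
    by_contra! h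
    refine hT.gradient_ne_zero q₀ (hT.zeroSet_subset_interior hq₀) ?_
    have hA0 : A = 0 := by
      ext x
      have hx : x = ∑ j, x j • ins j (1, 0) := by
        ext k
        have hk : ∀ j, (ins j ((1 : ℝ), (0 : Fin m → ℝ))) k = if j = k then 1 else 0 := by
          intro j
          refine Fin.succAboveCases j ?_ (fun l => ?_) k
          · simp
          · rw [← proj_apply, proj_ins]
            simp [(Fin.succAbove_ne j l).symm]
        simp [hk]
      rw [hx, map_sum]
      simp [h]
    rw [gradient, ← hA, hA0, map_zero]
  set α := |A (ins i (1, 0))| with hα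
  have hα0 : 0 < α := abs_pos.2 hi
  set I := ‖(ins i : (ℝ × (Fin m → ℝ)) →L[ℝ] E (m + 1))‖ + 1 with hI
  have hI0 : 0 < I := by positivity
  have hIt : ∀ t : ℝ, ‖ins i (t, 0)‖ ≤ I * |t| := by
    intro t
    refine ((ins i).le_opNorm _).trans ?_
    have : ‖(t, (0 : Fin m → ℝ))‖ = |t| := by simp
    rw [this]
    gcongr
    linarith
  have hIy : ∀ y : Fin m → ℝ, ‖ins i (0, y)‖ ≤ I * ‖y‖ := by
    intro y
    refine ((ins i).le_opNorm _).trans ?_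
    have : ‖((0 : ℝ), y)‖ = ‖y‖ := by simp
    rw [this]
    gcongr
    linarith
  have hsplit : ∀ x : E (m + 1), x = ins i (x i, 0) + ins i (0, proj i x) := by
    intro x
    rw [← map_add]
    simp
  -- With this `η` the error term `η I |d i|` is half of `α |d i|` and can be absorbed.
  set η := α / (2 * I) with hη
  have hη0 : 0 < η := by positivity
  have hloc := hst.isLittleO.def hη0
  obtain ⟨δ, hδ, hball⟩ := Metric.eventually_nhds_iff.1 hloc
  have hest : ∀ x y, dist x q₀ < δ → dist y q₀ < δ → |P x - P y - A (x - y)| ≤ η * ‖x - y‖ := by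
    intro x y hx hy
    exact hball (y := (x, y)) (by rw [Prod.dist_eq]; exact max_lt hx hy)
  set L₀ := (‖A‖ + η) * I with hL₀
  have hL₀0 : 0 < L₀ := by positivity
  -- The first bound keeps points at height `t ≤ ε` above the patch within distance `δ` of `q₀`; the
  -- second gives `L₀ t ≤ 1`, where taking the power `r ≥ 1` does not increase `|P|`.
  set ε := min (δ / (2 * (I + 1))) (1 / L₀) with hε
  have hε0 : 0 < ε := by positivity
  have hεδ : ε * (I + 1) < δ := by
    have : ε ≤ δ / (2 * (I + 1)) := min_le_left _ _
    rw [le_div_iff₀ (by positivity)] at this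
    linarith
  have hεL : L₀ * ε ≤ 1 := by
    have : ε ≤ 1 / L₀ := min_le_right _ _
    rwa [le_div_iff₀ hL₀0, mul_comm] at this
  set K := zeroSet P r ∩ closedBall q₀ ε with hK
  have hKδ : ∀ q ∈ K, dist q q₀ < δ := by
    intro q hq
    have h1 : dist q q₀ ≤ ε := hq.2
    nlinarith
  have hgraph : ∀ q ∈ K, ∀ q' ∈ K,
      |q i - q' i| ≤ 2 * (‖A‖ + η) * I / α * ‖proj i q - proj i q'‖ := by
    intro q hq q' hq'
    have h1 := hest q q' (hKδ q hq) (hKδ q' hq')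
    rw [hT.mem_zeroSet.1 hq.1, hT.mem_zeroSet.1 hq'.1, sub_zero, zero_sub, abs_neg] at h1
    set d := q - q' with hd
    have h2 : ‖d‖ ≤ I * |d i| + I * ‖proj i d‖ := by
      conv_lhs => rw [hsplit d]
      exact (norm_add_le _ _).trans (add_le_add (hIt _) (hIy _))
    have h3 : A d = d i * A (ins i (1, 0)) + A (ins i (0, proj i d)) := by
      conv_lhs => rw [hsplit d, map_add]
      congr 1
      have : ((d i, 0) : ℝ × (Fin m → ℝ)) = d i • (1, 0) := by simp
      rw [this, map_smul, map_smul, smul_eq_mul]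
    have h4 : |A (ins i (0, proj i d))| ≤ ‖A‖ * (I * ‖proj i d‖) := by
      refine (A.le_opNorm _).trans ?_
      gcongr
      exact hIy _
    have h5 : |d i| * α ≤ |A d| + |A (ins i (0, proj i d))| := by
      rw [hα, ← abs_mul]
      have : d i * A (ins i (1, 0)) = A d - A (ins i (0, proj i d)) := by rw [h3]; ring
      rw [this]
      exact abs_sub _ _
    have h6 : η * (I * |d i|) = α / 2 * |d i| := by rw [hη]; field_simp
    have h7 : η * ‖d‖ ≤ η * (I * |d i| + I * ‖proj i d‖) := by gcongr
    have h8 : |d i| * α ≤ 2 * (‖A‖ + η) * I * ‖proj i d‖ := by nlinarith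
    have e1 : q i - q' i = d i := by rw [hd]; simp
    have e2 : proj i q - proj i q' = proj i d := by rw [hd, map_sub]
    rw [e1, e2, div_mul_eq_mul_div, le_div_iff₀ hα0]
    exact h8
  refine ⟨ε, hε0, ⟨hT.isCompact_zeroSet.inter_right isClosed_closedBall, i, ?_⟩, i, ?_⟩
  · classical
    -- Off the projection of `K` the value is irrelevant: only the restriction to that projection is
    -- extended to a Lipschitz function.
    let φ₀ : (Fin m → ℝ) → ℝ := fun y => if h : ∃ q ∈ K, proj i q = y then h.choose i else 0
    have hφ₀ : ∀ q ∈ K, φ₀ (proj i q) = q i := by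
      intro q hq
      have h : ∃ q' ∈ K, proj i q' = proj i q := ⟨q, hq, rfl⟩
      have e : φ₀ (proj i q) = h.choose i := dif_pos h
      have := hgraph _ h.choose_spec.1 q hq
      rw [h.choose_spec.2, sub_self, norm_zero, mul_zero] at this
      rw [e]
      exact sub_eq_zero.1 (abs_eq_zero.1 (le_antisymm this (abs_nonneg _)))
    have hlip : LipschitzOnWith (2 * (‖A‖ + η) * I / α).toNNReal φ₀ (proj i '' K) := by
      refine LipschitzOnWith.of_dist_le_mul ?_
      rintro _ ⟨q, hq, rfl⟩ _ ⟨q', hq', rfl⟩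
      rw [hφ₀ q hq, hφ₀ q' hq', Real.dist_eq, dist_eq_norm, Real.coe_toNNReal _ (by positivity)]
      exact hgraph q hq q' hq'
    obtain ⟨φ, hφ, hφe⟩ := hlip.extend_real
    refine ⟨φ, _, L₀, ε, hφ, hL₀0, hε0, fun q hq => ?_, fun q hq t ht => ?_⟩
    · rw [← hφe ⟨q, hq, rfl⟩, hφ₀ q hq]
    · have e : ins i (q i + t, proj i q) = q + ins i (t, 0) := by
        conv_rhs => rw [← ins_proj i q, ← map_add]
        simp
      have h1 : dist (q + ins i (t, 0)) q₀ < δ := by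
        have h2 : dist (q + ins i (t, 0)) q₀ ≤ dist q q₀ + ‖ins i (t, 0)‖ := by
          rw [dist_eq_norm, dist_eq_norm, add_sub_right_comm]
          exact norm_add_le _ _
        have h3 : dist q q₀ ≤ ε := hq.2
        have h4 := hIt t
        rw [abs_of_nonneg ht.1] at h4
        have h5 : I * t ≤ I * ε := by gcongr; exact ht.2
        linarith
      have h2 := hest _ q h1 (hKδ q hq)
      rw [hT.mem_zeroSet.1 hq.1, sub_zero, add_sub_cancel_left] at h2
      have h3 : |P (q + ins i (t, 0))| ≤ L₀ * t := by
        have h4 := hIt t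
        rw [abs_of_nonneg ht.1] at h4
        have h5 := A.le_opNorm (ins i (t, 0))
        rw [Real.norm_eq_abs] at h5
        have h6 := abs_sub_abs_le_abs_sub (P (q + ins i (t, 0))) (A (ins i (t, 0)))
        have h7 : (‖A‖ + η) * ‖ins i (t, 0)‖ ≤ (‖A‖ + η) * (I * t) := by gcongr
        rw [hL₀]
        linarith
      rw [e, symbol]
      have h4 : L₀ * t ≤ 1 := by
        refine le_trans ?_ hεL
        gcongr
        exact ht.2
      calc |P (q + ins i (t, 0))| ^ r ≤ |P (q + ins i (t, 0))| ^ (1 : ℝ) :=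
            Real.rpow_le_rpow_of_exponent_ge' (abs_nonneg _) (h3.trans h4) zero_le_one hT.one_le_r
        _ ≤ L₀ * t := by rwa [Real.rpow_one]
  · have hst' : HasStrictFDerivAt (fun x => (P x, proj i x)) (A.prod (proj i)) q₀ :=
      hst.prodMk (proj i).hasStrictFDerivAt
    have hsurj : (A.prod (proj i) : E (m + 1) →L[ℝ] ℝ × (Fin m → ℝ)).range = ⊤ := by
      rw [LinearMap.range_eq_top]
      rintro ⟨a, y⟩
      refine ⟨ins i (0, y) + ((a - A (ins i (0, y))) / A (ins i (1, 0))) • ins i (1, 0), ?_⟩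
      simp only [ContinuousLinearMap.coe_coe, ContinuousLinearMap.prod_apply, map_add, map_smul,
        proj_ins]
      refine Prod.ext ?_ ?_
      · simp [div_mul_cancel₀ _ hi]
      · simp
    have hmap := hst'.map_nhds_eq_of_surj hsurj
    rw [hT.mem_zeroSet.1 hq₀] at hmap
    have h1 : (fun x => (P x, proj i x)) '' closedBall q₀ ε ∈ 𝓝 ((0 : ℝ), proj i q₀) := by
      rw [← hmap]
      exact image_mem_map (closedBall_mem_nhds q₀ hε0)
    have h2 : Tendsto (fun y : Fin m → ℝ => ((0 : ℝ), y)) (𝓝 (proj i q₀)) (𝓝 (0, proj i q₀)) :=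
      Continuous.tendsto (by fun_prop) _
    filter_upwards [h2 h1] with y hy
    obtain ⟨x, hx, he⟩ := hy
    rw [Prod.mk.injEq] at he
    exact ⟨x, ⟨hT.mem_zeroSet.2 he.1, hx⟩, he.2⟩

/-! ### The surface measure on a patch -/

/-- The parametrization of a graph. -/
def graphMap (i : Fin (m + 1)) (φ : (Fin m → ℝ) → ℝ) (y : Fin m → ℝ) : E (m + 1) := ins i (φ y, y)

theorem continuous_graphMap (i : Fin (m + 1)) {φ : (Fin m → ℝ) → ℝ} (hφ : Continuous φ) :
    Continuous (graphMap i φ) := by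
  unfold graphMap; fun_prop

theorem graphMap_proj {i : Fin (m + 1)} {φ : (Fin m → ℝ) → ℝ} {q : E (m + 1)}
    (h : q i = φ (proj i q)) : graphMap i φ (proj i q) = q := by
  rw [graphMap, ← h, ins_proj]

/-- A Lipschitz map enlarges Hausdorff measure by at most a constant factor, and `m`-dimensional
Hausdorff measure on `Fin m → ℝ` with the sup norm is Lebesgue measure. The scalar factor comes from
the normalization of `μHE[m]`. -/
theorem euclideanHausdorffMeasure_image_graphMap_le (i : Fin (m + 1)) {φ : (Fin m → ℝ) → ℝ}
    {Λ : ℝ≥0} (hφ : LipschitzWith Λ φ) :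
    ∃ C : ℝ≥0, ∀ A : Set (Fin m → ℝ),
      (μHE[m] : Measure (E (m + 1))) (graphMap i φ '' A) ≤ C * volume A := by
  have hG : LipschitzWith (‖(ins i : (ℝ × (Fin m → ℝ)) →L[ℝ] E (m + 1))‖₊ * max Λ 1)
      (graphMap i φ) := (ins i).lipschitz.comp (hφ.prodMk LipschitzWith.id)
  set G := ‖(ins i : (ℝ × (Fin m → ℝ)) →L[ℝ] E (m + 1))‖₊ * max Λ 1
  refine ⟨Measure.addHaarScalarFactor (volume : Measure (EuclideanSpace ℝ (Fin m)))
    (Measure.hausdorffMeasure (m : ℝ)) * G ^ m, fun A => ?_⟩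
  have h := hG.hausdorffMeasure_image_le (d := m) (Nat.cast_nonneg m) A
  have e : (Measure.hausdorffMeasure (m : ℝ) : Measure (Fin m → ℝ)) = volume := by
    have := @hausdorffMeasure_pi_real (Fin m) _
    simpa using this
  rw [e] at h
  rw [Measure.euclideanHausdorffMeasure_def, Measure.smul_apply, ENNReal.smul_def, smul_eq_mul,
    ENNReal.coe_mul, mul_assoc]
  gcongr
  simpa using h

/-- Holds because `proj i` is Lipschitz. It shows that pieces of the surface lying over open sets of
parameters have positive measure. -/
theorem volume_le_euclideanHausdorffMeasure (i : Fin (m + 1)) (A : Set (E (m + 1)))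
    (hA : (μHE[m] : Measure (E (m + 1))) A = 0) : volume (proj i '' A) = 0 := by
  have h := (proj i).lipschitz.hausdorffMeasure_image_le (d := m) (Nat.cast_nonneg m) A
  have e : (Measure.hausdorffMeasure (m : ℝ) : Measure (Fin m → ℝ)) = volume := by
    have := @hausdorffMeasure_pi_real (Fin m) _
    simpa using this
  rw [e] at h
  rw [Measure.euclideanHausdorffMeasure_def, Measure.smul_apply, ENNReal.smul_def, smul_eq_mul,
    mul_eq_zero, ENNReal.coe_eq_zero, or_iff_right
      (Measure.addHaarScalarFactor_volume_hausdorffMeasure_ne_zero m)] at hA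
  rw [hA, mul_zero] at h
  exact le_antisymm h zero_le

theorem IsPatch.measure_lt_top {T : E (m + 1) → ℝ} {K : Set (E (m + 1))} (h : IsPatch T K) :
    (μHE[m] : Measure (E (m + 1))) K < ⊤ := by
  obtain ⟨hK, i, φ, Λ, L, ε, hφ, -, -, hg, -⟩ := h
  obtain ⟨C, hC⟩ := euclideanHausdorffMeasure_image_graphMap_le i hφ
  have hsub : K ⊆ graphMap i φ '' (proj i '' K) := by
    intro q hq
    exact ⟨proj i q, ⟨q, hq, rfl⟩, graphMap_proj (hg q hq)⟩
  refine (measure_mono hsub).trans_lt ((hC _).trans_lt ?_)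
  exact ENNReal.mul_lt_top ENNReal.coe_lt_top (hK.image (proj i).continuous).measure_lt_top

theorem KineticAssumptions.exists_finite_cover (hT : KineticAssumptions P Ω r s) :
    ∃ (N : ℕ) (K : Fin N → Set (E (m + 1))), (∀ j, IsPatch (symbol P r) (K j)) ∧
      (⋃ j, K j) = zeroSet P r := by
  choose! ε hε hpatch _ using fun (q : E (m + 1)) (hq : q ∈ zeroSet P r) => hT.exists_patch hq
  obtain ⟨t, hts, hcov⟩ := hT.isCompact_zeroSet.elim_nhds_subcover (fun q => closedBall q (ε q))
    fun q hq => closedBall_mem_nhds q (hε q hq)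
  refine ⟨t.card, fun j => zeroSet P r ∩ closedBall (t.equivFin.symm j) (ε (t.equivFin.symm j)),
    fun j => hpatch _ (hts _ (t.equivFin.symm j).2), ?_⟩
  refine Subset.antisymm (iUnion_subset fun j => inter_subset_left) fun q hq => ?_
  obtain ⟨x, hx, hqx⟩ := mem_iUnion₂.1 (hcov hq)
  refine mem_iUnion.2 ⟨t.equivFin ⟨x, hx⟩, hq, ?_⟩
  simpa using hqx

theorem KineticAssumptions.isFiniteMeasure_surfaceMeasure (hT : KineticAssumptions P Ω r s) :
    IsFiniteMeasure (surfaceMeasure (zeroSet P r)) := by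
  obtain ⟨N, K, hK, hcov⟩ := hT.exists_finite_cover
  refine ⟨?_⟩
  rw [surfaceMeasure, Measure.restrict_apply_univ, ← hcov]
  refine (measure_iUnion_le _).trans_lt ?_
  rw [tsum_fintype]
  exact ENNReal.sum_lt_top.2 fun j _ => (hK j).measure_lt_top

/-- There are infinitely many disjoint subsets of the zero set of positive measure. -/
theorem KineticAssumptions.exists_disjoint_seq (hT : KineticAssumptions P Ω r s) (hm : 1 ≤ m) :
    ∃ A : ℕ → Set (E (m + 1)), (∀ k, MeasurableSet (A k)) ∧ Pairwise (Function.onFun Disjoint A) ∧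
      ∀ k, surfaceMeasure (zeroSet P r) (A k) ≠ 0 := by
  obtain ⟨q₀, hq₀⟩ := hT.nonempty
  obtain ⟨ε, hε, -, i, hi⟩ := hT.exists_patch hq₀
  obtain ⟨U, hU, hUo, hqU⟩ := _root_.mem_nhds_iff.1 hi
  -- With at least one parameter direction the neighbourhood `U` is infinite and contains infinitely
  -- many disjoint nonempty open sets.
  have : Nonempty (Fin m) := ⟨⟨0, hm⟩⟩
  have hUinf : U.Infinite := infinite_of_mem_nhds (proj i q₀) (hUo.mem_nhds hqU)
  have : Infinite U := hUinf.to_subtype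
  obtain ⟨W, hWn, hWo, hWd⟩ : ∃ W : ℕ → Set U, (∀ k, (W k).Nonempty) ∧ (∀ k, IsOpen (W k)) ∧
      Pairwise (Function.onFun Disjoint W) := by
    obtain ⟨W, h⟩ := exists_seq_infinite_isOpen_pairwise_disjoint U
    exact ⟨W, fun k => (h.1 k).nonempty, h.2.1, h.2.2⟩
  have hWo' : ∀ k, IsOpen (Subtype.val '' W k) := fun k => hUo.isOpenMap_subtype_val _ (hWo k)
  refine ⟨fun k => proj i ⁻¹' (Subtype.val '' W k),
    fun k => ((hWo' k).preimage (proj i).continuous).measurableSet, fun k l hkl => ?_, fun k h => ?_⟩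
  · exact Disjoint.preimage _ (disjoint_image_of_injective Subtype.val_injective (hWd hkl))
  · rw [surfaceMeasure, Measure.restrict_apply
      ((hWo' k).preimage (proj i).continuous).measurableSet] at h
    have h1 := volume_le_euclideanHausdorffMeasure i _ h
    refine ((hWo' k).measure_pos volume ((hWn k).image _)).ne' (measure_mono_null ?_ h1)
    rintro _ ⟨y, hy, rfl⟩
    obtain ⟨q, hq, hqy⟩ := hU y.2
    refine ⟨q, ⟨?_, hq.1⟩, hqy⟩
    rw [mem_preimage, hqy]
    exact ⟨y, hy, rfl⟩

end Geometry

/-! ### Trial functions concentrating on the zero set -/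

section TrialFunctions

open Filter Topology Set Metric
open scoped ENNReal NNReal

/-- A profile on `[0, η]` of mass one for which `∫ t f(t)² dt` is small. -/
theorem exists_profile {η δ : ℝ} (hη : 0 < η) (hδ : 0 < δ) :
    ∃ f : ℝ → ℝ, Measurable f ∧ (∀ t, 0 ≤ f t) ∧ (∀ t, f t ≠ 0 → t ∈ Icc 0 η) ∧ Integrable f ∧
      MemLp f 2 ∧ ∫ t, f t = 1 ∧ ∫⁻ t, ENNReal.ofReal (t * f t ^ 2) ≤ ENNReal.ofReal δ := by
  -- The profile is `1/(N t)` on `[η e^{-N}, η]`: its integral is `log(e^N)/N = 1`, and `t f(t)² = δ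
  -- f(t)`. The logarithm is essential, since rescaling a fixed shape while keeping its mass leaves
  -- `∫ t f(t)² dt` unchanged.
  set N : ℝ := δ⁻¹ with hN
  have hN0 : 0 < N := inv_pos.2 hδ
  set a : ℝ := η * Real.exp (-N) with ha
  have ha0 : 0 < a := by positivity
  have haη : a ≤ η := by
    have : Real.exp (-N) ≤ 1 := Real.exp_le_one_iff.2 (by linarith)
    nlinarith
  set f : ℝ → ℝ := (Icc a η).indicator fun t => (t * N)⁻¹ with hf
  have hm : Measurable f := by
    refine Measurable.indicator (by fun_prop) measurableSet_Icc
  have h0 : ∀ t, 0 ≤ f t := fun t => indicator_nonneg (fun t ht => by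
    have : 0 < t := ha0.trans_le ht.1
    positivity) t
  have hsupp : ∀ t, f t ≠ 0 → t ∈ Icc a η := fun t ht => by
    by_contra h
    exact ht (indicator_of_notMem h _)
  have hb : ∀ t, ‖f t‖ ≤ (a * N)⁻¹ := by
    intro t
    rw [Real.norm_of_nonneg (h0 t)]
    by_cases ht : t ∈ Icc a η
    · rw [hf, indicator_of_mem ht]
      have := ht.1
      gcongr
    · rw [hf, indicator_of_notMem ht]
      positivity
  have hmem : ∀ p, MemLp f p := by
    intro p
    have h1 : MemLp ((Icc a η).indicator fun _ : ℝ => (a * N)⁻¹) p :=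
      memLp_indicator_const p measurableSet_Icc _ (Or.inr measure_Icc_lt_top.ne)
    refine h1.mono hm.aestronglyMeasurable (Eventually.of_forall fun t => ?_)
    by_cases ht : t ∈ Icc a η
    · rw [indicator_of_mem ht]
      exact (hb t).trans (le_abs_self _)
    · rw [hf, indicator_of_notMem ht, indicator_of_notMem ht]
  have hint : ∫ t, f t = 1 := by
    rw [hf, integral_indicator measurableSet_Icc, integral_Icc_eq_integral_Ioc,
      ← intervalIntegral.integral_of_le haη]
    simp only [mul_inv]
    rw [intervalIntegral.integral_mul_const, integral_inv_of_pos ha0 hη, ha,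
      show η / (η * Real.exp (-N)) = Real.exp N by rw [Real.exp_neg]; field_simp, Real.log_exp,
      mul_inv_cancel₀ hN0.ne']
  refine ⟨f, hm, h0, fun t ht => ⟨ha0.le.trans (hsupp t ht).1, (hsupp t ht).2⟩,
    memLp_one_iff_integrable.1 (hmem 1), hmem 2, hint, ?_⟩
  have e : ∀ t, t * f t ^ 2 = δ * f t := by
    intro t
    by_cases ht : t ∈ Icc a η
    · have : 0 < t := ha0.trans_le ht.1
      rw [hf, indicator_of_mem ht, hN]
      field_simp
    · rw [hf, indicator_of_notMem ht]
      simp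
  simp only [e]
  rw [← ofReal_integral_eq_lintegral_ofReal ((memLp_one_iff_integrable.1 (hmem 1)).const_mul δ)
    (Eventually.of_forall fun t => mul_nonneg hδ.le (h0 t)), integral_const_mul, hint, mul_one]

variable {m : ℕ}

theorem inner_ins (i : Fin (m + 1)) (t u : ℝ) (y : Fin m → ℝ) (x : E (m + 1)) :
    inner ℝ (ins i (t + u, y)) x = t * x i + inner ℝ (ins i (u, y)) x := by
  have h : ins i (t + u, y) = ins i (t, 0) + ins i (u, y) := by
    rw [← map_add]; simp
  rw [h, inner_add_left]
  congr 1
  rw [PiLp.inner_apply, Fin.sum_univ_succAbove _ i]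
  have : ∀ k, ins i (t, (0 : Fin m → ℝ)) (i.succAbove k) = 0 := fun k => by
    rw [← proj_apply, proj_ins]; rfl
  simp [this, mul_comm]

/-- Coordinates adapted to the graph of `φ`, in the rescaled variable `ξ = p / 2π`. -/
def graphCoord (i : Fin (m + 1)) (φ : (Fin m → ℝ) → ℝ) (ξ : E (m + 1)) : ℝ × (Fin m → ℝ) :=
  (((2 * Real.pi) • ξ) i - φ (proj i ((2 * Real.pi) • ξ)), proj i ((2 * Real.pi) • ξ))

theorem ins_graphCoord (i : Fin (m + 1)) (φ : (Fin m → ℝ) → ℝ) (ξ : E (m + 1)) :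
    ins i ((graphCoord i φ ξ).1 + φ (graphCoord i φ ξ).2, (graphCoord i φ ξ).2) =
      (2 * Real.pi) • ξ := by
  rw [graphCoord, sub_add_cancel, ins_proj]

theorem measurable_graphCoord (i : Fin (m + 1)) {φ : (Fin m → ℝ) → ℝ} (hφ : Measurable φ) :
    Measurable (graphCoord i φ) := by
  unfold graphCoord
  have h1 : Measurable fun ξ : E (m + 1) => proj i ((2 * Real.pi) • ξ) := by fun_prop
  have h2 : Measurable fun ξ : E (m + 1) => ((2 * Real.pi) • ξ) i := by fun_prop
  exact (h2.sub (hφ.comp h1)).prodMk h1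

theorem measurePreserving_coord (i : Fin (m + 1)) :
    MeasurePreserving (fun x : E (m + 1) => (x i, proj i x)) volume
      ((volume : Measure ℝ).prod (volume : Measure (Fin m → ℝ))) := by
  have h1 := PiLp.volume_preserving_ofLp (Fin (m + 1))
  have h2 := volume_preserving_piFinSuccAbove (fun _ : Fin (m + 1) => ℝ) i
  exact h2.comp h1

/-- The shear `p_i - φ` preserves Lebesgue measure for any measurable `φ`, so only the dilation by
`2π` contributes a Jacobian. -/
theorem map_graphCoord (i : Fin (m + 1)) {φ : (Fin m → ℝ) → ℝ} (hφ : Measurable φ) :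
    Measure.map (graphCoord i φ) volume = ENNReal.ofReal (((2 * Real.pi) ^ (m + 1))⁻¹) •
      ((volume : Measure ℝ).prod (volume : Measure (Fin m → ℝ))) := by
  have hshear : MeasurePreserving (fun z : ℝ × (Fin m → ℝ) => (z.1 - φ z.2, z.2))
      ((volume : Measure ℝ).prod (volume : Measure (Fin m → ℝ)))
      ((volume : Measure ℝ).prod (volume : Measure (Fin m → ℝ))) := by
    have h := MeasurePreserving.skew_product (μa := (volume : Measure (Fin m → ℝ)))
      (μc := (volume : Measure ℝ)) (μd := (volume : Measure ℝ))
      (g := fun y t => t - φ y) (MeasurePreserving.id _)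
      (by fun_prop) (Eventually.of_forall fun y => (measurePreserving_sub_right volume (φ y)).map_eq)
    exact (Measure.measurePreserving_swap.comp h).comp Measure.measurePreserving_swap
  have h := hshear.comp (measurePreserving_coord i)
  have e : graphCoord i φ = ((fun z : ℝ × (Fin m → ℝ) => (z.1 - φ z.2, z.2)) ∘
      fun x : E (m + 1) => (x i, proj i x)) ∘ fun ξ : E (m + 1) => (2 * Real.pi) • ξ := rfl
  rw [e, ← Measure.map_map h.measurable (measurable_const_smul _),
    Measure.map_addHaar_smul _ (by positivity), Measure.map_smul, h.map_eq]
  congr 2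
  rw [finrank_euclideanSpace_fin, abs_of_nonneg (by positivity)]

/-- Functions which are bounded pointwise limits of trial functions with vanishing kinetic
energy. -/
def Approximable {n : ℕ} (T : E n → ℝ) (h : E n → ℂ) : Prop :=
  ∃ (ψ : ℕ → L2 n) (C : ℝ), (∀ k, ∀ᵐ x, ‖ψ k x‖ ≤ C) ∧
    (∀ᵐ x, Tendsto (fun k => ψ k x) atTop (𝓝 (h x))) ∧
    (∀ k, MemLp (fun ξ => (√(T ((2 * Real.pi) • ξ)) : ℂ) * (𝓕 (ψ k) : L2 n) ξ) 2) ∧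
    Tendsto (fun k => eLpNorm (fun ξ => (√(T ((2 * Real.pi) • ξ)) : ℂ) * (𝓕 (ψ k) : L2 n) ξ) 2
      volume) atTop (𝓝 0)

theorem Approximable.zero {n : ℕ} (T : E n → ℝ) : Approximable T 0 := by
  have h0 : (𝓕 (0 : L2 n) : L2 n) = 0 := (Lp.fourierTransformₗᵢ (E n) ℂ).map_zero
  have hz : (fun ξ => (√(T ((2 * Real.pi) • ξ)) : ℂ) * (𝓕 (0 : L2 n) : L2 n) ξ) =ᵐ[volume]
      (0 : E n → ℂ) := by
    rw [h0]
    filter_upwards [Lp.coeFn_zero ℂ 2 (volume : Measure (E n))] with x hx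
    rw [hx]; simp
  refine ⟨fun _ => 0, 0, fun _ => ?_, ?_, fun _ => ?_, ?_⟩
  · filter_upwards [Lp.coeFn_zero ℂ 2 (volume : Measure (E n))] with x hx
    rw [hx]; simp
  · filter_upwards [Lp.coeFn_zero ℂ 2 (volume : Measure (E n))] with x hx
    rw [hx]; exact tendsto_const_nhds
  · exact (MemLp.zero (ε := ℂ)).ae_eq hz.symm
  · simp only [eLpNorm_congr_ae hz, eLpNorm_zero]
    exact tendsto_const_nhds

theorem Approximable.add {n : ℕ} {T : E n → ℝ} {h h' : E n → ℂ} (H : Approximable T h)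
    (H' : Approximable T h') : Approximable T (h + h') := by
  obtain ⟨ψ, C, h1, h2, h3, h4⟩ := H
  obtain ⟨ψ', C', h1', h2', h3', h4'⟩ := H'
  have key : ∀ k, (fun ξ => (√(T ((2 * Real.pi) • ξ)) : ℂ) * (𝓕 (ψ k + ψ' k) : L2 n) ξ) =ᵐ[volume]
      (fun ξ => (√(T ((2 * Real.pi) • ξ)) : ℂ) * (𝓕 (ψ k) : L2 n) ξ) +
        fun ξ => (√(T ((2 * Real.pi) • ξ)) : ℂ) * (𝓕 (ψ' k) : L2 n) ξ := by
    intro k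
    rw [FourierTransform.fourier_add]
    filter_upwards [Lp.coeFn_add (𝓕 (ψ k) : L2 n) (𝓕 (ψ' k))] with x hx
    rw [hx, Pi.add_apply, Pi.add_apply, mul_add]
  have hadd : ∀ᵐ x, ∀ k, (ψ k + ψ' k) x = ψ k x + ψ' k x :=
    ae_all_iff.2 fun k => Lp.coeFn_add (ψ k) (ψ' k)
  refine ⟨fun k => ψ k + ψ' k, C + C', fun k => ?_, ?_, fun k => ?_, ?_⟩
  · filter_upwards [h1 k, h1' k, hadd] with x hx hx' e
    rw [e k]
    exact (norm_add_le _ _).trans (add_le_add hx hx')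
  · filter_upwards [h2, h2', hadd] with x hx hx' e
    simp only [e]
    exact hx.add hx'
  · exact ((h3 k).add (h3' k)).ae_eq (key k).symm
  · refine tendsto_of_tendsto_of_tendsto_of_le_of_le tendsto_const_nhds
      (by simpa using h4.add h4') (fun _ => zero_le) fun k => ?_
    rw [eLpNorm_congr_ae (key k)]
    exact eLpNorm_add_le (h3 k).1 (h3' k).1 (by norm_num)

theorem Approximable.sum {n : ℕ} {T : E n → ℝ} {ι : Type*} (s : Finset ι) {h : ι → E n → ℂ}
    (H : ∀ j ∈ s, Approximable T (h j)) : Approximable T (∑ j ∈ s, h j) := by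
  classical
  induction s using Finset.induction_on with
  | empty => simpa using Approximable.zero T
  | insert a s ha ih =>
    rw [Finset.sum_insert ha]
    exact (H a (Finset.mem_insert_self _ _)).add
      (ih fun j hj => H j (Finset.mem_insert_of_mem hj))

end TrialFunctions

/-! ### Trial functions on a single patch and on the whole zero set. -/

section PatchTrial

open Filter Topology Set Metric
open scoped ENNReal NNReal

variable {m : ℕ}

/-- Integrals against the surface measure on a graph, in terms of a density on the parameter
domain. -/
theorem exists_density {K : Set (E (m + 1))} (hK : IsCompact K) (i : Fin (m + 1))
    {φ : (Fin m → ℝ) → ℝ} {Λ : ℝ≥0} (hφ : LipschitzWith Λ φ)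
    (hg : ∀ q ∈ K, q i = φ (proj i q))
    (hfin : (μHE[m] : Measure (E (m + 1))) K < ⊤) {g : E (m + 1) → ℂ} (hgm : Measurable g)
    (hgK : ∀ q, g q ≠ 0 → q ∈ K)
    (hg1 : Integrable g ((μHE[m] : Measure (E (m + 1))).restrict K))
    (hg2 : MemLp g 2 ((μHE[m] : Measure (E (m + 1))).restrict K)) :
    ∃ ρ : (Fin m → ℝ) → ℂ, Measurable ρ ∧ Integrable ρ ∧ MemLp ρ 2 ∧
      (∀ y, ρ y ≠ 0 → graphMap i φ y ∈ K) ∧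
      ∀ f : E (m + 1) → ℂ, Continuous f →
        ∫ q in K, f q * g q ∂(μHE[m] : Measure (E (m + 1))) =
          ∫ y, f (graphMap i φ y) * ρ y := by
  set μ := (μHE[m] : Measure (E (m + 1))).restrict K with hμ
  have : IsFiniteMeasure μ := ⟨by rwa [hμ, Measure.restrict_apply_univ]⟩
  set G := graphMap i φ with hG
  have hGm : Measurable G := (continuous_graphMap i hφ.continuous).measurable
  have hpm : Measurable (proj i) := (proj i).continuous.measurable
  have hGp : ∀ᵐ q ∂μ, G (proj i q) = q := by
    filter_upwards [ae_restrict_mem hK.measurableSet] with q hq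
    exact graphMap_proj (hg q hq)
  -- Pushed down to the parameters, the surface measure is at most `C` times Lebesgue measure and so
  -- has a density bounded by `C`. This replaces the area formula.
  set ν := μ.map (proj i) with hν
  have : IsFiniteMeasure ν := Measure.isFiniteMeasure_map μ _
  obtain ⟨C, hC⟩ := euclideanHausdorffMeasure_image_graphMap_le i hφ
  have hνle : ν ≤ C • (volume : Measure (Fin m → ℝ)) := by
    refine Measure.le_iff.2 fun A hA => ?_
    rw [hν, Measure.map_apply hpm hA, hμ, Measure.restrict_apply (hpm hA)]
    refine (measure_mono ?_).trans (hC A)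
    rintro q ⟨hq, hqK⟩
    exact ⟨proj i q, hq, graphMap_proj (hg q hqK)⟩
  have hac : ν ≪ (volume : Measure (Fin m → ℝ)) :=
    (Measure.absolutelyContinuous_of_le hνle).trans (Measure.smul_absolutelyContinuous)
  set w := ν.rnDeriv volume with hw
  have hwm : Measurable w := Measure.measurable_rnDeriv _ _
  have hwC : ∀ᵐ y, w y ≤ C := by
    refine ae_le_of_forall_setLIntegral_le_of_sigmaFinite hwm fun A hA _ => ?_
    refine (Measure.setLIntegral_rnDeriv_le A).trans ((hνle A).trans ?_)
    rw [setLIntegral_const]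
    rfl
  have hwt : ∀ᵐ y, w y < ⊤ := Measure.rnDeriv_lt_top _ _
  have hmapint : ∀ f : E (m + 1) → ℂ, Measurable f →
      ∫ q, f q ∂μ = ∫ y, ((w y).toReal : ℂ) * f (G y) := by
    intro f hf
    have hfG : Measurable fun y => f (G y) := hf.comp hGm
    have e1 : ∫ q, f q ∂μ = ∫ y, f (G y) ∂ν := by
      rw [hν, integral_map hpm.aemeasurable hfG.aestronglyMeasurable]
      refine integral_congr_ae ?_
      filter_upwards [hGp] with q hq
      rw [hq]
    rw [e1, ← integral_rnDeriv_smul hac]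
    refine integral_congr_ae (Eventually.of_forall fun y => ?_)
    simp only [Complex.real_smul, hw]
  have hlint : ∀ f : E (m + 1) → ℝ≥0∞, Measurable f →
      ∫⁻ q, f q ∂μ = ∫⁻ y, w y * f (G y) := by
    intro f hf
    have hfG : Measurable fun y => f (G y) := hf.comp hGm
    have e1 : ∫⁻ q, f q ∂μ = ∫⁻ y, f (G y) ∂ν := by
      rw [hν, lintegral_map hfG hpm]
      refine lintegral_congr_ae ?_
      filter_upwards [hGp] with q hq
      rw [hq]
    exact e1.trans (lintegral_rnDeriv_mul hac hfG.aemeasurable).symm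
  set ρ : (Fin m → ℝ) → ℂ := fun y => ((w y).toReal : ℂ) * g (G y) with hρ
  have hρm : Measurable ρ :=
    (Complex.measurable_ofReal.comp hwm.ennreal_toReal).mul (hgm.comp hGm)
  have hen : ∀ᵐ y, ‖ρ y‖ₑ = w y * ‖g (G y)‖ₑ := by
    filter_upwards [hwt] with y hy
    rw [hρ, enorm_mul, ← ofReal_norm, Complex.norm_real,
      Real.norm_of_nonneg ENNReal.toReal_nonneg, ENNReal.ofReal_toReal hy.ne]
  refine ⟨ρ, hρm, ⟨hρm.aestronglyMeasurable, ?_⟩, ?_, fun y hy => hgK _ ?_, fun f hf => ?_⟩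
  · rw [HasFiniteIntegral, lintegral_congr_ae hen, ← hlint (fun q => ‖g q‖ₑ) hgm.enorm]
    exact hg1.2
  · rw [memLp_two_iff_integrable_sq_norm hρm.aestronglyMeasurable]
    refine ⟨by fun_prop, ?_⟩
    -- The bound `w² ≤ C w` reduces square integrability of `ρ` to that of `g` on the surface.
    have e : ∀ᵐ y, ‖‖ρ y‖ ^ 2‖ₑ ≤ C * (w y * ‖g (G y)‖ₑ ^ 2) := by
      filter_upwards [hen, hwC] with y hy hyC
      rw [Real.enorm_eq_ofReal (sq_nonneg _), ofReal_norm_sq, hy, mul_pow, sq (w y), mul_assoc]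
      gcongr
    refine (lintegral_mono_ae e).trans_lt ?_
    rw [lintegral_const_mul' _ _ ENNReal.coe_ne_top,
      ← hlint (fun q => ‖g q‖ₑ ^ 2) (hgm.enorm.pow_const 2)]
    refine ENNReal.mul_lt_top ENNReal.coe_lt_top ?_
    have := ((memLp_two_iff_integrable_sq_norm hg2.1).1 hg2).2
    refine lt_of_le_of_lt (lintegral_mono fun q => ?_) this
    rw [Real.enorm_eq_ofReal (sq_nonneg _), ofReal_norm_sq]
  · exact right_ne_zero_of_mul hy
  · rw [hmapint (fun q => f q * g q) (hf.measurable.mul hgm)]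
    refine integral_congr_ae (Eventually.of_forall fun y => ?_)
    simp only [hρ]
    ring

/-- The trial function with Fourier transform `f(p_i - φ) ρ` in graph coordinates. -/
theorem exists_trial {T : E (m + 1) → ℝ}
    {K : Set (E (m + 1))} (i : Fin (m + 1)) {φ : (Fin m → ℝ) → ℝ} (hφ : Measurable φ) {L ε : ℝ}
    (hL : 0 ≤ L)
    (hTL : ∀ q ∈ K, ∀ t ∈ Icc 0 ε, T (ins i (q i + t, proj i q)) ≤ L * t)
    {ρ : (Fin m → ℝ) → ℂ} (hρm : Measurable ρ) (hρ1 : Integrable ρ) (hρ2 : MemLp ρ 2)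
    (hρK : ∀ y, ρ y ≠ 0 → graphMap i φ y ∈ K) {f : ℝ → ℝ} (hfm : Measurable f)
    (hfs : ∀ t, f t ≠ 0 → t ∈ Icc 0 ε) (hf1 : Integrable f) (hf2 : MemLp f 2) :
    ∃ ψ : L2 (m + 1),
      (∀ᵐ x, ψ x = (∫ t : ℝ, Complex.exp (Complex.I * ((t * x i : ℝ) : ℂ)) * (f t : ℂ)) *
        ∫ y, Complex.exp (Complex.I * (inner ℝ (graphMap i φ y) x : ℝ)) * ρ y) ∧
      ∫⁻ ξ, ‖(√(T ((2 * Real.pi) • ξ)) : ℂ) * (𝓕 ψ : L2 (m + 1)) ξ‖ₑ ^ 2 ≤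
        ENNReal.ofReal ((2 * Real.pi) ^ (m + 1) * L) *
          ((∫⁻ t, ENNReal.ofReal (t * f t ^ 2)) * ∫⁻ y, ‖ρ y‖ₑ ^ 2) := by
  set D : ℝ := (2 * Real.pi) ^ (m + 1) with hD
  have hD0 : 0 < D := by positivity
  have hΨ := measurable_graphCoord i hφ
  have hmap := map_graphCoord i hφ
  rw [← hD] at hmap
  have hGm : ∀ y, graphMap i φ y = ins i (φ y, y) := fun y => rfl
  have hGme : Measurable (graphMap i φ) := by
    have : graphMap i φ = fun y => ins i (φ y, y) := rfl
    rw [this]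
    exact (ins i).continuous.measurable.comp (hφ.prodMk measurable_id)
  set H : ℝ × (Fin m → ℝ) → ℂ := fun z => (f z.1 : ℂ) * ρ z.2 with hH
  have hHm : Measurable H := (Complex.measurable_ofReal.comp (hfm.comp measurable_fst)).mul
    (hρm.comp measurable_snd)
  have hfc1 : Integrable fun t => (f t : ℂ) := hf1.ofReal
  have hH1 : Integrable H ((volume : Measure ℝ).prod volume) := hfc1.mul_prod hρ1
  have hH2 : MemLp H 2 ((volume : Measure ℝ).prod volume) := by
    rw [memLp_two_iff_integrable_sq_norm hHm.aestronglyMeasurable]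
    have := ((memLp_two_iff_integrable_sq_norm hf2.1).1 hf2).mul_prod
      ((memLp_two_iff_integrable_sq_norm hρ2.1).1 hρ2)
    refine this.congr (Eventually.of_forall fun z => ?_)
    simp only [hH, norm_mul, mul_pow, Complex.norm_real]
  -- The factor `D` cancels the Jacobian of the dilation in the inverse transform; in the energy,
  -- which is quadratic, one factor `D` survives.
  set Θ : E (m + 1) → ℂ := fun ξ => (D : ℂ) * H (graphCoord i φ ξ) with hΘ
  have hΘm : Measurable Θ := (hHm.comp hΨ).const_mul _
  have hΘ1 : Integrable Θ := by
    refine Integrable.const_mul ?_ _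
    have : Integrable H (Measure.map (graphCoord i φ) volume) := by
      rw [hmap]
      exact hH1.smul_measure ENNReal.ofReal_ne_top
    exact (integrable_map_measure hHm.aestronglyMeasurable hΨ.aemeasurable).1 this
  have hΘ2 : MemLp Θ 2 := by
    refine MemLp.const_mul ?_ _
    have : MemLp H 2 (Measure.map (graphCoord i φ) volume) := by
      rw [hmap]
      exact hH2.smul_measure ENNReal.ofReal_ne_top
    exact (memLp_map_measure_iff hHm.aestronglyMeasurable hΨ.aemeasurable).1 this
  refine ⟨𝓕⁻ (hΘ2.toLp Θ), ?_, ?_⟩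
  · filter_upwards [coeFn_fourierInv_toLp hΘ1 hΘ2] with x hx
    rw [hx, Real.fourierInv_eq']
    set J : ℝ × (Fin m → ℝ) → ℂ := fun z =>
      (Complex.exp (Complex.I * ((z.1 * x i : ℝ) : ℂ)) * (f z.1 : ℂ)) *
        (Complex.exp (Complex.I * (inner ℝ (graphMap i φ z.2) x : ℝ)) * ρ z.2) with hJ
    have hJm : Measurable J := by
      have h1 : Measurable fun z : ℝ × (Fin m → ℝ) =>
          Complex.exp (Complex.I * ((z.1 * x i : ℝ) : ℂ)) := by fun_prop
      have h2 : Measurable fun z : ℝ × (Fin m → ℝ) => (inner ℝ (graphMap i φ z.2) x : ℝ) :=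
        (hGme.comp measurable_snd).inner_const
      have h3 : Measurable fun z : ℝ × (Fin m → ℝ) =>
          Complex.exp (Complex.I * (inner ℝ (graphMap i φ z.2) x : ℝ)) :=
        Complex.measurable_exp.comp ((Complex.measurable_ofReal.comp h2).const_mul _)
      exact (h1.mul (Complex.measurable_ofReal.comp (hfm.comp measurable_fst))).mul
        (h3.mul (hρm.comp measurable_snd))
    have e : ∀ ξ : E (m + 1), Complex.exp (((2 * Real.pi * inner ℝ ξ x : ℝ) : ℂ) * Complex.I) • Θ ξ =
        (D : ℂ) * J (graphCoord i φ ξ) := by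
      intro ξ
      have h1 : 2 * Real.pi * inner ℝ ξ x = (graphCoord i φ ξ).1 * x i +
          inner ℝ (graphMap i φ (graphCoord i φ ξ).2) x := by
        rw [graphMap, ← inner_ins, ins_graphCoord, inner_smul_left]
        rfl
      rw [h1, hΘ, hJ, hH]
      simp only [smul_eq_mul]
      rw [Complex.ofReal_add, add_mul, Complex.exp_add, mul_comm _ Complex.I, mul_comm _ Complex.I]
      ring
    simp only [e]
    rw [integral_const_mul,
      ← integral_map (f := J) hΨ.aemeasurable hJm.aestronglyMeasurable, hmap,
      integral_smul_measure, integral_prod_mul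
        (fun t : ℝ => Complex.exp (Complex.I * ((t * x i : ℝ) : ℂ)) * (f t : ℂ))
        (fun y => Complex.exp (Complex.I * (inner ℝ (graphMap i φ y) x : ℝ)) * ρ y),
      ENNReal.toReal_ofReal (by positivity), Complex.real_smul, ← mul_assoc, Complex.ofReal_inv,
      mul_inv_cancel₀ (Complex.ofReal_ne_zero.2 hD0.ne'), one_mul]
  · rw [FourierTransform.fourier_fourierInv_eq]
    set b : ℝ × (Fin m → ℝ) → ℝ≥0∞ := fun z =>
      ENNReal.ofReal (z.1 * f z.1 ^ 2) * ‖ρ z.2‖ₑ ^ 2 with hb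
    have hm1 : Measurable fun t : ℝ => ENNReal.ofReal (t * f t ^ 2) :=
      ENNReal.measurable_ofReal.comp (measurable_id.mul (hfm.pow_const 2))
    have hm2 : Measurable fun y => ‖ρ y‖ₑ ^ 2 := hρm.enorm.pow_const 2
    have hbm : Measurable b := (hm1.comp measurable_fst).mul (hm2.comp measurable_snd)
    have hle : ∀ᵐ ξ, ‖(√(T ((2 * Real.pi) • ξ)) : ℂ) * (hΘ2.toLp Θ) ξ‖ₑ ^ 2 ≤
        ENNReal.ofReal (D ^ 2 * L) * b (graphCoord i φ ξ) := by
      filter_upwards [hΘ2.coeFn_toLp] with ξ hξ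
      rw [hξ, hΘ, hb, hH]
      simp only
      set t := (graphCoord i φ ξ).1 with ht
      set y := (graphCoord i φ ξ).2 with hy
      by_cases h0 : f t = 0
      · simp [h0]
      by_cases h1 : ρ y = 0
      · simp [h1]
      have h2 := hρK y h1
      have h3 := hfs t h0
      have h4 := hTL _ h2 t h3
      have h5 : ins i (graphMap i φ y i + t, proj i (graphMap i φ y)) = (2 * Real.pi) • ξ := by
        rw [hGm, ins_apply_same, proj_ins]
        simp only
        rw [add_comm (φ y) t]
        exact ins_graphCoord i φ ξ
      rw [h5] at h4
      have h6 : (√(T ((2 * Real.pi) • ξ))) ^ 2 ≤ L * t := by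
        by_cases h : 0 ≤ T ((2 * Real.pi) • ξ)
        · rwa [Real.sq_sqrt h]
        · rw [Real.sqrt_eq_zero_of_nonpos (not_le.1 h).le]
          have := mul_nonneg hL h3.1
          simpa using this
      rw [← ofReal_norm_sq, ← ofReal_norm_sq, ← ENNReal.ofReal_mul (by have := h3.1; positivity),
        ← ENNReal.ofReal_mul' (by have := h3.1; positivity)]
      refine ENNReal.ofReal_le_ofReal ?_
      rw [norm_mul, norm_mul, norm_mul, Complex.norm_real, Complex.norm_real, Complex.norm_real,
        mul_pow, mul_pow, mul_pow, Real.norm_eq_abs, Real.norm_eq_abs, Real.norm_eq_abs, sq_abs,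
        sq_abs, sq_abs]
      calc √(T ((2 * Real.pi) • ξ)) ^ 2 * (D ^ 2 * (f t ^ 2 * ‖ρ y‖ ^ 2))
          ≤ L * t * (D ^ 2 * (f t ^ 2 * ‖ρ y‖ ^ 2)) := by gcongr
        _ = _ := by ring
    refine (lintegral_mono_ae hle).trans ?_
    rw [lintegral_const_mul' _ _ ENNReal.ofReal_ne_top, ← lintegral_map hbm hΨ, hmap,
      lintegral_smul_measure, hb, lintegral_prod_mul hm1.aemeasurable hm2.aemeasurable,
      smul_eq_mul, ← mul_assoc, mul_comm (ENNReal.ofReal (D ^ 2 * L)),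
      ← ENNReal.ofReal_mul (by positivity)]
    refine le_of_eq ?_
    congr 2
    field_simp

theorem eLpNorm_two_eq_rpow {α : Type*} [MeasurableSpace α] (μ : Measure α) (f : α → ℂ) :
    eLpNorm f 2 μ = (∫⁻ x, ‖f x‖ₑ ^ 2 ∂μ) ^ (1 / 2 : ℝ) := by
  rw [eLpNorm_eq_lintegral_rpow_enorm_toReal (by norm_num) (by norm_num)]
  simp

/-- The trial function is the extension of the patch density times the one-dimensional transform of
the profile at `x i`. For the profile with support in `[0, 1/(k+1)]` that factor differs from `1` by
at most `|x i|/(k+1)`, while the kinetic energy is at most a constant times `1/(k+1)`. -/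
theorem IsPatch.approximable {T : E (m + 1) → ℝ}
    (hTm : AEMeasurable fun ξ => T ((2 * Real.pi) • ξ)) {K : Set (E (m + 1))} (hK : IsPatch T K)
    {g : E (m + 1) → ℂ} (hg : MemLp g 2 ((μHE[m] : Measure (E (m + 1))).restrict K)) :
    Approximable T fun x => ∫ q in K, Complex.exp (Complex.I * (inner ℝ q x : ℝ)) * g q
      ∂(μHE[m] : Measure (E (m + 1))) := by
  have hfin := hK.measure_lt_top
  obtain ⟨hKc, i, φ, Λ, L, ε, hφ, hL, hε, hφK, hTL⟩ := hK
  set μ := (μHE[m] : Measure (E (m + 1))).restrict K with hμ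
  have : IsFiniteMeasure μ := ⟨by rwa [hμ, Measure.restrict_apply_univ]⟩
  set g₀ : E (m + 1) → ℂ := K.indicator (hg.1.mk g) with hg₀
  have hg₀m : Measurable g₀ := hg.1.stronglyMeasurable_mk.measurable.indicator hKc.measurableSet
  have hgg : g =ᵐ[μ] g₀ := by
    filter_upwards [hg.1.ae_eq_mk, ae_restrict_mem hKc.measurableSet] with q h1 h2
    rw [hg₀, indicator_of_mem h2, h1]
  have hg₀2 : MemLp g₀ 2 μ := (memLp_congr_ae hgg).1 hg
  obtain ⟨ρ, hρm, hρ1, hρ2, hρK, hρ⟩ := exists_density hKc i hφ hφK hfin hg₀m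
    (fun q hq => by
      by_contra h
      exact hq (indicator_of_notMem h _)) (hg₀2.integrable (by norm_num)) hg₀2
  have hη : ∀ k : ℕ, 0 < min ε (1 / ((k : ℝ) + 1)) := fun k => by positivity
  have hδ : ∀ k : ℕ, (0 : ℝ) < 1 / ((k : ℝ) + 1) := fun k => by positivity
  choose f hfm hf0 hfs hf1 hf2 hfi hfk using fun k : ℕ => exists_profile (hη k) (hδ k)
  choose ψ hψ hψk using fun k : ℕ => exists_trial (T := T) i hφ.continuous.measurable hL.le
    hTL hρm hρ1 hρ2 hρK (hfm k) (fun t ht => ⟨(hfs k t ht).1, (hfs k t ht).2.trans (min_le_left _ _)⟩)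
    (hf1 k) (hf2 k)
  have hnorm : ∀ a : ℝ, ‖Complex.exp (Complex.I * (a : ℂ))‖ = 1 := fun a => by
    rw [mul_comm, Complex.norm_exp_ofReal_mul_I]
  have hlim0 : Tendsto (fun k : ℕ => 1 / ((k : ℝ) + 1)) atTop (𝓝 0) :=
    tendsto_one_div_add_atTop_nhds_zero_nat
  have hkin : Tendsto (fun k => ∫⁻ ξ, ‖(√(T ((2 * Real.pi) • ξ)) : ℂ) *
      (𝓕 (ψ k) : L2 (m + 1)) ξ‖ₑ ^ 2) atTop (𝓝 0) := by
    have hρfin : ∫⁻ y, ‖ρ y‖ₑ ^ 2 ≠ ⊤ := by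
      have h := hρ2.2
      rw [eLpNorm_two_eq_rpow] at h
      intro h'
      rw [h'] at h
      simp at h
    have h1 : Tendsto (fun k : ℕ => ENNReal.ofReal ((2 * Real.pi) ^ (m + 1) * L) *
        (ENNReal.ofReal (1 / ((k : ℝ) + 1)) * ∫⁻ y, ‖ρ y‖ₑ ^ 2)) atTop (𝓝 0) := by
      have h2 : Tendsto (fun k : ℕ => ENNReal.ofReal (1 / ((k : ℝ) + 1))) atTop (𝓝 0) := by
        simpa using ENNReal.tendsto_ofReal hlim0
      have h3 := ENNReal.Tendsto.mul_const h2 (Or.inr hρfin)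
      have h4 := ENNReal.Tendsto.const_mul h3
        (Or.inr (ENNReal.ofReal_ne_top (r := (2 * Real.pi) ^ (m + 1) * L)))
      simpa using h4
    refine tendsto_of_tendsto_of_tendsto_of_le_of_le tendsto_const_nhds h1 (fun _ => zero_le)
      fun k => (hψk k).trans ?_
    gcongr
    exact hfk k
  refine ⟨ψ, ∫ y, ‖ρ y‖, fun k => ?_, ?_, fun k => ?_, ?_⟩
  · filter_upwards [hψ k] with x hx
    rw [hx, norm_mul, ← one_mul (∫ y, ‖ρ y‖)]
    gcongr
    · refine (norm_integral_le_integral_norm _).trans (le_of_eq ?_)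
      rw [← hfi k]
      refine integral_congr_ae (Eventually.of_forall fun t => ?_)
      simp only [norm_mul, hnorm, one_mul, Complex.norm_real, Real.norm_of_nonneg (hf0 k t)]
    · refine (norm_integral_le_integral_norm _).trans (le_of_eq ?_)
      simp only [norm_mul, hnorm, one_mul]
  · filter_upwards [ae_all_iff.2 hψ] with x hx
    simp only [hx]
    have e : ∫ q in K, Complex.exp (Complex.I * (inner ℝ q x : ℝ)) * g q
        ∂(μHE[m] : Measure (E (m + 1))) =
        1 * ∫ y, Complex.exp (Complex.I * (inner ℝ (graphMap i φ y) x : ℝ)) * ρ y := by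
      rw [one_mul, ← hρ (fun q => Complex.exp (Complex.I * (inner ℝ q x : ℝ))) (by fun_prop)]
      refine integral_congr_ae ?_
      filter_upwards [hgg] with q hq
      rw [hq]
    rw [e]
    refine Tendsto.mul_const _ ?_
    rw [tendsto_iff_norm_sub_tendsto_zero]
    have hx0 : Tendsto (fun k : ℕ => |x i| * (1 / ((k : ℝ) + 1))) atTop (𝓝 0) := by
      simpa using hlim0.const_mul |x i|
    refine squeeze_zero (fun _ => norm_nonneg _) (fun k => ?_) hx0
    have e1 : (∫ t : ℝ, Complex.exp (Complex.I * ((t * x i : ℝ) : ℂ)) * (f k t : ℂ)) - 1 =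
        ∫ t : ℝ, (Complex.exp (Complex.I * ((t * x i : ℝ) : ℂ)) - 1) * (f k t : ℂ) := by
      have h1 : Integrable fun t : ℝ => Complex.exp (Complex.I * ((t * x i : ℝ) : ℂ)) * (f k t : ℂ) :=
        (hf1 k).ofReal.bdd_mul (c := 1) (by fun_prop) (Eventually.of_forall fun t => (hnorm _).le)
      have h2 : ∫ t : ℝ, (f k t : ℂ) = 1 := by
        rw [integral_complex_ofReal, hfi k, Complex.ofReal_one]
      have h3 : Integrable fun t : ℝ => (f k t : ℂ) := (hf1 k).ofReal
      simp only [sub_mul, one_mul]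
      rw [integral_sub h1 h3, h2]
    rw [e1]
    calc _ ≤ ∫ t : ℝ, |x i| * (1 / ((k : ℝ) + 1)) * f k t := by
          refine norm_integral_le_of_norm_le ((hf1 k).const_mul _) (Eventually.of_forall fun t => ?_)
          rw [norm_mul, Complex.norm_real, Real.norm_of_nonneg (hf0 k t)]
          by_cases ht : f k t = 0
          · simp [ht]
          · have h1 := hfs k t ht
            have h2 := Real.norm_exp_I_mul_ofReal_sub_one_le (x := t * x i)
            refine mul_le_mul_of_nonneg_right (h2.trans ?_) (hf0 k t)
            rw [Real.norm_eq_abs, abs_mul, abs_of_nonneg h1.1, mul_comm]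
            gcongr
            exact h1.2.trans (min_le_right _ _)
      _ = _ := by rw [integral_const_mul, hfi k, mul_one]
  · refine ⟨?_, ?_⟩
    · exact (Complex.measurable_ofReal.comp_aemeasurable hTm.sqrt).aestronglyMeasurable.mul
        (Lp.aestronglyMeasurable _)
    · rw [eLpNorm_two_eq_rpow]
      refine ENNReal.rpow_lt_top_of_nonneg (by norm_num) (ne_top_of_le_ne_top ?_ (hψk k))
      refine ENNReal.mul_ne_top ENNReal.ofReal_ne_top (ENNReal.mul_ne_top
        (ne_top_of_le_ne_top ENNReal.ofReal_ne_top (hfk k)) ?_)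
      have h := hρ2.2
      rw [eLpNorm_two_eq_rpow] at h
      intro h'
      rw [h'] at h
      simp at h
  · simp only [eLpNorm_two_eq_rpow]
    have := (ENNReal.continuous_rpow_const (y := 1 / 2)).tendsto 0 |>.comp hkin
    simpa [Function.comp_def] using this

variable {P : E (m + 1) → ℝ} {Ω : Set (E (m + 1))} {r s : ℝ}

/-- The Fourier transform of a square integrable function on the zero set is approximable. -/
theorem KineticAssumptions.approximable (hT : KineticAssumptions P Ω r s) {g : E (m + 1) → ℂ}
    (hg : MemLp g 2 (surfaceMeasure (zeroSet P r))) :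
    Approximable (symbol P r) fun x => ∫ q, Complex.exp (Complex.I * (inner ℝ q x : ℝ)) * g q
      ∂(surfaceMeasure (zeroSet P r)) := by
  obtain ⟨N, K, hK, hcov⟩ := hT.exists_finite_cover
  have hKm : ∀ j, MeasurableSet (K j) := fun j => (hK j).1.measurableSet
  -- Making the patches disjoint writes the surface integral as a sum over `K j` of the truncations
  -- of `g` to `A j`.
  set A := disjointed K with hA
  have hAm : ∀ j, MeasurableSet (A j) := fun j =>
    disjointedRec (p := MeasurableSet) (fun _ i h => h.diff (hKm i)) (hKm j)
  have hAK : ∀ j, A j ⊆ K j := fun j => disjointed_subset K j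
  have hAS : (⋃ j, A j) = zeroSet P r := by rw [hA, iUnion_disjointed, hcov]
  have hAd : Pairwise (Function.onFun Disjoint A) := disjoint_disjointed K
  set μ : Measure (E (m + 1)) := μHE[m] with hμ
  have hS : surfaceMeasure (zeroSet P r) = μ.restrict (zeroSet P r) := rfl
  rw [hS] at hg ⊢
  have : IsFiniteMeasure (μ.restrict (zeroSet P r)) := hS ▸ hT.isFiniteMeasure_surfaceMeasure
  have hgi : ∀ j, MemLp ((A j).indicator g) 2 (μ.restrict (K j)) := fun j =>
    (hg.mono_measure (Measure.restrict_mono_set _ (hcov ▸ subset_iUnion K j))).indicator (hAm j)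
  have h1 := Approximable.sum Finset.univ fun j _ =>
    (hK j).approximable hT.aemeasurable_symbol_smul (hgi j)
  convert h1 using 1
  ext x
  rw [Finset.sum_apply]
  have hint : Integrable (fun q => Complex.exp (Complex.I * (inner ℝ q x : ℝ)) * g q)
      (μ.restrict (zeroSet P r)) := by
    refine (hg.integrable (by norm_num)).bdd_mul (c := 1) (by fun_prop)
      (Eventually.of_forall fun q => ?_)
    rw [mul_comm, Complex.norm_exp_ofReal_mul_I]
  rw [← hAS, integral_iUnion_fintype hAm hAd fun j =>
    hint.mono_measure (Measure.restrict_mono_set _ (hAS ▸ subset_iUnion A j))]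
  refine Finset.sum_congr rfl fun j _ => ?_
  have e : ∀ q, Complex.exp (Complex.I * (inner ℝ q x : ℝ)) * (A j).indicator g q =
      (A j).indicator (fun q => Complex.exp (Complex.I * (inner ℝ q x : ℝ)) * g q) q := by
    intro q
    by_cases hq : q ∈ A j <;> simp [hq]
  simp only [e]
  rw [setIntegral_indicator (hAm j), inter_eq_self_of_subset_right (hAK j)]

end PatchTrial

/-! ### Integral operators with bounded kernels -/

section BoundedKernel

open Filter Topology Set
open scoped ENNReal NNReal

/-- On a finite measure space a bounded kernel is square integrable, so the operator is
Hilbert–Schmidt, and the maximal domain in `integralOperator` is the whole space. -/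
theorem exists_clm_of_bounded_kernel {X : Type*} [MeasurableSpace X] {ν : Measure X}
    [IsFiniteMeasure ν] {k : X → X → ℂ} (hk : Measurable (Function.uncurry k)) {C : ℝ} (hC : 0 ≤ C)
    (hkC : ∀ᵐ z ∂(ν.prod ν), ‖Function.uncurry k z‖ ≤ C) :
    ∃ Λ : Lp ℂ 2 ν →L[ℂ] Lp ℂ 2 ν, IsCompactOperator Λ ∧
      (∀ u, ∀ᵐ p ∂ν, Integrable (fun q => k p q * u q) ν ∧ Λ u p = ∫ q, k p q * u q ∂ν) ∧
      ∀ (a : ℝ) u, u ∈ eigenspace (integralOperator ν k) a ↔ Λ u = (a : ℂ) • u := by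
  have hu1 : ∀ u : Lp ℂ 2 ν, Integrable u ν := fun u => (Lp.memLp u).integrable (by norm_num)
  have hsec : ∀ᵐ p ∂ν, ∀ᵐ q ∂ν, ‖k p q‖ ≤ C := Measure.ae_ae_of_ae_prod hkC
  have hint : ∀ u : Lp ℂ 2 ν, ∀ᵐ p ∂ν, Integrable (fun q => k p q * u q) ν := by
    intro u
    filter_upwards [hsec] with p hp
    exact (hu1 u).bdd_mul (c := C) (hk.comp measurable_prodMk_left).aestronglyMeasurable hp
  have hm : ∀ u : Lp ℂ 2 ν, AEStronglyMeasurable (fun p => ∫ q, k p q * u q ∂ν) ν := by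
    intro u
    refine AEStronglyMeasurable.integral_prod_right' (f := fun z : X × X => k z.1 z.2 * u z.2) ?_
    exact hk.aestronglyMeasurable.mul (Lp.aestronglyMeasurable u).comp_snd
  have hadd : ∀ u v : Lp ℂ 2 ν, (fun p => ∫ q, k p q * (u + v : Lp ℂ 2 ν) q ∂ν) =ᵐ[ν]
      fun p => (∫ q, k p q * u q ∂ν) + ∫ q, k p q * v q ∂ν := by
    intro u v
    filter_upwards [hint u, hint v] with p h1 h2
    rw [← integral_add h1 h2]
    refine integral_congr_ae ?_
    filter_upwards [Lp.coeFn_add u v] with q hq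
    rw [hq, Pi.add_apply, mul_add]
  have hsmul : ∀ (c : ℂ) (u : Lp ℂ 2 ν), (fun p => ∫ q, k p q * (c • u : Lp ℂ 2 ν) q ∂ν) =ᵐ[ν]
      fun p => c * ∫ q, k p q * u q ∂ν := by
    intro c u
    refine Eventually.of_forall fun p => ?_
    simp only
    rw [← integral_const_mul]
    refine integral_congr_ae ?_
    filter_upwards [Lp.coeFn_smul c u] with q hq
    rw [hq, Pi.smul_apply, smul_eq_mul]
    ring
  set M : ℝ := ν.real univ with hM
  have hMe : ν univ = ENNReal.ofReal M := (ofReal_measureReal).symm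
  have hbd : ∀ u : Lp ℂ 2 ν, ∫⁻ p, ‖∫ q, k p q * u q ∂ν‖ₑ ^ 2 ∂ν ≤
      ENNReal.ofReal ((C * M) ^ 2 * ‖u‖ ^ 2) := by
    intro u
    have h1 : ∫⁻ q, ‖u q‖ₑ ∂ν ≤ ENNReal.ofReal (√M * ‖u‖) := by
      refine lintegral_enorm_le_of_weight (ω := fun _ => 1) measurable_const
        (Eventually.of_forall fun _ => one_pos) (Lp.aestronglyMeasurable u) (Real.sqrt_nonneg _)
        (norm_nonneg _) ?_ ?_
      · simp only [ENNReal.ofReal_one, one_mul]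
        rw [lintegral_enorm_sq_eq, ofReal_norm_sq]
      · rw [Real.sq_sqrt measureReal_nonneg, ← hMe]
        simp
    have h2 : ∀ᵐ p ∂ν, ‖∫ q, k p q * u q ∂ν‖ₑ ^ 2 ≤ ENNReal.ofReal ((C * (√M * ‖u‖)) ^ 2) := by
      filter_upwards [hsec] with p hp
      rw [ENNReal.ofReal_pow (by positivity)]
      gcongr
      refine (enorm_integral_le_lintegral_enorm _).trans ?_
      rw [ENNReal.ofReal_mul hC]
      refine le_trans ?_ (mul_le_mul_right h1 _)
      rw [← lintegral_const_mul' _ _ ENNReal.ofReal_ne_top]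
      refine lintegral_mono_ae ?_
      filter_upwards [hp] with q hq
      rw [enorm_mul]
      gcongr
      rw [← ofReal_norm]
      exact ENNReal.ofReal_le_ofReal hq
    refine (lintegral_mono_ae h2).trans ?_
    rw [lintegral_const, hMe, ← ENNReal.ofReal_mul (by positivity)]
    refine ENNReal.ofReal_le_ofReal (le_of_eq ?_)
    rw [mul_pow, mul_pow, Real.sq_sqrt measureReal_nonneg]
    ring
  set Λ := mkLp (fun (u : Lp ℂ 2 ν) p => ∫ q, k p q * u q ∂ν) ((C * M) ^ 2) hm hadd hsmul hbd
    with hΛ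
  have hΛu : ∀ u, ∀ᵐ p ∂ν, Λ u p = ∫ q, k p q * u q ∂ν := fun u =>
    by
    exact coeFn_mkLp u
  refine ⟨Λ, isCompactOperator_of_kernel (k := Function.uncurry k) ?_ Λ hΛu,
    fun u => (hint u).and (hΛu u), fun a u => ?_⟩
  · exact MemLp.of_bound hk.aestronglyMeasurable C hkC
  · have hdom : u ∈ (integralOperator ν k).domain :=
      ⟨hint u, memLp_two_of_lintegral_le (hm u) (hbd u)⟩
    have e : integralOperator ν k ⟨u, hdom⟩ = Λ u := by
      apply Lp.ext
      refine (MemLp.coeFn_toLp hdom.2).trans ?_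
      filter_upwards [hΛu u] with p hp
      rw [hp]
    rw [← e]
    exact ⟨fun ⟨_, h⟩ => h, fun h => ⟨hdom, h⟩⟩

end BoundedKernel

/-! ### The quadratic form of the operator on the surface -/

section SurfaceForm

open Filter Topology Set
open scoped ENNReal NNReal

variable {n : ℕ}

/-- The Fourier transform `∫ e^{i q⬝x} g(q) dν(q)` of the measure `g ν`. -/
def extend (ν : Measure (E n)) (g : E n → ℂ) (x : E n) : ℂ :=
  ∫ q, Complex.exp (Complex.I * (inner ℝ q x : ℝ)) * g q ∂ν

theorem norm_exp_I_mul_ofReal' (a : ℝ) : ‖Complex.exp (Complex.I * (a : ℂ))‖ = 1 := by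
  rw [mul_comm, Complex.norm_exp_ofReal_mul_I]

theorem integrable_exp_mul {ν : Measure (E n)} {g : E n → ℂ} (hg : Integrable g ν) (x : E n) :
    Integrable (fun q => Complex.exp (Complex.I * (inner ℝ q x : ℝ)) * g q) ν :=
  hg.bdd_mul (c := 1) (by fun_prop) (Eventually.of_forall fun q => (norm_exp_I_mul_ofReal' _).le)

theorem norm_extend_le {ν : Measure (E n)} {g : E n → ℂ} (x : E n) :
    ‖extend ν g x‖ ≤ ∫ q, ‖g q‖ ∂ν := by
  refine (norm_integral_le_integral_norm _).trans (le_of_eq ?_)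
  simp only [norm_mul, norm_exp_I_mul_ofReal', one_mul]

theorem continuous_extend {ν : Measure (E n)} {g : E n → ℂ} (hg : Integrable g ν) :
    Continuous (extend ν g) := by
  refine continuous_of_dominated (fun x => (integrable_exp_mul hg x).1) (bound := fun q => ‖g q‖)
    (fun x => Eventually.of_forall fun q => ?_) hg.norm (Eventually.of_forall fun q => by fun_prop)
  rw [norm_mul, norm_exp_I_mul_ofReal', one_mul]

theorem continuous_hat {V : E n → ℝ} (hV : Integrable V) : Continuous (hat V) := by
  refine continuous_const.mul ?_
  have h : ∀ x p : E n, ‖Complex.exp (-(Complex.I * (inner ℝ x p : ℝ)))‖ = 1 := fun x p => by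
    rw [← mul_neg, ← Complex.ofReal_neg, norm_exp_I_mul_ofReal']
  refine continuous_of_dominated (bound := fun x => ‖V x‖) (fun p => ?_)
    (fun x => Eventually.of_forall fun q => ?_) hV.norm (Eventually.of_forall fun q => by fun_prop)
  · exact ((hV.ofReal (𝕜 := ℂ)).bdd_mul (c := 1) (by fun_prop)
      (Eventually.of_forall fun q => (h _ _).le)).1
  · rw [norm_mul, h, one_mul, Complex.norm_real]

theorem norm_hat_le (V : E n → ℝ) (p : E n) :
    ‖hat V p‖ ≤ (2 * Real.pi) ^ (-(n : ℝ) / 2) * ∫ x, ‖V x‖ := by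
  rw [hat, norm_mul, Complex.norm_real, Real.norm_of_nonneg (by positivity)]
  gcongr
  refine (norm_integral_le_integral_norm _).trans (le_of_eq ?_)
  refine integral_congr_ae (Eventually.of_forall fun x => ?_)
  simp only
  rw [norm_mul, ← mul_neg, ← Complex.ofReal_neg, norm_exp_I_mul_ofReal', one_mul, Complex.norm_real]

/-- The potential energy form of Fourier transforms of measures, in terms of the Fourier transform
of the potential. -/
theorem integral_potential_extend {ν : Measure (E n)} [IsFiniteMeasure ν] {V : E n → ℝ}
    (hV : Integrable V) {g h : E n → ℂ} (hg : Integrable g ν) (hh : Integrable h ν) :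
    ∫ x, (V x : ℂ) * (conj (extend ν g x) * extend ν h x) =
      (((2 * Real.pi) ^ ((n : ℝ) / 2) : ℝ) : ℂ) *
        ∫ z, hat V (z.1 - z.2) * (conj (g z.1) * h z.2) ∂(ν.prod ν) := by
  have hgc : Integrable (fun p => conj (g p)) ν :=
    (LinearIsometryEquiv.integrable_comp_iff (Complex.conjLIE)).2 hg
  have hprod : Integrable (fun z : E n × E n => conj (g z.1) * h z.2) (ν.prod ν) := hgc.mul_prod hh
  have h1 : ∀ x, (V x : ℂ) * (conj (extend ν g x) * extend ν h x) =
      ∫ z, Complex.exp (-(Complex.I * (inner ℝ x (z.1 - z.2) : ℝ))) * (V x : ℂ) *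
        (conj (g z.1) * h z.2) ∂(ν.prod ν) := by
    intro x
    have e1 : conj (extend ν g x) =
        ∫ p, Complex.exp (-(Complex.I * (inner ℝ p x : ℝ))) * conj (g p) ∂ν := by
      rw [extend, ← integral_conj]
      refine integral_congr_ae (Eventually.of_forall fun p => ?_)
      simp only [map_mul, ← Complex.exp_conj, Complex.conj_I, Complex.conj_ofReal, neg_mul]
    rw [e1, extend, ← integral_prod_mul, ← integral_const_mul]
    refine integral_congr_ae (Eventually.of_forall fun z => ?_)
    simp only
    rw [inner_sub_right, Complex.ofReal_sub, real_inner_comm z.1 x, real_inner_comm z.2 x, mul_sub,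
      neg_sub, sub_eq_add_neg, Complex.exp_add]
    ring
  simp only [h1]
  rw [integral_integral_swap]
  · rw [← integral_const_mul]
    refine integral_congr_ae (Eventually.of_forall fun z => ?_)
    simp only
    rw [integral_mul_const, hat]
    generalize (∫ x : E n, Complex.exp (-(Complex.I * (inner ℝ x (z.1 - z.2) : ℝ))) * (V x : ℂ)) = J
    have hc : (((2 * Real.pi) ^ ((n : ℝ) / 2) : ℝ) : ℂ) *
        (((2 * Real.pi) ^ (-(n : ℝ) / 2) : ℝ) : ℂ) = 1 := by
      rw [← Complex.ofReal_mul, ← Real.rpow_add (by positivity), neg_div, add_neg_cancel,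
        Real.rpow_zero, Complex.ofReal_one]
    linear_combination (-(J * (conj (g z.1) * h z.2))) * hc
  · have h2 : Integrable (fun w : E n × (E n × E n) => (V w.1 : ℂ) * (conj (g w.2.1) * h w.2.2))
        (volume.prod (ν.prod ν)) := (hV.ofReal (𝕜 := ℂ)).mul_prod hprod
    have h3 := h2.bdd_mul (c := 1)
      (f := fun w => Complex.exp (-(Complex.I * (inner ℝ w.1 (w.2.1 - w.2.2) : ℝ))))
      (by fun_prop) (Eventually.of_forall fun w => by
        rw [← mul_neg, ← Complex.ofReal_neg, norm_exp_I_mul_ofReal'])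
    refine h3.congr (Eventually.of_forall fun w => ?_)
    simp only [Function.uncurry]
    ring

variable {m : ℕ} {P : E (m + 1) → ℝ} {Ω : Set (E (m + 1))} {r s : ℝ}

/-- The weight `|∇P|^{-1/2}`. -/
def gradWeight (P : E n → ℝ) (q : E n) : ℝ := (√‖gradient P q‖)⁻¹

theorem norm_gradient_eq (P : E n → ℝ) (q : E n) : ‖gradient P q‖ = ‖fderiv ℝ P q‖ := by
  rw [gradient, LinearIsometryEquiv.norm_map]

theorem measurable_gradWeight (P : E n → ℝ) : Measurable (gradWeight P) := by
  have h : gradWeight P = fun q => (√‖fderiv ℝ P q‖)⁻¹ := by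
    ext q
    rw [gradWeight, norm_gradient_eq]
  rw [h]
  exact (measurable_fderiv ℝ P).norm.sqrt.inv

theorem KineticAssumptions.gradWeight_pos (hT : KineticAssumptions P Ω r s) {q : E (m + 1)}
    (hq : q ∈ zeroSet P r) : 0 < gradWeight P q :=
  inv_pos.2 (Real.sqrt_pos.2 (norm_pos_iff.2 (hT.gradient_ne_zero q (hT.zeroSet_subset_interior hq))))

theorem KineticAssumptions.exists_gradWeight_le (hT : KineticAssumptions P Ω r s) :
    ∃ B, ∀ q ∈ zeroSet P r, gradWeight P q ≤ B := by
  have hc : ContinuousOn (gradWeight P) (zeroSet P r) := by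
    intro q hq
    have h1 : ContinuousAt (fderiv ℝ P) q :=
      ((hT.contDiffAt hq).fderiv_right (m := 1) (by norm_num)).continuousAt
    have h2 : ContinuousAt (gradWeight P) q := by
      have h : gradWeight P = fun q => (√‖fderiv ℝ P q‖)⁻¹ := by
        ext q
        rw [gradWeight, norm_gradient_eq]
      have h3 := hT.gradWeight_pos hq
      rw [h] at h3 ⊢
      exact (Real.continuous_sqrt.continuousAt.comp h1.norm).inv₀ (fun h0 => by
        simp at h0 h3
        exact h3 h0)
    exact h2.continuousWithinAt
  obtain ⟨B, hB⟩ := (hT.isCompact_zeroSet.image_of_continuousOn hc).bddAbove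
  exact ⟨B, fun q hq => hB ⟨q, hq, rfl⟩⟩

theorem KineticAssumptions.memLp_gradWeight_mul (hT : KineticAssumptions P Ω r s)
    {f : E (m + 1) → ℂ} (hf : MemLp f 2 (surfaceMeasure (zeroSet P r))) :
    MemLp (fun q => (gradWeight P q : ℂ) * f q) 2 (surfaceMeasure (zeroSet P r)) := by
  obtain ⟨B, hB⟩ := hT.exists_gradWeight_le
  refine MemLp.of_le_mul (c := B) hf ((Complex.measurable_ofReal.comp
    (measurable_gradWeight P)).aestronglyMeasurable.mul hf.1) ?_
  filter_upwards [ae_restrict_mem hT.isCompact_zeroSet.measurableSet] with q hq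
  rw [norm_mul, Complex.norm_real, Real.norm_of_nonneg (hT.gradWeight_pos hq).le]
  gcongr
  exact hB q hq

/-- The Fourier transform of `u / |∇P|^{1/2}` on the zero set. -/
def surfaceExtend (P : E n → ℝ) (r : ℝ) (u : E n → ℂ) : E n → ℂ :=
  extend (surfaceMeasure (zeroSet P r)) fun q => (gradWeight P q : ℂ) * u q

/-- The kernel is bounded, as `hat V` is bounded for integrable `V` and the weight is bounded on the
compact zero set. One half of the power of `2π` comes from the normalization of `hat`, the other
from the prefactor of the kernel. -/
theorem KineticAssumptions.exists_surface_clm (hT : KineticAssumptions P Ω r s)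
    {V : E (m + 1) → ℝ} (hV : Integrable V) :
    ∃ Λ : Lp ℂ 2 (surfaceMeasure (zeroSet P r)) →L[ℂ] Lp ℂ 2 (surfaceMeasure (zeroSet P r)),
      IsCompactOperator Λ ∧
      (∀ (a : ℝ) u, u ∈ eigenspace (surfaceOperator P r V) a ↔ Λ u = (a : ℂ) • u) ∧
      ∀ u v : Lp ℂ 2 (surfaceMeasure (zeroSet P r)),
        ∫ x, (V x : ℂ) * (conj (surfaceExtend P r u x) * surfaceExtend P r v x) =
        (((2 * Real.pi) ^ (m + 1) : ℝ) : ℂ) * inner ℂ u (Λ v) := by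
  have := hT.isFiniteMeasure_surfaceMeasure
  set ν := surfaceMeasure (zeroSet P r) with hν
  have hmem : ∀ᵐ q ∂ν, q ∈ zeroSet P r := ae_restrict_mem hT.isCompact_zeroSet.measurableSet
  set b := gradWeight P with hb
  have hbm : Measurable b := measurable_gradWeight P
  set d : ℝ := (2 * Real.pi) ^ (((m + 1 : ℕ) : ℝ) / 2) with hd
  have hd0 : 0 < d := by positivity
  obtain ⟨B, hB⟩ := hT.exists_gradWeight_le
  have hbB : ∀ᵐ q ∂ν, ‖(b q : ℂ)‖ ≤ max B 0 := by
    filter_upwards [hmem] with q hq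
    rw [Complex.norm_real, Real.norm_of_nonneg (hT.gradWeight_pos hq).le]
    exact (hB q hq).trans (le_max_left _ _)
  set k : E (m + 1) → E (m + 1) → ℂ := fun p q =>
    ((√‖gradient P p‖ * (2 * Real.pi) ^ (((m + 1 : ℕ) : ℝ) / 2))⁻¹ : ℝ) * hat V (p - q) *
      ((√‖gradient P q‖)⁻¹ : ℝ) with hk
  have hkb : ∀ p q, k p q = ((d⁻¹ : ℝ) : ℂ) * (b p : ℂ) * hat V (p - q) * (b q : ℂ) := by
    intro p q
    simp only [hk, hb, gradWeight]
    rw [mul_inv, mul_comm (√‖gradient P p‖)⁻¹, Complex.ofReal_mul]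
  have hhm : Measurable fun z : E (m + 1) × E (m + 1) => hat V (z.1 - z.2) :=
    ((continuous_hat hV).comp (continuous_fst.sub continuous_snd)).measurable
  have hkm : Measurable (Function.uncurry k) := by
    have e : Function.uncurry k = fun z =>
        ((d⁻¹ : ℝ) : ℂ) * (b z.1 : ℂ) * hat V (z.1 - z.2) * (b z.2 : ℂ) := by
      ext z
      exact hkb z.1 z.2
    rw [e]
    exact (((Complex.measurable_ofReal.comp (hbm.comp measurable_fst)).const_mul _).mul hhm).mul
      (Complex.measurable_ofReal.comp (hbm.comp measurable_snd))
  set Cv : ℝ := (2 * Real.pi) ^ (-((m + 1 : ℕ) : ℝ) / 2) * ∫ x, ‖V x‖ with hCv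
  have hCv0 : 0 ≤ Cv := by positivity
  obtain ⟨Λ, hΛc, hΛ, hΛe⟩ := exists_clm_of_bounded_kernel (ν := ν) (k := k) hkm
    (C := d⁻¹ * max B 0 * Cv * max B 0) (by positivity) (by
      filter_upwards [Measure.quasiMeasurePreserving_fst.ae hbB,
        Measure.quasiMeasurePreserving_snd.ae hbB] with z h1 h2
      rw [Function.uncurry, hkb, norm_mul, norm_mul, norm_mul, Complex.norm_real,
        Real.norm_of_nonneg (inv_nonneg.2 hd0.le)]
      gcongr
      exact norm_hat_le V _)
  refine ⟨Λ, hΛc, hΛe, fun u v => ?_⟩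
  have hg : ∀ f : Lp ℂ 2 ν, Integrable (fun q => (b q : ℂ) * f q) ν := fun f =>
    (hT.memLp_gradWeight_mul (Lp.memLp f)).integrable (by norm_num)
  have hd2 : (2 * Real.pi) ^ (m + 1) = d * d := by
    rw [hd, ← Real.rpow_add (by positivity), add_halves, Real.rpow_natCast]
  change ∫ x, (V x : ℂ) * (conj (extend ν (fun q => (b q : ℂ) * u q) x) *
    extend ν (fun q => (b q : ℂ) * v q) x) = _
  rw [integral_potential_extend hV (hg u) (hg v), ← hd, hd2, Complex.ofReal_mul, mul_assoc]
  congr 1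
  have hint : Integrable (fun z : E (m + 1) × E (m + 1) => hat V (z.1 - z.2) *
      (conj ((b z.1 : ℂ) * u z.1) * ((b z.2 : ℂ) * v z.2))) (ν.prod ν) := by
    have hgc : Integrable (fun p => conj ((b p : ℂ) * u p)) ν :=
      (LinearIsometryEquiv.integrable_comp_iff (Complex.conjLIE)).2 (hg u)
    exact (hgc.mul_prod (hg v)).bdd_mul (c := Cv) hhm.aestronglyMeasurable
      (Eventually.of_forall fun z => norm_hat_le V _)
  rw [integral_prod _ hint, integral_conj_mul_eq_inner, ← integral_const_mul]
  refine integral_congr_ae ?_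
  filter_upwards [hΛ v] with p hp
  rw [hp.2, ← mul_assoc, ← integral_const_mul]
  refine integral_congr_ae (Eventually.of_forall fun q => ?_)
  simp only [hkb, map_mul, Complex.conj_ofReal]
  have : (d : ℂ) * ((d⁻¹ : ℝ) : ℂ) = 1 := by
    rw [← Complex.ofReal_mul, mul_inv_cancel₀ hd0.ne', Complex.ofReal_one]
  linear_combination (-(hat V (p - q) * (b p : ℂ) * conj (u p) * (b q : ℂ) * v q)) * this

end SurfaceForm

/-! ### Unique continuation for Fourier transforms of compactly supported measures -/

section Uniqueness

open Filter Topology Set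
open scoped ENNReal NNReal

variable {n : ℕ} {ν : Measure (E n)}

/-- The positive and negative parts of `h` are densities of two finite measures with the same
characteristic function, so these measures coincide. -/
theorem ae_eq_zero_of_extend_ofReal [IsFiniteMeasure ν] {h : E n → ℝ} (hh : Integrable h ν)
    (h0 : ∀ x, extend ν (fun q => (h q : ℂ)) x = 0) : h =ᵐ[ν] 0 := by
  set p : E n → ℝ := fun q => max (h q) 0 with hp
  set m : E n → ℝ := fun q => max (-h q) 0 with hm
  have hpi : Integrable p ν := hh.pos_part
  have hmi : Integrable m ν := hh.neg_part
  have key : ∀ f : E n → ℝ, Integrable f ν → (∀ q, 0 ≤ f q) → ∀ t,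
      charFun (ν.withDensity fun q => ENNReal.ofReal (f q)) t = extend ν (fun q => (f q : ℂ)) t := by
    intro f hf hf0 t
    rw [charFun_apply, integral_withDensity_eq_integral_toReal_smul₀
      (hf.1.aemeasurable.ennreal_ofReal) (Eventually.of_forall fun q => ENNReal.ofReal_lt_top)]
    refine integral_congr_ae (Eventually.of_forall fun q => ?_)
    simp only [ENNReal.toReal_ofReal (hf0 q), Complex.real_smul]
    rw [mul_comm, mul_comm Complex.I]
  have hfin : ∀ f : E n → ℝ, Integrable f ν →
      IsFiniteMeasure (ν.withDensity fun q => ENNReal.ofReal (f q)) := fun f hf =>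
    isFiniteMeasure_withDensity_ofReal hf.2
  have := hfin p hpi
  have := hfin m hmi
  have e : (ν.withDensity fun q => ENNReal.ofReal (p q)) =
      ν.withDensity fun q => ENNReal.ofReal (m q) := by
    refine Measure.ext_of_charFun (funext fun t => ?_)
    rw [key p hpi (fun q => le_max_right _ _), key m hmi (fun q => le_max_right _ _), ← sub_eq_zero,
      ← h0 t]
    have hpc : Integrable (fun q => (p q : ℂ)) ν := hpi.ofReal
    have hmc : Integrable (fun q => (m q : ℂ)) ν := hmi.ofReal
    rw [extend, extend, extend, ← integral_sub (integrable_exp_mul hpc t) (integrable_exp_mul hmc t)]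
    refine integral_congr_ae (Eventually.of_forall fun q => ?_)
    have : h q = p q - m q := by
      simp only [hp, hm]
      rcases le_total 0 (h q) with h1 | h1
      · rw [max_eq_left h1, max_eq_right (by linarith), sub_zero]
      · rw [max_eq_right h1, max_eq_left (by linarith)]; ring
    simp only [this, Complex.ofReal_sub]
    ring
  rw [withDensity_eq_iff hpi.1.aemeasurable.ennreal_ofReal hmi.1.aemeasurable.ennreal_ofReal
    hpi.lintegral_lt_top.ne] at e
  filter_upwards [e] with q hq
  rw [ENNReal.ofReal_eq_ofReal_iff (le_max_right _ _) (le_max_right _ _)] at hq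
  change max (h q) 0 = max (-h q) 0 at hq
  rcases le_total 0 (h q) with h1 | h1
  · rwa [max_eq_left h1, max_eq_right (by linarith)] at hq
  · rw [max_eq_right h1, max_eq_left (by linarith)] at hq
    simpa using hq.symm

/-- The transform of `conj g` at `x` is the conjugate of that of `g` at `-x`, so the real and
imaginary parts of `g` have vanishing transforms as well. -/
theorem ae_eq_zero_of_extend [IsFiniteMeasure ν] {g : E n → ℂ} (hg : Integrable g ν)
    (h0 : ∀ x, extend ν g x = 0) : g =ᵐ[ν] 0 := by
  have hgc : Integrable (fun q => conj (g q)) ν :=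
    (LinearIsometryEquiv.integrable_comp_iff (Complex.conjLIE)).2 hg
  have h1 : ∀ x, extend ν (fun q => conj (g q)) x = 0 := by
    intro x
    rw [← map_zero (starRingEnd ℂ), ← h0 (-x), extend, extend, ← integral_conj]
    refine integral_congr_ae (Eventually.of_forall fun q => ?_)
    have e : conj (Complex.I * ((inner ℝ q (-x) : ℝ) : ℂ)) = Complex.I * (inner ℝ q x : ℝ) := by
      rw [map_mul, Complex.conj_I, Complex.conj_ofReal, inner_neg_right, Complex.ofReal_neg, neg_mul_neg]
    simp only [map_mul (starRingEnd ℂ) (Complex.exp _), ← Complex.exp_conj, e]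
  have hre := ae_eq_zero_of_extend_ofReal (h := fun q => (g q).re) hg.re fun x => by
    have e : extend ν (fun q => ((g q).re : ℂ)) x =
        (1 / 2 : ℂ) * (extend ν g x + extend ν (fun q => conj (g q)) x) := by
      rw [extend, extend, extend, ← integral_add (integrable_exp_mul hg x) (integrable_exp_mul hgc x),
        ← integral_const_mul]
      refine integral_congr_ae (Eventually.of_forall fun q => ?_)
      simp only [Complex.re_eq_add_conj]
      ring
    rw [e, h0, h1]; simp
  have him := ae_eq_zero_of_extend_ofReal (h := fun q => (g q).im) hg.im fun x => by
    have e : extend ν (fun q => ((g q).im : ℂ)) x =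
        (1 / (2 * Complex.I) : ℂ) * (extend ν g x - extend ν (fun q => conj (g q)) x) := by
      rw [extend, extend, extend, ← integral_sub (integrable_exp_mul hg x) (integrable_exp_mul hgc x),
        ← integral_const_mul]
      refine integral_congr_ae (Eventually.of_forall fun q => ?_)
      simp only [Complex.im_eq_sub_conj]
      ring
    rw [e, h0, h1]; simp
  filter_upwards [hre, him] with q h2 h3
  exact Complex.ext h2 h3

/-- On every line the Fourier transform of a compactly supported measure extends to an entire
function. -/
theorem differentiable_extend_line {R : ℝ} (hR : ∀ᵐ q ∂ν, ‖q‖ ≤ R) {g : E n → ℂ}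
    (hg : Integrable g ν) (x y : E n) :
    Differentiable ℂ fun z : ℂ => ∫ q, Complex.exp (Complex.I * ((inner ℝ q x : ℝ) +
      z * (inner ℝ q y : ℝ))) * g q ∂ν := by
  intro z₀
  set M : ℝ := max R 0 * ‖y‖ with hM
  have hMq : ∀ᵐ q ∂ν, |(inner ℝ q y : ℝ)| ≤ M := by
    filter_upwards [hR] with q hq
    refine (abs_real_inner_le_norm q y).trans ?_
    rw [hM]
    gcongr
    exact hq.trans (le_max_left _ _)
  have hM0 : 0 ≤ M := by positivity
  have hexp : ∀ᵐ q ∂ν, ∀ z ∈ Metric.ball z₀ 1, ‖Complex.exp (Complex.I * ((inner ℝ q x : ℝ) +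
      z * (inner ℝ q y : ℝ)))‖ ≤ Real.exp ((‖z₀‖ + 1) * M) := by
    filter_upwards [hMq] with q hq z hz
    rw [Complex.norm_exp]
    refine Real.exp_le_exp.2 ?_
    have e : (Complex.I * ((inner ℝ q x : ℝ) + z * (inner ℝ q y : ℝ))).re =
        -z.im * (inner ℝ q y : ℝ) := by simp
    rw [e]
    refine (le_abs_self _).trans ?_
    rw [abs_mul, abs_neg]
    have hz' : ‖z‖ ≤ ‖z₀‖ + 1 := by
      rw [Metric.mem_ball, dist_eq_norm] at hz
      have := norm_add_le z₀ (z - z₀)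
      rw [add_sub_cancel] at this
      linarith
    have := (Complex.abs_im_le_norm z).trans hz'
    gcongr
  have hm : ∀ z : ℂ, AEStronglyMeasurable (fun q => Complex.exp (Complex.I * ((inner ℝ q x : ℝ) +
      z * (inner ℝ q y : ℝ))) * g q) ν := fun z =>
    AEStronglyMeasurable.mul (by fun_prop) hg.1
  have h := hasDerivAt_integral_of_dominated_loc_of_deriv_le (μ := ν) (𝕜 := ℂ) (x₀ := z₀)
    (s := Metric.ball z₀ 1) (F := fun z q => Complex.exp (Complex.I * ((inner ℝ q x : ℝ) +
      z * (inner ℝ q y : ℝ))) * g q)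
    (F' := fun z q => Complex.exp (Complex.I * ((inner ℝ q x : ℝ) +
      z * (inner ℝ q y : ℝ))) * (Complex.I * (1 * (inner ℝ q y : ℝ))) * g q)
    (bound := fun q => Real.exp ((‖z₀‖ + 1) * M) * M * ‖g q‖)
    (Metric.ball_mem_nhds z₀ one_pos) (Eventually.of_forall hm) ?_ ?_ ?_ (hg.norm.const_mul _) ?_
  · exact h.2.differentiableAt
  · refine hg.bdd_mul (c := Real.exp ((‖z₀‖ + 1) * M)) (by fun_prop) ?_
    filter_upwards [hexp] with q hq
    exact hq z₀ (Metric.mem_ball_self one_pos)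
  · exact AEStronglyMeasurable.mul (by fun_prop) hg.1
  · filter_upwards [hexp, hMq] with q h1 h2 z hz
    rw [norm_mul, norm_mul, norm_mul, Complex.norm_I, one_mul, one_mul, Complex.norm_real,
      Real.norm_eq_abs]
    have := h1 z hz
    gcongr
  · refine Eventually.of_forall fun q z _ => ?_
    exact (((((hasDerivAt_id z).mul_const _).const_add _).const_mul _).cexp).mul_const _

/-- If the transform is nonzero at `x`, then on each line through `x` it is the restriction of an
entire function that is nonzero at `t = 0`, so it has finitely many zeros with `t` in the bounded
interval `(1, 2)`. By Fubini some dilate of the translated zero set is null, hence so is the zero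
set itself. -/
theorem extend_eq_zero_of_measure_ne_zero [IsFiniteMeasure ν] {R : ℝ} (hR : ∀ᵐ q ∂ν, ‖q‖ ≤ R)
    {g : E n → ℂ} (hg : Integrable g ν) (h0 : volume {x | extend ν g x = 0} ≠ 0) (x : E n) :
    extend ν g x = 0 := by
  by_contra hx
  refine h0 ?_
  set Z : Set (E n) := {v | extend ν g (x + v) = 0} with hZ
  have hZc : IsClosed Z :=
    isClosed_singleton.preimage ((continuous_extend hg).comp (continuous_const.add continuous_id))
  have hZ0 : volume {y | extend ν g y = 0} = volume Z :=
    (measure_preimage_add volume x {y | extend ν g y = 0}).symm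
  rw [hZ0]
  have hline : ∀ v : E n, volume {t : ℝ | t ∈ Ioo (1 : ℝ) 2 ∧ t • v ∈ Z} = 0 := by
    intro v
    refine Set.Finite.measure_zero ?_ _
    by_contra hinf
    set F : ℂ → ℂ := fun z : ℂ => ∫ q, Complex.exp (Complex.I * ((inner ℝ q x : ℝ) +
      z * (inner ℝ q v : ℝ))) * g q ∂ν with hF
    have hFd : Differentiable ℂ F := differentiable_extend_line hR hg x v
    have hFt : ∀ t : ℝ, F t = extend ν g (x + t • v) := by
      intro t
      rw [hF, extend]
      refine integral_congr_ae (Eventually.of_forall fun q => ?_)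
      simp only [inner_add_right, inner_smul_right, Complex.ofReal_add, Complex.ofReal_mul]
    have hinf' : ((fun t : ℝ => (t : ℂ)) '' {t : ℝ | t ∈ Ioo (1 : ℝ) 2 ∧ t • v ∈ Z}).Infinite :=
      Set.Infinite.image Complex.ofReal_injective.injOn hinf
    obtain ⟨z, -, hz⟩ := hinf'.exists_accPt_of_subset_isCompact
      (isCompact_Icc.image Complex.continuous_ofReal)
      (image_mono fun t ht => Ioo_subset_Icc_self ht.1)
    rw [accPt_iff_frequently_nhdsNE] at hz
    have hzero := (hFd.differentiableOn.analyticOnNhd isOpen_univ).eqOn_zero_of_preconnected_of_frequently_eq_zero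
      isPreconnected_univ (mem_univ z) (hz.mono (by
        rintro _ ⟨t, ht, rfl⟩
        rw [hFt]
        exact ht.2))
    have := hzero (mem_univ ((0 : ℝ) : ℂ))
    rw [hFt, zero_smul, add_zero] at this
    exact hx this
  have hW : MeasurableSet {w : ℝ × E n | w.1 • w.2 ∈ Z} :=
    (hZc.preimage (by fun_prop : Continuous fun w : ℝ × E n => w.1 • w.2)).measurableSet
  have hprod : ((volume.restrict (Ioo (1 : ℝ) 2)).prod (volume : Measure (E n)))
      {w : ℝ × E n | w.1 • w.2 ∈ Z} = 0 := by
    rw [Measure.prod_apply_symm hW]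
    refine (lintegral_congr fun v => ?_).trans lintegral_zero
    rw [Measure.restrict_apply (measurable_prodMk_right hW), ← hline v]
    congr 1
    ext t
    exact and_comm
  rw [Measure.measure_prod_null hW] at hprod
  have : (volume.restrict (Ioo (1 : ℝ) 2)) ≠ 0 := by
    rw [Ne, Measure.restrict_eq_zero]
    simp
  have : NeBot (ae (volume.restrict (Ioo (1 : ℝ) 2))) := ae_neBot.2 this
  obtain ⟨t, ht, ht'⟩ := (hprod.and (ae_restrict_mem measurableSet_Ioo)).exists
  have ht0 : t ≠ 0 := by linarith [ht'.1]
  have e : (Prod.mk t ⁻¹' {w : ℝ × E n | w.1 • w.2 ∈ Z}) = (fun v : E n => t • v) ⁻¹' Z := rfl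
  simp only at ht
  rw [e, Measure.addHaar_preimage_smul _ ht0, Pi.zero_apply, mul_eq_zero] at ht
  refine ht.resolve_left ?_
  rw [ENNReal.ofReal_eq_zero, not_le]
  positivity

end Uniqueness

/-! ### Negative compact operators -/

section NegativeCompact

variable {H : Type*} [NormedAddCommGroup H] [InnerProductSpace ℂ H] [CompleteSpace H]

/-- Strict negativity makes every eigenvalue negative, in particular nonzero, so each eigenspace is
finite-dimensional. The eigenspaces of a compact symmetric operator have dense sum; finitely many of
them would make `H` finite-dimensional. -/
theorem infinite_setOf_neg_eigenvalue {Λ : H →L[ℂ] H} (hc : IsCompactOperator Λ)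
    (hs : (Λ : H →ₗ[ℂ] H).IsSymmetric) (hneg : ∀ u, u ≠ 0 → (inner ℂ u (Λ u)).re < 0)
    (hH : ¬ FiniteDimensional ℂ H) :
    {a : ℝ | a < 0 ∧ ∃ u, u ≠ 0 ∧ Λ u = (a : ℂ) • u}.Infinite := by
  intro hfin
  refine hH ?_
  set W : Submodule ℂ H := ⨆ a : hfin.toFinset, Module.End.eigenspace (Λ : H →ₗ[ℂ] H) ((a : ℝ) : ℂ)
    with hW
  have hle : (⨆ μ : ℂ, Module.End.eigenspace (Λ : H →ₗ[ℂ] H) μ) ≤ W := by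
    refine iSup_le fun μ => ?_
    by_cases hμ : Module.End.eigenspace (Λ : H →ₗ[ℂ] H) μ = ⊥
    · rw [hμ]; exact bot_le
    · obtain ⟨u, hu, hu0⟩ := Submodule.exists_mem_ne_zero_of_ne_bot hμ
      have hu' : Λ u = μ • u := Module.End.mem_eigenspace_iff.1 hu
      have hμr : conj μ = μ := hs.conj_eigenvalue_eq_self hμ
      have hμe : ((μ.re : ℝ) : ℂ) = μ := Complex.conj_eq_iff_re.1 hμr
      have h1 := hneg u hu0
      rw [hu', inner_smul_right, inner_self_eq_norm_sq_to_K, ← hμe] at h1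
      have h2 : μ.re < 0 := by
        have h3 : ((μ.re : ℂ) * ((‖u‖ : ℝ) : ℂ) ^ 2).re = μ.re * ‖u‖ ^ 2 := by
          rw [← Complex.ofReal_pow, ← Complex.ofReal_mul, Complex.ofReal_re]
        have h4 : μ.re * ‖u‖ ^ 2 < 0 := h3 ▸ h1
        have := norm_pos_iff.2 hu0
        by_contra h5
        exact absurd h4 (not_lt.2 (mul_nonneg (not_lt.1 h5) (sq_nonneg _)))
      have hmem : μ.re ∈ hfin.toFinset := by
        rw [Set.Finite.mem_toFinset]
        exact ⟨h2, u, hu0, by rw [hμe]; exact hu'⟩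
      have := le_iSup (fun a : hfin.toFinset =>
        Module.End.eigenspace (Λ : H →ₗ[ℂ] H) ((a : ℝ) : ℂ)) ⟨μ.re, hmem⟩
      simpa only [hμe] using this
  have hfd : ∀ a : hfin.toFinset, FiniteDimensional ℂ
      (Module.End.eigenspace (Λ : H →ₗ[ℂ] H) ((a : ℝ) : ℂ)) := by
    rintro ⟨a, ha⟩
    rw [Set.Finite.mem_toFinset] at ha
    exact ContinuousLinearMap.finite_dimensional_eigenspace hc _
      (Complex.ofReal_ne_zero.2 ha.1.ne)
  have hWfd : FiniteDimensional ℂ W := Submodule.finite_iSup _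
  have hbot : Wᗮ = ⊥ := by
    have := ContinuousLinearMap.orthogonalComplement_iSup_eigenspaces_eq_bot hc hs
    exact eq_bot_iff.2 (this ▸ Submodule.orthogonal_le hle)
  have htop : W = ⊤ := Submodule.orthogonal_eq_bot_iff.1 hbot
  rw [htop] at hWfd
  exact Module.Finite.equiv (Submodule.topEquiv (R := ℂ) (M := H))

end NegativeCompact

theorem not_finiteDimensional_Lp {X : Type*} [MeasurableSpace X] {ν : Measure X}
    [IsFiniteMeasure ν] {A : ℕ → Set X} (hA : ∀ k, MeasurableSet (A k))
    (hd : Pairwise (Function.onFun Disjoint A)) (h0 : ∀ k, ν (A k) ≠ 0) :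
    ¬ FiniteDimensional ℂ (Lp ℂ 2 ν) := by
  intro hfd
  have hne : ∀ k, indicatorConstLp 2 (hA k) (measure_ne_top ν _) (1 : ℂ) ≠ 0 := by
    intro k hk
    have h1 : ‖indicatorConstLp 2 (hA k) (measure_ne_top ν _) (1 : ℂ)‖ = 0 := by rw [hk, norm_zero]
    rw [norm_indicatorConstLp (by norm_num) (by norm_num), norm_one, one_mul] at h1
    rw [Real.rpow_eq_zero measureReal_nonneg (by norm_num)] at h1
    exact h0 k ((measureReal_eq_zero_iff (measure_ne_top ν _)).1 h1)
  have hli : LinearIndependent ℂ fun k => indicatorConstLp 2 (hA k) (measure_ne_top ν _) (1 : ℂ) := by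
    refine linearIndependent_of_ne_zero_of_inner_eq_zero hne fun k l hkl => ?_
    simp only
    rw [integral_conj_mul_eq_inner]
    refine integral_eq_zero_of_ae ?_
    filter_upwards [indicatorConstLp_coeFn (p := 2) (hs := hA k) (hμs := measure_ne_top ν _)
      (c := (1 : ℂ)), indicatorConstLp_coeFn (p := 2) (hs := hA l) (hμs := measure_ne_top ν _)
      (c := (1 : ℂ))] with x h1 h2
    rw [h1, h2]
    by_cases hx : x ∈ A k
    · have : x ∉ A l := fun h => (Set.disjoint_left.1 (hd hkl)) hx h
      simp [this]
    · simp [hx]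
  exact not_finite_iff_infinite.2 inferInstance hli.finite

/-! ### Comparison of the two operators -/

section Comparison

open Filter Topology Set
open scoped ENNReal NNReal

/-- A finite Hermitian form that is close to a negative diagonal form is negative. -/
theorem re_sum_sum_neg {ι : Type*} [Fintype ι] {M : ι → ι → ℂ} {μ : ι → ℝ}
    (hμ : ∀ i, 0 < μ i) {d : ι → ι → ℝ} (hd0 : ∀ i j, 0 ≤ d i j)
    (hdiag : ∀ i, (M i i).re ≤ -μ i + d i i) (hoff : ∀ i j, i ≠ j → ‖M i j‖ ≤ d i j)
    (hd : ∀ i j, d i j * (Fintype.card ι + 1) ≤ μ i) (hd' : ∀ i j, d i j * (Fintype.card ι + 1) ≤ μ j)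
    {c : ι → ℂ} (hc : c ≠ 0) : (∑ i, ∑ j, conj (c i) * c j * M i j).re < 0 := by
  classical
  set N : ℝ := ((Fintype.card ι : ℕ) : ℝ) with hN
  have hN0 : 0 ≤ N := Nat.cast_nonneg _
  set S : ℝ := ∑ i, μ i * ‖c i‖ ^ 2 with hS
  have hS0 : 0 < S := by
    obtain ⟨i, hi⟩ := Function.ne_iff.1 hc
    refine Finset.sum_pos' (fun j _ => mul_nonneg (hμ j).le (sq_nonneg _)) ⟨i, Finset.mem_univ i, ?_⟩
    have : 0 < ‖c i‖ := norm_pos_iff.2 hi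
    have := hμ i
    positivity
  have hterm : ∀ i j, (conj (c i) * c j * M i j).re ≤ (if i = j then -(μ i * ‖c i‖ ^ 2) else 0) +
      (μ i * ‖c i‖ ^ 2 + μ j * ‖c j‖ ^ 2) / (2 * (N + 1)) := by
    intro i j
    have h1 : d i j * (‖c i‖ * ‖c j‖) ≤ (μ i * ‖c i‖ ^ 2 + μ j * ‖c j‖ ^ 2) / (2 * (N + 1)) := by
      rw [le_div_iff₀ (by positivity)]
      have h2 : d i j * (N + 1) * ‖c i‖ ^ 2 ≤ μ i * ‖c i‖ ^ 2 := by gcongr; exact hd i j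
      have h3 : d i j * (N + 1) * ‖c j‖ ^ 2 ≤ μ j * ‖c j‖ ^ 2 := by gcongr; exact hd' i j
      have h4 : 0 ≤ d i j * (N + 1) * (‖c i‖ - ‖c j‖) ^ 2 := by
        have := hd0 i j
        positivity
      nlinarith
    by_cases hij : i = j
    · subst hij
      rw [if_pos rfl]
      have e : (conj (c i) * c i * M i i).re = ‖c i‖ ^ 2 * (M i i).re := by
        rw [mul_comm (conj (c i)), Complex.mul_conj, Complex.normSq_eq_norm_sq, Complex.re_ofReal_mul]
      rw [e]
      have h2 := mul_le_mul_of_nonneg_left (hdiag i) (sq_nonneg ‖c i‖)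
      nlinarith
    · rw [if_neg hij, zero_add]
      refine ((Complex.re_le_norm _).trans ?_).trans h1
      rw [norm_mul, norm_mul, RCLike.norm_conj, mul_comm]
      gcongr
      exact hoff i j hij
  -- Summed over all pairs, the symmetrized errors amount to `N S / (N + 1)`, which is less than the
  -- diagonal gain `S`.
  have hsum : (∑ i, ∑ j, conj (c i) * c j * M i j).re ≤ -S + N * S / (N + 1) := by
    simp only [Complex.re_sum]
    refine (Finset.sum_le_sum fun i _ => Finset.sum_le_sum fun j _ => hterm i j).trans (le_of_eq ?_)
    simp only [Finset.sum_add_distrib, Finset.sum_ite_eq, Finset.mem_univ, if_true,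
      Finset.sum_neg_distrib, ← Finset.sum_div, Finset.sum_const, Finset.card_univ, nsmul_eq_mul,
      ← Finset.mul_sum]
    rw [← hS, ← hN]
    field_simp
    ring
  have : -S + N * S / (N + 1) = -(S / (N + 1)) := by field_simp; ring
  rw [this] at hsum
  have : 0 < S / (N + 1) := by positivity
  linarith

/-- Pulling back along `D` replaces the integrals by inner products, where sesquilinearity needs no
integrability of cross terms. -/
theorem energyForm_sum {n : ℕ} (hn : 0 < n) {P V : E n → ℝ} {Ω : Set (E n)} {r s : ℝ}
    (hT : KineticAssumptions P Ω r s) (hV : PotentialAssumptions (symbol P r) s V) {lam : ℝ}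
    (hlam : 0 < lam) {ι : Type*} [Fintype ι] (ψ : ι → L2 n)
    (hψ : ∀ i, ψ i ∈ formDomain (symbol P r) V) (c : ι → ℂ) :
    energyForm (symbol P r) V lam (∑ i, c i • ψ i) (∑ i, c i • ψ i) =
      ∑ i, ∑ j, conj (c i) * c j * energyForm (symbol P r) V lam (ψ i) (ψ j) := by
  obtain ⟨d⟩ := nonempty_pencilData hn hT hV hlam
  choose f hf using fun i => (d.range_D _).1 (hψ i)
  have e : ∑ i, c i • ψ i = d.D (∑ i, c i • f i) := by
    simp only [map_sum, map_smul, hf]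
  rw [e, d.energyForm_eq]
  simp only [← hf, d.energyForm_eq]
  simp only [pform, map_sum, map_smul, sum_inner, inner_sum, inner_smul_left, inner_smul_right,
    Finset.mul_sum, ← Finset.sum_add_distrib, ← Finset.sum_sub_distrib]
  rw [Finset.sum_comm]
  refine Finset.sum_congr rfl fun i _ => Finset.sum_congr rfl fun j _ => ?_
  ring

/-- The kinetic part is an inner product of vectors tending to zero in `L²`; the potential part
converges by dominated convergence with majorant `C C' |V|`. -/
theorem tendsto_energyForm {n : ℕ} {T V : E n → ℝ} (hT0 : ∀ p, 0 ≤ T p) (hV : Integrable V)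
    (lam : ℝ) {ψ ψ' : ℕ → L2 n} {C C' : ℝ} {h h' : E n → ℂ}
    (h1 : ∀ k, ∀ᵐ x, ‖ψ k x‖ ≤ C) (h2 : ∀ᵐ x, Tendsto (fun k => ψ k x) atTop (𝓝 (h x)))
    (h3 : ∀ k, MemLp (fun ξ => (√(T ((2 * Real.pi) • ξ)) : ℂ) * (𝓕 (ψ k) : L2 n) ξ) 2)
    (h4 : Tendsto (fun k => eLpNorm (fun ξ => (√(T ((2 * Real.pi) • ξ)) : ℂ) *
      (𝓕 (ψ k) : L2 n) ξ) 2 volume) atTop (𝓝 0))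
    (h1' : ∀ k, ∀ᵐ x, ‖ψ' k x‖ ≤ C') (h2' : ∀ᵐ x, Tendsto (fun k => ψ' k x) atTop (𝓝 (h' x)))
    (h3' : ∀ k, MemLp (fun ξ => (√(T ((2 * Real.pi) • ξ)) : ℂ) * (𝓕 (ψ' k) : L2 n) ξ) 2)
    (h4' : Tendsto (fun k => eLpNorm (fun ξ => (√(T ((2 * Real.pi) • ξ)) : ℂ) *
      (𝓕 (ψ' k) : L2 n) ξ) 2 volume) atTop (𝓝 0)) :
    Tendsto (fun k => energyForm T V lam (ψ k) (ψ' k)) atTop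
      (𝓝 (lam * ∫ x, (V x : ℂ) * (conj (h x) * h' x))) := by
  have hkin : Tendsto (fun k => ∫ ξ, kineticDensity T (ψ k) (ψ' k) ξ) atTop (𝓝 0) := by
    have e : ∀ k, ∫ ξ, kineticDensity T (ψ k) (ψ' k) ξ =
        inner ℂ ((h3 k).toLp _) ((h3' k).toLp _) := by
      intro k
      rw [integral_conj_mul_eq_inner]
      refine integral_congr_ae ?_
      filter_upwards [(h3 k).coeFn_toLp, (h3' k).coeFn_toLp] with ξ e1 e2
      have e3 : ((T ((2 * Real.pi) • ξ) : ℝ) : ℂ) =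
          (√(T ((2 * Real.pi) • ξ)) : ℂ) * (√(T ((2 * Real.pi) • ξ)) : ℂ) := by
        rw [← Complex.ofReal_mul, Real.mul_self_sqrt (hT0 _)]
      rw [e1, e2, kineticDensity, e3, map_mul, Complex.conj_ofReal]
      ring
    have hz := (ENNReal.tendsto_toReal ENNReal.zero_ne_top).comp h4
    have hz' := (ENNReal.tendsto_toReal ENNReal.zero_ne_top).comp h4'
    have hm := hz.mul hz'
    rw [ENNReal.toReal_zero, mul_zero] at hm
    refine squeeze_zero_norm (fun k => ?_) hm
    rw [e]
    refine (norm_inner_le_norm _ _).trans (le_of_eq ?_)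
    rw [Lp.norm_toLp, Lp.norm_toLp]
    rfl
  have hpot : Tendsto (fun k => ∫ x, potentialDensity V (ψ k) (ψ' k) x) atTop
      (𝓝 (∫ x, (V x : ℂ) * (conj (h x) * h' x))) := by
    refine tendsto_integral_of_dominated_convergence (fun x => ‖V x‖ * (C * C')) (fun k => ?_)
      (hV.norm.mul_const _) (fun k => ?_) ?_
    · refine (hV.ofReal (𝕜 := ℂ)).1.mul (AEStronglyMeasurable.mul ?_ (Lp.aestronglyMeasurable _))
      exact Complex.continuous_conj.comp_aestronglyMeasurable (Lp.aestronglyMeasurable _)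
    · filter_upwards [h1 k, h1' k] with x e1 e2
      rw [potentialDensity, norm_mul, norm_mul, RCLike.norm_conj, Complex.norm_real]
      have := (norm_nonneg _).trans e1
      gcongr
    · filter_upwards [h2, h2'] with x e1 e2
      exact (((Complex.continuous_conj.tendsto _).comp e1).mul e2).const_mul _
  have := hkin.add (hpot.const_mul (lam : ℂ))
  rw [zero_add] at this
  exact this

theorem mem_formDomain_of_bounded {n : ℕ} {T V : E n → ℝ} (hV : Integrable V) {ψ : L2 n} {C : ℝ}
    (h1 : ∀ᵐ x, ‖ψ x‖ ≤ C)
    (h3 : MemLp (fun ξ => (√(T ((2 * Real.pi) • ξ)) : ℂ) * (𝓕 ψ : L2 n) ξ) 2) :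
    ψ ∈ formDomain T V := by
  have hm : AEStronglyMeasurable (fun x => (√|V x| : ℂ)) :=
    (Complex.measurable_ofReal.comp_aemeasurable
      hV.aestronglyMeasurable.aemeasurable.abs.sqrt).aestronglyMeasurable
  have hs : MemLp (fun x => (√|V x| : ℂ)) 2 := by
    rw [memLp_two_iff_integrable_sq_norm hm]
    refine hV.abs.congr (Eventually.of_forall fun x => ?_)
    simp only [Complex.norm_real, Real.norm_of_nonneg (Real.sqrt_nonneg _),
      Real.sq_sqrt (abs_nonneg _)]
  refine ⟨h3, MemLp.of_le_mul (c := C) hs (hm.mul (Lp.aestronglyMeasurable _)) ?_⟩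
  filter_upwards [h1] with x hx
  rw [norm_mul, mul_comm]
  gcongr

variable {m : ℕ} {P V : E (m + 1) → ℝ} {Ω : Set (E (m + 1))} {r s : ℝ}

/-- Orthonormal eigenfunctions of the operator on the surface with negative eigenvalues yield
negative eigenvalues of the Hamiltonian. -/
theorem card_le_numNegEigenvalues_of_orthonormal (hT : KineticAssumptions P Ω r s)
    (hV : PotentialAssumptions (symbol P r) s V)
    {Λ : Lp ℂ 2 (surfaceMeasure (zeroSet P r)) →L[ℂ] Lp ℂ 2 (surfaceMeasure (zeroSet P r))}
    (hΛ : ∀ u v : Lp ℂ 2 (surfaceMeasure (zeroSet P r)),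
        ∫ x, (V x : ℂ) * (conj (surfaceExtend P r u x) * surfaceExtend P r v x) =
        (((2 * Real.pi) ^ (m + 1) : ℝ) : ℂ) * inner ℂ u (Λ v))
    {ι : Type*} [Fintype ι] {u : ι → Lp ℂ 2 (surfaceMeasure (zeroSet P r))}
    (hu : Orthonormal ℂ u) {a : ι → ℝ} (ha : ∀ i, a i < 0) (hua : ∀ i, Λ (u i) = (a i : ℂ) • u i)
    {lam : ℝ} (hlam : 0 < lam) :
    (Fintype.card ι : ℕ∞) ≤ numNegEigenvalues (hamiltonian (symbol P r) V lam) := by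
  classical
  have hV1 : Integrable V := memLp_one_iff_integrable.1 hV.integrable
  choose ψ C h1 h2 h3 h4 using fun i => hT.approximable (hT.memLp_gradWeight_mul (Lp.memLp (u i)))
  set b : ℝ := lam * (2 * Real.pi) ^ (m + 1) with hb
  have hb0 : 0 < b := by positivity
  have hlim : ∀ i j, Tendsto (fun k => energyForm (symbol P r) V lam (ψ i k) (ψ j k)) atTop
      (𝓝 (if i = j then ((b * a i : ℝ) : ℂ) else 0)) := by
    intro i j
    have h := tendsto_energyForm (symbol_nonneg P r) hV1 lam (h1 i) (h2 i) (h3 i) (h4 i) (h1 j)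
      (h2 j) (h3 j) (h4 j)
    have e : (lam : ℂ) * ∫ x, (V x : ℂ) * (conj (surfaceExtend P r (u i) x) *
        surfaceExtend P r (u j) x) = if i = j then ((b * a i : ℝ) : ℂ) else 0 := by
      rw [hΛ, hua, inner_smul_right, orthonormal_iff_ite.1 hu i j]
      by_cases hij : i = j
      · subst hij
        simp only [if_true, hb, Complex.ofReal_mul]
        ring
      · simp [hij]
    rw [← e]
    exact h
  set μ : ι → ℝ := fun i => -(b * a i) with hμ
  have hμ0 : ∀ i, 0 < μ i := fun i => neg_pos.2 (mul_neg_of_pos_of_neg hb0 (ha i))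
  set N : ℝ := ((Fintype.card ι : ℕ) : ℝ) with hN
  have hN0 : 0 ≤ N := Nat.cast_nonneg _
  -- This tolerance is what `re_sum_sum_neg` requires; one `k` serves all pairs because `ι` is
  -- finite.
  have hev : ∀ᶠ k in atTop, ∀ i j, ‖energyForm (symbol P r) V lam (ψ i k) (ψ j k) -
      (if i = j then ((b * a i : ℝ) : ℂ) else 0)‖ < min (μ i) (μ j) / (N + 1) := by
    rw [eventually_all]
    intro i
    rw [eventually_all]
    intro j
    have hpos : 0 < min (μ i) (μ j) / (N + 1) := div_pos (lt_min (hμ0 i) (hμ0 j)) (by positivity)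
    have h := (tendsto_iff_norm_sub_tendsto_zero.1 (hlim i j))
    exact h.eventually (gt_mem_nhds hpos)
  obtain ⟨k, hk⟩ := hev.exists
  have hdom : ∀ i, ψ i k ∈ formDomain (symbol P r) V := fun i =>
    mem_formDomain_of_bounded hV1 (h1 i k) (h3 i k)
  refine card_le_numNegEigenvalues_hamiltonian (Nat.succ_pos m) hT hV hlam (fun i => ψ i k) hdom
    fun c hc => ?_
  rw [energyForm_sum (Nat.succ_pos m) hT hV hlam _ hdom]
  refine re_sum_sum_neg hμ0 (d := fun i j => min (μ i) (μ j) / (N + 1)) (fun i j => ?_)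
    (fun i => ?_) (fun i j hij => ?_) (fun i j => ?_) (fun i j => ?_) hc
  · exact (div_pos (lt_min (hμ0 i) (hμ0 j)) (by positivity)).le
  · have h := (Complex.re_le_norm _).trans (hk i i).le
    rw [if_pos rfl, Complex.sub_re, Complex.ofReal_re] at h
    simp only [hμ] at h ⊢
    linarith
  · have h := hk i j
    rw [if_neg hij, sub_zero] at h
    exact h.le
  · rw [div_mul_cancel₀ _ (by positivity)]
    exact min_le_left _ _
  · rw [div_mul_cancel₀ _ (by positivity)]
    exact min_le_right _ _

theorem isSymmetric_surface_clm
    {Λ : Lp ℂ 2 (surfaceMeasure (zeroSet P r)) →L[ℂ] Lp ℂ 2 (surfaceMeasure (zeroSet P r))}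
    (hΛ : ∀ u v : Lp ℂ 2 (surfaceMeasure (zeroSet P r)),
        ∫ x, (V x : ℂ) * (conj (surfaceExtend P r u x) * surfaceExtend P r v x) =
        (((2 * Real.pi) ^ (m + 1) : ℝ) : ℂ) * inner ℂ u (Λ v)) :
    (Λ : Lp ℂ 2 (surfaceMeasure (zeroSet P r)) →ₗ[ℂ] _).IsSymmetric := by
  intro u v
  change inner ℂ (Λ u) v = inner ℂ u (Λ v)
  have hd : (((2 * Real.pi) ^ (m + 1) : ℝ) : ℂ) ≠ 0 :=
    Complex.ofReal_ne_zero.2 (by positivity)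
  refine mul_left_cancel₀ hd ?_
  rw [← hΛ, ← inner_conj_symm]
  have h := congrArg (starRingEnd ℂ) (hΛ v u)
  rw [map_mul, Complex.conj_ofReal] at h
  rw [← h, ← integral_conj]
  refine integral_congr_ae (Eventually.of_forall fun x => ?_)
  simp only [map_mul, Complex.conj_ofReal, Complex.conj_conj]
  ring

/-- It suffices to bound each finite partial sum. Eigenspaces of a symmetric operator are mutually
orthogonal, so orthonormal bases of finitely many of them combine to an orthonormal family of the
right cardinality. -/
theorem numNegEigenvalues_surface_le (hT : KineticAssumptions P Ω r s)
    (hV : PotentialAssumptions (symbol P r) s V) {lam : ℝ} (hlam : 0 < lam) :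
    numNegEigenvalues (surfaceOperator P r V) ≤
      numNegEigenvalues (hamiltonian (symbol P r) V lam) := by
  obtain ⟨Λ, hc, he, hΛ⟩ := hT.exists_surface_clm (memLp_one_iff_integrable.1 hV.integrable)
  have hs := isSymmetric_surface_clm hΛ
  refine iSup_le fun F => ?_
  have heq : ∀ a : ℝ, eigenspace (surfaceOperator P r V) a =
      Module.End.eigenspace (Λ : Lp ℂ 2 (surfaceMeasure (zeroSet P r)) →ₗ[ℂ] _) (a : ℂ) := by
    intro a
    ext u
    rw [he, Module.End.mem_eigenspace_iff]
    rfl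
  set G : F → Submodule ℂ (Lp ℂ 2 (surfaceMeasure (zeroSet P r))) := fun a =>
    Module.End.eigenspace (Λ : Lp ℂ 2 (surfaceMeasure (zeroSet P r)) →ₗ[ℂ] _) ((a.1.1 : ℝ) : ℂ) with hG
  have hfd : ∀ a : F, FiniteDimensional ℂ (G a) := fun a =>
    ContinuousLinearMap.finite_dimensional_eigenspace hc _ (Complex.ofReal_ne_zero.2 a.1.2.ne)
  have hinj : Function.Injective fun a : F => ((a.1.1 : ℝ) : ℂ) := fun a a' h =>
    Subtype.ext (Subtype.ext (Complex.ofReal_injective h))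
  have hort := (hs.orthogonalFamily_eigenspaces.comp hinj).orthonormal_sigma_orthonormal
    (v_family := fun a => stdOrthonormalBasis ℂ (G a)) fun a => (stdOrthonormalBasis ℂ (G a)).orthonormal
  have hcard := card_le_numNegEigenvalues_of_orthonormal hT hV hΛ hort
    (a := fun z => z.1.1.1) (fun z => z.1.1.2)
    (fun z => Module.End.mem_eigenspace_iff.1 (stdOrthonormalBasis ℂ (G z.1) z.2).2) hlam
  refine le_trans (le_of_eq ?_) hcard
  rw [Fintype.card_sigma, Nat.cast_sum, ← Finset.sum_coe_sort F]
  refine Finset.sum_congr rfl fun a _ => ?_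
  have : FiniteDimensional ℂ (eigenspace (surfaceOperator P r V) (a.1.1)) := by
    rw [heq]; exact hfd a
  rw [eigenMultiplicity_eq_finrank, Fintype.card_fin, heq]

theorem infinite_surface_eigenvalues (hm : 1 ≤ m) (hT : KineticAssumptions P Ω r s)
    (hV : Integrable V) (hneg : ∀ᵐ x, V x ≤ 0) (hne : ¬ ∀ᵐ x, V x = 0) :
    {a : ℝ | a < 0 ∧ IsEigenvalue (surfaceOperator P r V) a}.Infinite := by
  obtain ⟨Λ, hc, he, hΛ⟩ := hT.exists_surface_clm hV
  have hs := isSymmetric_surface_clm hΛ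
  have := hT.isFiniteMeasure_surfaceMeasure
  have hmem : ∀ᵐ q ∂(surfaceMeasure (zeroSet P r)), q ∈ zeroSet P r :=
    ae_restrict_mem hT.isCompact_zeroSet.measurableSet
  obtain ⟨A, hA, hAd, hA0⟩ := hT.exists_disjoint_seq hm
  refine (infinite_setOf_neg_eigenvalue hc hs (fun u hu => ?_)
    (not_finiteDimensional_Lp hA hAd hA0)).mono ?_
  rotate_left
  · rintro a ⟨ha, u, hu, hua⟩
    refine ⟨ha, fun hbot => hu ?_⟩
    have : u ∈ eigenspace (surfaceOperator P r V) a := (he a u).2 hua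
    rw [hbot] at this
    exact this
  · have hg : Integrable (fun q => (gradWeight P q : ℂ) * u q) (surfaceMeasure (zeroSet P r)) :=
      (hT.memLp_gradWeight_mul (Lp.memLp u)).integrable (by norm_num)
    set h : E (m + 1) → ℂ := surfaceExtend P r u with hh
    have hhc : Continuous h := continuous_extend hg
    have hint : Integrable fun x => -V x * ‖h x‖ ^ 2 := by
      refine hV.neg.mul_bdd (c := (∫ q, ‖(gradWeight P q : ℂ) * u q‖
        ∂(surfaceMeasure (zeroSet P r))) ^ 2) (by fun_prop) (Eventually.of_forall fun x => ?_)
      rw [norm_pow, norm_norm]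
      gcongr
      exact norm_extend_le x
    have h0 : ∀ᵐ x, 0 ≤ -V x * ‖h x‖ ^ 2 := by
      filter_upwards [hneg] with x hx
      exact mul_nonneg (by linarith) (sq_nonneg _)
    have hpos : 0 < ∫ x, -V x * ‖h x‖ ^ 2 := by
      refine lt_of_le_of_ne (integral_nonneg_of_ae h0) fun heq => hu ?_
      have hz := (integral_eq_zero_iff_of_nonneg_ae h0 hint).1 heq.symm
      -- Since `V |h|² = 0` almost everywhere, `V` would vanish almost everywhere if `h` had only a
      -- null set of zeros.
      have hZ : volume {x | h x = 0} ≠ 0 := by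
        intro hv
        refine hne ?_
        have hv' : ∀ᵐ x, h x ≠ 0 := by
          rw [ae_iff]
          simpa using hv
        filter_upwards [hz, hv'] with x h1 h2
        rw [Pi.zero_apply, mul_eq_zero, neg_eq_zero] at h1
        exact h1.resolve_right (pow_ne_zero 2 (norm_ne_zero_iff.2 h2))
      obtain ⟨R, hR⟩ := hT.isCompact_zeroSet.isBounded.exists_norm_le
      have hall := extend_eq_zero_of_measure_ne_zero (hmem.mono fun q hq => hR q hq) hg hZ
      have hg0 := ae_eq_zero_of_extend hg hall
      apply Lp.ext
      filter_upwards [hg0, hmem, Lp.coeFn_zero ℂ 2 (surfaceMeasure (zeroSet P r))] with q h1 h2 h3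
      rw [h3]
      exact (mul_eq_zero.1 h1).resolve_left (Complex.ofReal_ne_zero.2 (hT.gradWeight_pos h2).ne')
    have e := hΛ u u
    have e1 : ∫ x, (V x : ℂ) * (conj (h x) * h x) = ((-∫ x, -V x * ‖h x‖ ^ 2 : ℝ) : ℂ) := by
      rw [← integral_neg, ← integral_complex_ofReal]
      refine integral_congr_ae (Eventually.of_forall fun x => ?_)
      simp only
      rw [mul_comm (conj (h x)), Complex.mul_conj, Complex.normSq_eq_norm_sq]
      push_cast
      ring
    rw [e1] at e
    have e2 := congrArg Complex.re e
    rw [Complex.ofReal_re, Complex.re_ofReal_mul] at e2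
    have hd : (0 : ℝ) < (2 * Real.pi) ^ (m + 1) := by positivity
    by_contra hcon
    have := mul_nonneg hd.le (not_lt.1 hcon)
    linarith

theorem numNegEigenvalues_eq_top_of_infinite {X : Type*} [AddCommGroup X] [Module ℂ X]
    {A : X →ₗ.[ℂ] X} (h : {a : ℝ | a < 0 ∧ IsEigenvalue A a}.Infinite) :
    numNegEigenvalues A = ⊤ := by
  rw [ENat.eq_top_iff_forall_ge]
  intro N
  obtain ⟨t, ht, hcard⟩ := h.exists_subset_card_eq N
  set F : Finset {a : ℝ // a < 0} := t.subtype (fun a => a < 0) with hF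
  have hFc : F.card = N := by
    rw [hF, Finset.card_subtype, Finset.filter_true_of_mem (fun a ha => (ht ha).1), hcard]
  refine le_trans ?_ (le_iSup _ F)
  calc (N : ℕ∞) = ∑ a ∈ F, 1 := by rw [Finset.sum_const, hFc]; simp
    _ ≤ _ := Finset.sum_le_sum fun a ha => one_le_eigenMultiplicity (ht (Finset.mem_subtype.1 ha)).2

end Comparison

end DegenerateSymbol

end

theorem mainTheorem2 {n : ℕ} (hn : 2 ≤ n) (P : E n → ℝ) (Ω : Set (E n)) (r s : ℝ)
    (hT : KineticAssumptions P Ω r s) (V : E n → ℝ)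
    (hV : PotentialAssumptions (symbol P r) s V) :
    (∀ lam : ℝ, 0 < lam →
      numNegEigenvalues (surfaceOperator P r V) ≤
        numNegEigenvalues (hamiltonian (symbol P r) V lam)) ∧
    ((∀ᵐ x, V x ≤ 0) → ¬ (∀ᵐ x, V x = 0) →
      {a : ℝ | a < 0 ∧ IsEigenvalue (surfaceOperator P r V) a}.Infinite ∧
      ∀ lam : ℝ, 0 < lam →
        {a : ℝ | a < 0 ∧ IsEigenvalue (hamiltonian (symbol P r) V lam) a}.Infinite) := by
  obtain ⟨m, rfl⟩ : ∃ m, n = m + 1 := ⟨n - 1, by omega⟩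
  have hV1 : Integrable V := memLp_one_iff_integrable.1 hV.integrable
  refine ⟨fun lam hlam => numNegEigenvalues_surface_le hT hV hlam, fun hneg hne => ?_⟩
  have hinf := infinite_surface_eigenvalues (by omega) hT hV1 hneg hne
  -- The comparison makes the count with multiplicity infinite; distinctness comes from the finite
  -- multiplicity of each negative eigenvalue.
  refine ⟨hinf, fun lam hlam => infinite_of_numNegEigenvalues_eq_top
    (fun a ha => finiteDimensional_eigenspace_hamiltonian (Nat.succ_pos m) hT hV hlam ha)
    (top_le_iff.1 ?_)⟩
  rw [← numNegEigenvalues_eq_top_of_infinite hinf]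
  exact numNegEigenvalues_surface_le hT hV hlam
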